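/- Let $\Gamma$ be a compact connected metric graph with finite vertex set $V$ and finite edge set $E$ (loops and multiple edges allowed), let $q:\Gamma\to\mathbb R$ be piecewise continuous, and let $\beta=|E|-|V|+1$. Let $H^0$ act as $f\mapsto -f''+qf$ on the complex-valued functions $f$ that are in $H^2(e)$ for each edge $e$, are continuous at every vertex $v$, and satisfy $\sum_{e\ni v}\frac{df}{dx_e}(v)=\chi_v f(v)$ with $\chi_v\in\mathbb R$, where the sum runs over the edge ends at $v$ and derivatives are taken into the edges; at vertices of degree one the Dirichlet condition $f(v)=0$ is allowed instead. Eigenvalues are numbered $\lambda_1\le\lambda_2\le\dots$ with multiplicity. Choose a spanning tree of $\Gamma$ and, in the interior of each of the $\beta$ edges outside it, a point $c_j$, $j=1,\dots,\beta$. Cutting $\Gamma$ at every $c_j$ gives a metric tree $T$ in which $c_j$ is replaced by two vertices $c_j^+$ and $c_j^-$ of degree one. For $\boldsymbol\gamma\in\mathbb R^\beta$ let $H_{\boldsymbol\gamma}$ act as $f\mapsto -f''+qf$ on the real-valued functions that are in $H^2$ on each edge of $T$, satisfy the given conditions at the vertices of $\Gamma$, and satisfy $$f'(c_j^+)=\gamma_j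 f(c_j^+),\qquad f'(c_j^-)=-\gamma_j f(c_j^-),\qquad j=1,\dots,\beta,$$ with derivatives taken into the edges of $T$. Let $\lambda_n(H^0)$ be a simple eigenvalue with real eigenfunction $\psi$, and assume that $\psi$ is non-zero at all vertices of $\Gamma$ that do not carry the Dirichlet condition and at all cut points $c_j$. Let $\phi$ be the (finite) number of zeros of $\psi$ on $\Gamma$, Dirichlet vertices not counted, and let $\widetilde{\boldsymbol\gamma}=(\tilde\gamma_1,\dots,\tilde\gamma_\beta)$ with $\tilde\gamma_j=\psi'(c_j^+)/\psi(c_j^+)$. Then 1. $\lambda_{\phi+1}(H_{\widetilde{\boldsymbol\gamma}})=\lambda_n(H^0)$; 2. the function $\boldsymbol\gamma\mapsto\lambda_{\phi+1}(H_{\boldsymbol\gamma})$ on $\mathbb R^\beta$ is twice continuously differentiable near $\widetilde{\boldsymbol\gamma}$, and $\widetilde{\boldsymbol\gamma}$ is a non-degenerate critical point of it; 3. the Morse index of this critical point is $n-1+\beta-\phi$. -/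

import Mathlib

open MeasureTheory

/-- `q` is piecewise continuous on `[a, b]`: continuous off a finite set, with finite one-sided
limits at every point of the interval. -/
def PiecewiseContinuous (q : ℝ → ℝ) (a b : ℝ) : Prop :=
  (∃ S : Finset ℝ, ContinuousOn q (Set.Icc a b \ S)) ∧
  (∀ x ∈ Set.Ico a b, ∃ l, Filter.Tendsto q (nhdsWithin x (Set.Ioi x)) (nhds l)) ∧
  (∀ x ∈ Set.Ioc a b, ∃ l, Filter.Tendsto q (nhdsWithin x (Set.Iio x)) (nhds l))

theorem PiecewiseContinuous.mono {q : ℝ → ℝ} {a b a' b' : ℝ} (h : PiecewiseContinuous q a b)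
    (ha : a ≤ a') (hb : b' ≤ b) : PiecewiseContinuous q a' b' := by
  obtain ⟨⟨S, hS⟩, h₁, h₂⟩ := h
  refine ⟨⟨S, hS.mono ?_⟩, fun x hx => h₁ x ⟨ha.trans hx.1, hx.2.trans_le hb⟩,
    fun x hx => h₂ x ⟨ha.trans_lt hx.1, hx.2.trans hb⟩⟩
  exact Set.sdiff_subset_sdiff_left (Set.Icc_subset_Icc ha hb)

/-- `f` belongs to the Sobolev space `H²(a, b)` and `g ∈ L²(a, b)` is its second derivative:
`f` is differentiable on `[a, b]` (one-sidedly at the end points) and `f'` is the absolutely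
continuous function with derivative `g`. By convention `f` is extended by zero outside `[a, b]`, so
that a function on the edge is determined by its values on the edge. -/
structure HasSobolevSecondDeriv {𝕜 : Type*} [RCLike 𝕜] (a b : ℝ) (f g : ℝ → 𝕜) : Prop where
  eq_zero : ∀ x ∉ Set.Icc a b, f x = 0
  differentiableOn : DifferentiableOn ℝ f (Set.Icc a b)
  memLp : MemLp g 2 (volume.restrict (Set.Icc a b))
  deriv_eq : ∀ x ∈ Set.Icc a b,
    derivWithin f (Set.Icc a b) x = derivWithin f (Set.Icc a b) a + ∫ t in a..x, g t

/-- A compact metric graph with vertex set `V` and edge set `E` (loops and multiple edges are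
allowed), together with a Schrödinger potential and vertex conditions. The edge `e` is the interval
`[lo e, hi e]`, whose lower end is glued to the vertex `src e` and whose upper end to `tgt e`.
At a vertex `v ∉ dir` the `δ`-type condition with coefficient `χ v` is imposed; at `v ∈ dir`
the Dirichlet condition is imposed, which is allowed only at vertices of degree one. -/
structure QuantumGraph (V E : Type*) [DecidableEq V] [Fintype E] where
  src : E → V
  tgt : E → V
  lo : E → ℝ
  hi : E → ℝ
  lo_lt_hi : ∀ e, lo e < hi e
  q : E → ℝ → ℝ
  q_piecewise : ∀ e, PiecewiseContinuous (q e) (lo e) (hi e)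
  χ : V → ℝ
  dir : Set V
  degree_dir : ∀ v ∈ dir,
    ∑ e, ((if src e = v then 1 else 0) + (if tgt e = v then 1 else 0)) = (1 : ℕ)

namespace QuantumGraph

variable {V E : Type*} [DecidableEq V] [Fintype E] (G : QuantumGraph V E)

section Operator

variable (𝕜 : Type*) [RCLike 𝕜]

variable {𝕜} in
/-- The derivative of `f` along the edge `e` at the coordinate `x` (one-sided at the ends). -/
noncomputable def edgeDeriv (f : E → ℝ → 𝕜) (e : E) (x : ℝ) : 𝕜 :=
  derivWithin (f e) (Set.Icc (G.lo e) (G.hi e)) x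

variable {𝕜} in
/-- The sum over all edge ends at `v` of the derivatives of `f` taken into the edges. -/
noncomputable def flux (f : E → ℝ → 𝕜) (v : V) : 𝕜 :=
  ∑ e, ((if G.src e = v then G.edgeDeriv f e (G.lo e) else 0) +
    (if G.tgt e = v then -G.edgeDeriv f e (G.hi e) else 0))

variable {𝕜} in
/-- The vertex conditions: `f` is continuous at the vertices (with value `F v` at `v`), satisfies
the `δ`-type condition at the vertices outside `dir`, and vanishes at those in `dir`. -/
def VertexConditions (f : E → ℝ → 𝕜) : Prop :=
  ∃ F : V → 𝕜, (∀ e, f e (G.lo e) = F (G.src e)) ∧ (∀ e, f e (G.hi e) = F (G.tgt e)) ∧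
    (∀ v ∉ G.dir, G.flux f v = (G.χ v : 𝕜) * F v) ∧ (∀ v ∈ G.dir, F v = 0)

variable {𝕜} in
/-- `f` is in the domain of the Schrödinger operator `H : f ↦ -f'' + q f` of the quantum graph
and `H f = u` in `L²`. -/
def OperatorRel (f u : E → ℝ → 𝕜) : Prop :=
  ∃ g : E → ℝ → 𝕜, (∀ e, HasSobolevSecondDeriv (G.lo e) (G.hi e) (f e) (g e)) ∧
    G.VertexConditions f ∧
    ∀ e, ∀ᵐ x ∂(volume.restrict (Set.Icc (G.lo e) (G.hi e))),
      u e x = -g e x + (G.q e x : 𝕜) * f e x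

theorem edgeDeriv_add {f₁ f₂ : E → ℝ → 𝕜} {e : E} {x : ℝ}
    (hx : x ∈ Set.Icc (G.lo e) (G.hi e))
    (h₁ : DifferentiableOn ℝ (f₁ e) (Set.Icc (G.lo e) (G.hi e)))
    (h₂ : DifferentiableOn ℝ (f₂ e) (Set.Icc (G.lo e) (G.hi e))) :
    G.edgeDeriv (f₁ + f₂) e x = G.edgeDeriv f₁ e x + G.edgeDeriv f₂ e x :=
  derivWithin_add (h₁ x hx) (h₂ x hx)

theorem edgeDeriv_smul {f : E → ℝ → 𝕜} {e : E} {x : ℝ} (c : 𝕜)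
    (hx : x ∈ Set.Icc (G.lo e) (G.hi e))
    (h : DifferentiableOn ℝ (f e) (Set.Icc (G.lo e) (G.hi e))) :
    G.edgeDeriv (c • f) e x = c * G.edgeDeriv f e x :=
  derivWithin_const_smul c (h x hx)

theorem OperatorRel.add {f₁ f₂ u₁ u₂ : E → ℝ → 𝕜} (h₁ : G.OperatorRel f₁ u₁)
    (h₂ : G.OperatorRel f₂ u₂) : G.OperatorRel (f₁ + f₂) (u₁ + u₂) := by
  obtain ⟨g₁, a₁, ⟨F₁, b₁, c₁, d₁, e₁⟩, k₁⟩ := h₁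
  obtain ⟨g₂, a₂, ⟨F₂, b₂, c₂, d₂, e₂⟩, k₂⟩ := h₂
  have hl : ∀ e, G.lo e ∈ Set.Icc (G.lo e) (G.hi e) := fun e => ⟨le_rfl, (G.lo_lt_hi e).le⟩
  have hr : ∀ e, G.hi e ∈ Set.Icc (G.lo e) (G.hi e) := fun e => ⟨(G.lo_lt_hi e).le, le_rfl⟩
  have hint : ∀ (g : ℝ → 𝕜) (e : E), MemLp g 2 (volume.restrict (Set.Icc (G.lo e) (G.hi e))) →
      ∀ x ∈ Set.Icc (G.lo e) (G.hi e), IntervalIntegrable g volume (G.lo e) x := by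
    intro g e hg x hx
    have : IntegrableOn g (Set.Icc (G.lo e) (G.hi e)) volume :=
      hg.integrable (by norm_num)
    rw [intervalIntegrable_iff_integrableOn_Ioc_of_le hx.1]
    exact this.mono_set fun y hy => ⟨hy.1.le, hy.2.trans hx.2⟩
  have hd : ∀ e, ∀ x ∈ Set.Icc (G.lo e) (G.hi e),
      G.edgeDeriv (f₁ + f₂) e x = G.edgeDeriv f₁ e x + G.edgeDeriv f₂ e x := fun e x hx =>
    G.edgeDeriv_add 𝕜 hx (a₁ e).differentiableOn (a₂ e).differentiableOn
  refine ⟨g₁ + g₂, fun e => ⟨?_, ?_, ?_, ?_⟩, ⟨F₁ + F₂, ?_, ?_, ?_, ?_⟩, fun e => ?_⟩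
  · intro x hx
    simp [(a₁ e).eq_zero x hx, (a₂ e).eq_zero x hx]
  · exact (a₁ e).differentiableOn.add (a₂ e).differentiableOn
  · exact (a₁ e).memLp.add (a₂ e).memLp
  · intro x hx
    have p₁ := (a₁ e).deriv_eq x hx
    have p₂ := (a₂ e).deriv_eq x hx
    have q₁ := hd e x hx
    have q₂ := hd e _ (hl e)
    simp only [edgeDeriv] at q₁ q₂
    rw [q₁, q₂, p₁, p₂]
    have := intervalIntegral.integral_add (hint _ e (a₁ e).memLp x hx)
      (hint _ e (a₂ e).memLp x hx)
    simp only [Pi.add_apply]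
    rw [this]
    ring
  · intro e; simp [b₁, b₂]
  · intro e; simp [c₁, c₂]
  · intro v hv
    have : G.flux (f₁ + f₂) v = G.flux f₁ v + G.flux f₂ v := by
      simp only [flux]
      rw [← Finset.sum_add_distrib]
      refine Finset.sum_congr rfl fun e _ => ?_
      rw [hd e _ (hl e), hd e _ (hr e)]
      split_ifs <;> ring
    rw [this, d₁ v hv, d₂ v hv, Pi.add_apply, mul_add]
  · intro v hv; simp [e₁ v hv, e₂ v hv]
  · filter_upwards [k₁ e, k₂ e] with x hx₁ hx₂
    simp only [Pi.add_apply, hx₁, hx₂]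
    ring

theorem OperatorRel.smul {f u : E → ℝ → 𝕜} (c : 𝕜) (h : G.OperatorRel f u) :
    G.OperatorRel (c • f) (c • u) := by
  obtain ⟨g, a, ⟨F, b₁, b₂, b₃, b₄⟩, k⟩ := h
  have hl : ∀ e, G.lo e ∈ Set.Icc (G.lo e) (G.hi e) := fun e => ⟨le_rfl, (G.lo_lt_hi e).le⟩
  have hr : ∀ e, G.hi e ∈ Set.Icc (G.lo e) (G.hi e) := fun e => ⟨(G.lo_lt_hi e).le, le_rfl⟩
  have hd : ∀ e, ∀ x ∈ Set.Icc (G.lo e) (G.hi e),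
      G.edgeDeriv (c • f) e x = c * G.edgeDeriv f e x := fun e x hx =>
    G.edgeDeriv_smul 𝕜 c hx (a e).differentiableOn
  refine ⟨c • g, fun e => ⟨?_, ?_, ?_, ?_⟩, ⟨c • F, ?_, ?_, ?_, ?_⟩, fun e => ?_⟩
  · intro x hx
    simp [(a e).eq_zero x hx]
  · exact (a e).differentiableOn.const_smul c
  · exact (a e).memLp.const_smul c
  · intro x hx
    have p := (a e).deriv_eq x hx
    have q₁ := hd e x hx
    have q₂ := hd e _ (hl e)
    simp only [edgeDeriv] at q₁ q₂
    rw [q₁, q₂, p]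
    simp only [Pi.smul_apply, smul_eq_mul, intervalIntegral.integral_const_mul]
    ring
  · intro e; simp [b₁]
  · intro e; simp [b₂]
  · intro v hv
    have : G.flux (c • f) v = c * G.flux f v := by
      simp only [flux, Finset.mul_sum]
      refine Finset.sum_congr rfl fun e _ => ?_
      rw [hd e _ (hl e), hd e _ (hr e)]
      split_ifs <;> ring
    rw [this, b₃ v hv, Pi.smul_apply, smul_eq_mul]
    ring
  · intro v hv; simp [b₄ v hv]
  · filter_upwards [k e] with x hx
    simp only [Pi.smul_apply, smul_eq_mul, hx]
    ring

theorem OperatorRel.zero : G.OperatorRel (0 : E → ℝ → 𝕜) 0 := by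
  refine ⟨0, fun e => ⟨fun _ _ => rfl, ?_, ?_, ?_⟩, ⟨0, ?_, ?_, ?_, ?_⟩, fun e => ?_⟩
  · exact differentiableOn_const (0 : 𝕜)
  · exact MemLp.zero
  · intro x _
    simp
  all_goals simp [flux, edgeDeriv]

/-- The space of all `f` in the domain of `H` with `H f = μ f`. -/
def eigenspace (μ : ℝ) : Submodule 𝕜 (E → ℝ → 𝕜) where
  carrier := {f | G.OperatorRel f ((μ : 𝕜) • f)}
  add_mem' h₁ h₂ := by
    simpa only [Set.mem_ofPred_eq, smul_add] using OperatorRel.add G 𝕜 h₁ h₂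
  zero_mem' := by
    simpa only [Set.mem_ofPred_eq, smul_zero] using OperatorRel.zero G 𝕜
  smul_mem' c f h := by
    simpa only [Set.mem_ofPred_eq, smul_comm c (μ : 𝕜) f] using OperatorRel.smul G 𝕜 c h

/-- The number of eigenvalues of `H` in `s`, counted with multiplicity: the dimension of the span
of the corresponding eigenspaces. -/
noncomputable def eigenvalueCount (s : Set ℝ) : ℕ∞ :=
  Cardinal.toENat (Module.rank 𝕜 ↥(⨆ μ ∈ s, G.eigenspace 𝕜 μ))

/-- `μ` is the `m`-th eigenvalue of `H` in the order `λ₁ ≤ λ₂ ≤ …`, each eigenvalue being repeated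
according to its multiplicity: fewer than `m` eigenvalues are `< μ` and at least `m` are `≤ μ`. -/
def IsNthEigenvalue (m : ℕ) (μ : ℝ) : Prop :=
  G.eigenvalueCount 𝕜 (Set.Iio μ) < m ∧ m ≤ G.eigenvalueCount 𝕜 (Set.Iic μ)

end Operator

/-- The zeros of `f` in the interior of the edges, as pairs of an edge and a coordinate. -/
def internalZeros (f : E → ℝ → ℝ) : Set (E × ℝ) :=
  {p | p.2 ∈ Set.Ioo (G.lo p.1) (G.hi p.1) ∧ f p.1 p.2 = 0}

/-- `f` does not vanish at the vertices that carry a `δ`-type condition. -/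
def NonzeroOnVertices (f : E → ℝ → ℝ) : Prop :=
  ∀ e, (G.src e ∉ G.dir → f e (G.lo e) ≠ 0) ∧ (G.tgt e ∉ G.dir → f e (G.hi e) ≠ 0)

/-- `u` and `v` are joined by a path consisting of edges from `S`. -/
def Joined (S : Set E) : V → V → Prop :=
  Relation.EqvGen fun u v => ∃ e ∈ S, G.src e = u ∧ G.tgt e = v

/-- The edges in `S` connect all the vertices but form no cycles: no edge of `S` has its ends joined
by a path in the rest of `S`. -/
def IsSpanningTree (S : Finset E) : Prop :=
  (∀ u v, G.Joined S u v) ∧ ∀ e ∈ S, ¬ G.Joined (↑S \ {e}) (G.src e) (G.tgt e)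

/-- The first Betti number `|E| - |V| + 1`. -/
def betti [Fintype V] (_G : QuantumGraph V E) : ℤ := (Fintype.card E : ℤ) - (Fintype.card V : ℤ) + 1

variable [DecidableEq E]

/-- The quantum graph obtained by cutting every edge `j ∉ S` at the point with coordinate `c j`.
Its vertices are those of `G` (`inl v`), the vertices `c_j⁻` (`inr (inl j)`) and the vertices
`c_j⁺` (`inr (inr j)`). Its edges are those in `S` (`inl e`), and for every `j ∉ S` the pieces
`[lo j, c j]` (`inr (inl j)`), ending at `c_j⁻`, and `[c j, hi j]` (`inr (inr j)`), starting at
`c_j⁺`. The conditions at the vertices of `G` are kept; with derivatives taken into the edges,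
`f'(c_j⁺) = γ_j f(c_j⁺)` and `f'(c_j⁻) = -γ_j f(c_j⁻)` are imposed at the new ones. -/
def cut (S : Finset E) (c : {e // e ∉ S} → ℝ)
    (hc : ∀ j : {e // e ∉ S}, c j ∈ Set.Ioo (G.lo j) (G.hi j)) (γ : {e // e ∉ S} → ℝ) :
    QuantumGraph (V ⊕ {e // e ∉ S} ⊕ {e // e ∉ S})
      ({e // e ∈ S} ⊕ {e // e ∉ S} ⊕ {e // e ∉ S}) where
  src
    | .inl e => .inl (G.src e)
    | .inr (.inl j) => .inl (G.src j)
    | .inr (.inr j) => .inr (.inr j)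
  tgt
    | .inl e => .inl (G.tgt e)
    | .inr (.inl j) => .inr (.inl j)
    | .inr (.inr j) => .inl (G.tgt j)
  lo
    | .inl e => G.lo e
    | .inr (.inl j) => G.lo j
    | .inr (.inr j) => c j
  hi
    | .inl e => G.hi e
    | .inr (.inl j) => c j
    | .inr (.inr j) => G.hi j
  lo_lt_hi
    | .inl e => G.lo_lt_hi e
    | .inr (.inl j) => (hc j).1
    | .inr (.inr j) => (hc j).2
  q
    | .inl e => G.q e
    | .inr (.inl j) => G.q j
    | .inr (.inr j) => G.q j
  q_piecewise
    | .inl e => G.q_piecewise e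
    | .inr (.inl j) => (G.q_piecewise j).mono le_rfl (hc j).2.le
    | .inr (.inr j) => (G.q_piecewise j).mono (hc j).1.le le_rfl
  χ
    | .inl v => G.χ v
    | .inr (.inl j) => -γ j
    | .inr (.inr j) => γ j
  dir := Sum.inl '' G.dir
  degree_dir := by
    rintro _ ⟨v, hv, rfl⟩
    have h := G.degree_dir v hv
    rw [← Fintype.sum_subtype_add_sum_subtype (fun e => e ∈ S)] at h
    simp only [Fintype.sum_sum_type, Sum.inl.injEq, reduceCtorEq, if_false, add_zero, zero_add]
    rw [Finset.sum_add_distrib (s := (Finset.univ : Finset {e // e ∉ S}))] at h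
    convert h

end QuantumGraph

section Morse

variable {X : Type*} [NormedAddCommGroup X] [NormedSpace ℝ X]

/-- The Hessian of `Λ` at `x`, as a bilinear form. -/
noncomputable def hessianAt (Λ : X → ℝ) (x : X) : LinearMap.BilinForm ℝ X :=
  (fderiv ℝ (fderiv ℝ Λ) x).toBilinForm

/-- `Λ` is twice continuously differentiable near `x`, its derivative vanishes at `x`, and its
Hessian at `x` is non-degenerate. -/
def IsNondegenerateCriticalPoint (Λ : X → ℝ) (x : X) : Prop :=
  ContDiffAt ℝ 2 Λ x ∧ fderiv ℝ Λ x = 0 ∧ (hessianAt Λ x).Nondegenerate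

/-- The maximal dimension of a subspace on which the Hessian of `Λ` at `x` is negative definite. -/
noncomputable def morseIndex (Λ : X → ℝ) (x : X) : ℕ :=
  sigNeg (LinearMap.BilinMap.toQuadraticMap (hessianAt Λ x))

end Morse

/-! The spectral problem is reduced to finite-dimensional symmetric forms. Below a level `K`, cut
every edge into pieces so short that the Dirichlet problem on each piece is positive. Replacing each
piece by its Dirichlet-to-Neumann form gives a form on nodal values, smooth in the spectral
parameter `μ`. Its kernel consists of the nodal values of the eigenfunctions for `μ`, and its
negative index is the number of eigenvalues below `μ` (`exists_isReduction`,
`IsReduction.finrank_iSup_Iio`).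

On the cut tree this form is `R μ + D γ` with `D γ = ∑ γ j (p j ² - m j ²)`, where `p j` and `m j`
are the values at the two sides of the `j`-th cut. Let `B` be the form at the eigenvalue `ξ` and at
the logarithmic derivatives `γ₀` of `ψ`. Two indices of `B` are computed.

On the whole nodal space: `ψ` lies in the kernel of `B`, and the substitution `x = u ψ` turns `B`
into a sum over the pieces of a coefficient times the squared increment of `u`. The coefficient has
the sign of the product of the values of `ψ` at the two ends of the piece. On a tree the increments
are independent, so the negative index is the number of sign changes, which is the number `φ` of
zeros, and the kernel is spanned by `ψ`. Hence `ξ` is the eigenvalue number `φ + 1` of the cut graph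
(`negIndex_diagonal`, `internalZeros_finite_ncard`).

On the subspace `Y₀` where `p j = m j` for all `j`: the terms with `γ` cancel, and the form is that
of the uncut graph. As `ξ` is its simple `n`-th eigenvalue, the index is `n - 1` and the kernel is
again spanned by `ψ`.

The two indices are linked by perturbation theory (`exists_branch`). The implicit function theorem
gives a branch `Λ γ` with a kernel vector `w γ`. It is critical at `γ₀` because `p j ψ = m j ψ`, and
its Hessian is a negative multiple of `C = B (A ·) (A ·)`, where `A` is the derivative of `w`. The
range of `A` is `B`-orthogonal to `Y₀`, which has codimension `β`, and `C` is non-degenerate. A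
dimension count shows that the index of `B` is the sum of those of `C` and of `B` on `Y₀`. So `C`
has negative index `φ - (n - 1)`, and the Morse index is its positive index `β - φ + n - 1`. -/

section

open Filter Topology

set_option linter.unusedSectionVars false

/-! ### Negative index of inertia and its semicontinuity. -/

section Index

variable {Y : Type*} [NormedAddCommGroup Y] [NormedSpace ℝ Y]

/-- The negative index of inertia of a continuous bilinear form. -/
noncomputable def negIndex (B : Y →L[ℝ] Y →L[ℝ] ℝ) : ℕ :=
  sigNeg (LinearMap.BilinMap.toQuadraticMap B.toBilinForm)

variable [FiniteDimensional ℝ Y]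

theorem le_negIndex {B : Y →L[ℝ] Y →L[ℝ] ℝ} {U : Submodule ℝ Y}
    (hU : ∀ x ∈ U, x ≠ 0 → B x x < 0) : Module.finrank ℝ U ≤ negIndex B := by
  refine le_sigNeg_of_negDef _ fun x hx => ?_
  have := hU x x.2 (by simpa using hx)
  simpa using this

theorem exists_finrank_eq_negIndex (B : Y →L[ℝ] Y →L[ℝ] ℝ) :
    ∃ U : Submodule ℝ Y, Module.finrank ℝ U = negIndex B ∧ ∀ x ∈ U, x ≠ 0 → B x x < 0 := by
  obtain ⟨U, h₁, h₂⟩ :=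
    exists_finrank_eq_sigNeg_and_negDef (LinearMap.BilinMap.toQuadraticMap B.toBilinForm)
  refine ⟨U, h₁, fun x hx hx0 => ?_⟩
  have := h₂ ⟨x, hx⟩ (by simpa using hx0)
  simpa using this

/-- Sylvester's law of inertia: the positive index of `B` is the negative index of `-B`, and by
symmetry the radical of the quadratic form is the kernel. -/
theorem negIndex_neg_add {B : Y →L[ℝ] Y →L[ℝ] ℝ} (hB : ∀ x y, B x y = B y x) :
    negIndex (-B) + negIndex B + Module.finrank ℝ (LinearMap.ker B.toLinearMap) =
      Module.finrank ℝ Y := by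
  rw [← QuadraticForm.sigPos_add_sigNeg_add_radical
    (Q := LinearMap.BilinMap.toQuadraticMap B.toBilinForm)]
  have h₁ : negIndex (-B) = sigPos (LinearMap.BilinMap.toQuadraticMap B.toBilinForm) := by
    rw [negIndex, ← sigNeg_neg]
    congr 1
  have h₂ : LinearMap.ker B.toLinearMap =
      (LinearMap.BilinMap.toQuadraticMap B.toBilinForm).radical := by
    ext x
    rw [QuadraticMap.mem_radical_iff']
    simp only [LinearMap.mem_ker, LinearMap.BilinMap.toQuadraticMap_apply]
    constructor
    · intro h
      have h' : ∀ y, B x y = 0 := fun y => by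
        have : B x = 0 := h
        simp [this]
      refine ⟨h' x, fun y => ?_⟩
      simp [h', hB y x]
    · rintro ⟨h, h'⟩
      refine ContinuousLinearMap.ext fun y => ?_
      have := h' y
      simp only [ContinuousLinearMap.toBilinForm_apply, map_add, LinearMap.add_apply] at this h
      change B x y = 0
      linarith [hB x y]
  rw [h₁, h₂]
  rfl

/-- The form attains its maximum on the compact unit sphere of `U`. -/
theorem exists_forall_le_neg_norm_sq {B : Y →L[ℝ] Y →L[ℝ] ℝ} {U : Submodule ℝ Y}
    (hU : ∀ x ∈ U, x ≠ 0 → B x x < 0) : ∃ ε > 0, ∀ x ∈ U, B x x ≤ -ε * ‖x‖ ^ 2 := by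
  have hc : Continuous fun x : U => B x x := by fun_prop
  obtain h | h := (Metric.sphere (0 : U) 1).eq_empty_or_nonempty
  · refine ⟨1, one_pos, fun x hx => ?_⟩
    by_cases hx0 : x = 0
    · simp [hx0]
    exfalso
    have hn : ‖x‖ ≠ 0 := by simpa using hx0
    have : (‖x‖⁻¹ • ⟨x, hx⟩ : U) ∈ Metric.sphere (0 : U) 1 := by
      simp [norm_smul, hn]
    simp [h] at this
  · obtain ⟨y, hy, hmax⟩ := (isCompact_sphere (0 : U) 1).exists_isMaxOn h hc.continuousOn
    have hy1 : ‖y‖ = 1 := by simpa using hy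
    have hy0 : (y : Y) ≠ 0 := by
      intro h0
      have : y = 0 := by simpa using h0
      simp [this] at hy1
    refine ⟨-(B y y), by linarith [hU y y.2 hy0], fun x hx => ?_⟩
    by_cases hx0 : x = 0
    · simp [hx0]
    have hn : ‖x‖ ≠ 0 := by simpa using hx0
    have hs : (‖x‖⁻¹ • ⟨x, hx⟩ : U) ∈ Metric.sphere (0 : U) 1 := by
      simp [norm_smul, hn]
    have := hmax hs
    simp only [Set.mem_ofPred_eq, Submodule.coe_smul, map_smul, smul_eq_mul,
      smul_apply] at this
    have e : B x x = ‖x‖ ^ 2 * (‖x‖⁻¹ * (‖x‖⁻¹ * B x x)) := by field_simp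
    rw [e]
    nlinarith [sq_nonneg ‖x‖, mul_le_mul_of_nonneg_left this (sq_nonneg ‖x‖)]

variable {Θ : Type*} [TopologicalSpace Θ]

/-- Lower semicontinuity: a maximal negative subspace is uniformly negative, so it stays negative
under small perturbations. -/
theorem eventually_negIndex_le {R : Θ → Y →L[ℝ] Y →L[ℝ] ℝ} {θ : Θ} (hR : ContinuousAt R θ) :
    ∀ᶠ η in 𝓝 θ, negIndex (R θ) ≤ negIndex (R η) := by
  obtain ⟨U, hU, hneg⟩ := exists_finrank_eq_negIndex (R θ)
  obtain ⟨ε, hε, hle⟩ := exists_forall_le_neg_norm_sq hneg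
  filter_upwards [(Metric.tendsto_nhds (α := Y →L[ℝ] Y →L[ℝ] ℝ)).mp hR ε hε] with η hη
  rw [← hU]
  refine le_negIndex fun x hx hx0 => ?_
  have h₁ := hle x hx
  have h₂ : ‖(R η - R θ) x x‖ ≤ ‖R η - R θ‖ * ‖x‖ * ‖x‖ := (R η - R θ).le_opNorm₂ x x
  have h₃ : ‖R η - R θ‖ < ε := by
    rw [← dist_eq_norm (R η) (R θ)]; exact hη
  have hn : 0 < ‖x‖ := by simpa using hx0
  have h₄ := (le_abs_self _).trans h₂
  simp only [sub_apply] at h₄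
  nlinarith [mul_pos hn hn]

/-- Lower semicontinuity for `-R` keeps the positive index from dropping, so the negative index can
gain at most the dimension of the kernel. -/
theorem eventually_negIndex_le_add {R : Θ → Y →L[ℝ] Y →L[ℝ] ℝ} {θ : Θ}
    (hsymm : ∀ η x y, R η x y = R η y x) (hR : ContinuousAt R θ) :
    ∀ᶠ η in 𝓝 θ, negIndex (R η) ≤
      negIndex (R θ) + Module.finrank ℝ (LinearMap.ker (R θ).toLinearMap) := by
  have hR' : ContinuousAt (fun η => -R η) θ := by
    have := hR.const_smul (-1 : ℝ)
    exact this.congr (Eventually.of_forall fun η => neg_one_smul ℝ (R η))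
  filter_upwards [eventually_negIndex_le hR'] with η hη
  have h₁ := negIndex_neg_add (hsymm θ)
  have h₂ := negIndex_neg_add (hsymm η)
  omega

/-- If the kernel does not shrink, no dimension is left by which either index could grow. -/
theorem eventually_negIndex_eq {R : Θ → Y →L[ℝ] Y →L[ℝ] ℝ} {θ : Θ}
    (hsymm : ∀ η x y, R η x y = R η y x) (hR : ContinuousAt R θ)
    (hker : ∀ᶠ η in 𝓝 θ, Module.finrank ℝ (LinearMap.ker (R θ).toLinearMap) ≤
      Module.finrank ℝ (LinearMap.ker (R η).toLinearMap)) :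
    ∀ᶠ η in 𝓝 θ, negIndex (R η) = negIndex (R θ) := by
  have hR' : ContinuousAt (fun η => -R η) θ := by
    have := hR.const_smul (-1 : ℝ)
    exact this.congr (Eventually.of_forall fun η => neg_one_smul ℝ (R η))
  filter_upwards [eventually_negIndex_le hR, eventually_negIndex_le hR', hker] with η h₁ h₂ h₃
  have h₄ := negIndex_neg_add (hsymm θ)
  have h₅ := negIndex_neg_add (hsymm η)
  omega

end Index

/-! ### Counting eigenvalues by the index of a reduced form. -/

section Counting

variable {Y : Type*} [NormedAddCommGroup Y] [NormedSpace ℝ Y] [FiniteDimensional ℝ Y]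
  {X : Type*} [AddCommGroup X] [Module ℝ X]

/-- A family of spaces `𝓔 μ` whose traces are the kernels of the forms `R μ`, `μ < K`, where
`R μ` is negative on the traces of the span of the `𝓔 ν` with `ν < μ`. -/
structure IsReduction (K : ℝ) (𝓔 : ℝ → Submodule ℝ X) (τ : X →ₗ[ℝ] Y)
    (R : ℝ → Y →L[ℝ] Y →L[ℝ] ℝ) : Prop where
  symm : ∀ μ x y, R μ x y = R μ y x
  continuousAt : ∀ μ < K, ContinuousAt R μ
  trace : ∀ μ < K, ∀ f ∈ 𝓔 μ, R μ (τ f) = 0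
  exists_trace : ∀ μ < K, ∀ y, R μ y = 0 → ∃ f ∈ 𝓔 μ, τ f = y
  neg : ∀ μ < K, ∀ f ∈ ⨆ ν ∈ Set.Iio μ, 𝓔 ν, f ≠ 0 → R μ (τ f) (τ f) < 0
  pos : ∃ M, ∀ μ ≤ M, ∀ y ≠ 0, 0 < R μ y y

namespace IsReduction

variable {K : ℝ} {𝓔 : ℝ → Submodule ℝ X} {τ : X →ₗ[ℝ] Y} {R : ℝ → Y →L[ℝ] Y →L[ℝ] ℝ}

/-- The trace is injective on the span, since `R μ` is negative on the traces of its non-zero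
elements. -/
theorem finite_iSup_Iio (h : IsReduction K 𝓔 τ R) {μ : ℝ} (hμ : μ < K) :
    Module.Finite ℝ ↥(⨆ ν ∈ Set.Iio μ, 𝓔 ν) := by
  refine Module.Finite.of_injective (τ.domRestrict (⨆ ν ∈ Set.Iio μ, 𝓔 ν)) ?_
  rw [← LinearMap.ker_eq_bot, LinearMap.ker_eq_bot']
  intro f hf
  by_contra hf0
  have := h.neg μ hμ f f.2 (by simpa using hf0)
  rw [LinearMap.domRestrict_apply] at hf
  simp [hf] at this

theorem iSup_Iio_le {μ ν : ℝ} (hμν : μ < ν) :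
    (⨆ η ∈ Set.Iio μ, 𝓔 η) ⊔ 𝓔 μ ≤ ⨆ η ∈ Set.Iio ν, 𝓔 η := by
  refine sup_le (biSup_mono fun η hη => lt_trans hη hμν) ?_
  exact le_biSup 𝓔 (i := μ) (s := Set.Iio ν) hμν

theorem disjoint (h : IsReduction K 𝓔 τ R) {μ : ℝ} (hμ : μ < K) :
    Disjoint (⨆ ν ∈ Set.Iio μ, 𝓔 ν) (𝓔 μ) := by
  rw [Submodule.disjoint_def]
  intro f hf hf'
  by_contra hf0
  have := h.neg μ hμ f hf hf0
  simp [h.trace μ hμ f hf'] at this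

theorem finite (h : IsReduction K 𝓔 τ R) {μ : ℝ} (hμ : μ < K) : Module.Finite ℝ (𝓔 μ) := by
  obtain ⟨ν, hν, hνK⟩ := exists_between hμ
  have := h.finite_iSup_Iio hνK
  exact Module.Finite.of_injective _
    (Submodule.inclusion_injective (le_sup_right.trans (iSup_Iio_le (𝓔 := 𝓔) hν)))

/-- For `ν` slightly above `μ` the element `f` belongs to the span below `ν`, where `R ν` is
negative. -/
theorem injOn (h : IsReduction K 𝓔 τ R) {μ : ℝ} (hμ : μ < K) {f : X} (hf : f ∈ 𝓔 μ)
    (h0 : τ f = 0) : f = 0 := by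
  by_contra hf0
  obtain ⟨ν, hν, hνK⟩ := exists_between hμ
  have := h.neg ν hνK f (le_sup_right.trans (iSup_Iio_le (𝓔 := 𝓔) hν) hf) hf0
  simp [h0] at this

theorem finrank_ker (h : IsReduction K 𝓔 τ R) {μ : ℝ} (hμ : μ < K) :
    Module.finrank ℝ (LinearMap.ker (R μ).toLinearMap) = Module.finrank ℝ (𝓔 μ) := by
  have e : (𝓔 μ).map τ = LinearMap.ker (R μ).toLinearMap := by
    ext y
    simp only [Submodule.mem_map, LinearMap.mem_ker]
    exact ⟨fun ⟨f, hf, hy⟩ => hy ▸ h.trace μ hμ f hf, fun hy => h.exists_trace μ hμ y hy⟩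
  rw [← e, ← LinearMap.range_domRestrict]
  refine LinearMap.finrank_range_of_inj ?_
  rw [← LinearMap.ker_eq_bot, LinearMap.ker_eq_bot']
  intro f hf
  exact Subtype.ext (h.injOn hμ f.2 hf)

theorem finrank_add_le (h : IsReduction K 𝓔 τ R) {μ ν : ℝ} (hμν : μ < ν) (hν : ν < K) :
    Module.finrank ℝ ↥(⨆ η ∈ Set.Iio μ, 𝓔 η) + Module.finrank ℝ (𝓔 μ) ≤
      Module.finrank ℝ ↥(⨆ η ∈ Set.Iio ν, 𝓔 η) := by
  have := h.finite_iSup_Iio hν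
  have := h.finite_iSup_Iio (hμν.trans hν)
  have := h.finite (hμν.trans hν)
  rw [← Submodule.finrank_sup_add_finrank_inf_eq, (h.disjoint (hμν.trans hν)).eq_bot,
    finrank_bot, add_zero]
  exact Submodule.finrank_mono (iSup_Iio_le hμν)

/-- The number of eigenvalues below `μ` is the negative index of the reduced form. -/
theorem finrank_iSup_Iio (h : IsReduction K 𝓔 τ R) {μ : ℝ} (hμ : μ < K) :
    Module.finrank ℝ ↥(⨆ ν ∈ Set.Iio μ, 𝓔 ν) = negIndex (R μ) := by
  apply le_antisymm
  · have hinj : Function.Injective (τ.domRestrict (⨆ ν ∈ Set.Iio μ, 𝓔 ν)) := by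
      rw [← LinearMap.ker_eq_bot, LinearMap.ker_eq_bot']
      intro f hf
      by_contra hf0
      have := h.neg μ hμ f f.2 (by simpa using hf0)
      rw [LinearMap.domRestrict_apply] at hf
      simp [hf] at this
    rw [← LinearMap.finrank_range_of_inj hinj]
    refine le_negIndex ?_
    rintro _ ⟨f, rfl⟩ hf0
    refine h.neg μ hμ f f.2 fun h0 => hf0 ?_
    simp [h0]
  · obtain ⟨M₀, hM₀⟩ := h.pos
    set M := min M₀ μ
    have hM : ∀ y ≠ 0, 0 < R M y y := hM₀ M (min_le_left _ _)
    have hmono : ∀ a b, a ≤ b → b < K → Module.finrank ℝ ↥(⨆ η ∈ Set.Iio a, 𝓔 η) ≤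
        Module.finrank ℝ ↥(⨆ η ∈ Set.Iio b, 𝓔 η) := by
      intro a b hab hb
      obtain rfl | hlt := hab.eq_or_lt
      · rfl
      · have := h.finrank_add_le hlt hb
        omega
    -- As `ν` increases, the index can jump only at a `ν` where `R ν` has a kernel, and by at most
    -- the dimension of that kernel. The dimension of the span gains just as much there. So the set
    -- of `ν` with `[M, ν] ⊆ s` is closed in `[M, μ]` (lower semicontinuity of the index,
    -- monotonicity of the span) and extends to the right of each of its points. At `M` the form is
    -- positive and the index is zero.
    set s : Set ℝ := {ν | negIndex (R ν) ≤ Module.finrank ℝ ↥(⨆ η ∈ Set.Iio ν, 𝓔 η)}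
    have key : Set.Icc M μ ⊆ {ν | Set.Icc M ν ⊆ s} := by
      refine IsClosed.Icc_subset_of_forall_mem_nhdsWithin ?_ ?_ ?_
      · rw [← isOpen_compl_iff, isOpen_iff_mem_nhds]
        intro ν hν
        by_cases hνI : ν ∈ Set.Icc M μ
        · have hνs : ¬ Set.Icc M ν ⊆ s := fun h' => hν ⟨h', hνI⟩
          obtain ⟨η, hη, hηs⟩ := Set.not_subset.mp hνs
          obtain rfl | hlt := hη.2.eq_or_lt
          · have hηK := hνI.2.trans_lt hμ
            filter_upwards [eventually_negIndex_le (h.continuousAt η hηK)] with ζ hζ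
            rintro ⟨hζs, hζI⟩
            obtain hle | hlt := le_or_gt η ζ
            · exact hηs (hζs ⟨hη.1, hle⟩)
            · exact hηs (hζ.trans ((hζs ⟨hζI.1, le_rfl⟩ : ζ ∈ s).trans (hmono _ _ hlt.le hηK)))
          · filter_upwards [Ioi_mem_nhds hlt] with ζ hζ
            rintro ⟨hζs, -⟩
            exact hηs (hζs ⟨hη.1, le_of_lt hζ⟩)
        · exact mem_of_superset (isClosed_Icc.isOpen_compl.mem_nhds hνI)
            fun x hx hx' => hx hx'.2
      · have : negIndex (R M) = 0 := by
          obtain ⟨U, hU, hneg⟩ := exists_finrank_eq_negIndex (R M)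
          rw [← hU, Submodule.finrank_eq_zero, Submodule.eq_bot_iff]
          intro x hx
          by_contra hx0
          exact (hM x hx0).not_gt (hneg x hx hx0)
        simp [s, this]
      · rintro ν ⟨hνs, hν1, hν2⟩
        have hνK := hν2.trans hμ
        have h2 := eventually_negIndex_le_add h.symm (h.continuousAt ν hνK)
        have h3 : s ∈ 𝓝[>] ν := by
          filter_upwards [nhdsWithin_le_nhds h2, nhdsWithin_le_nhds (Iio_mem_nhds hνK),
            self_mem_nhdsWithin] with η hη hηK hην
          have h3 := h.finrank_add_le hην hηK
          rw [h.finrank_ker hνK] at hη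
          exact hη.trans ((Nat.add_le_add_right (hνs ⟨hν1, le_rfl⟩) _).trans h3)
        obtain ⟨u, hu, hus⟩ := mem_nhdsGT_iff_exists_Ioo_subset.mp h3
        refine mem_of_superset (Ioo_mem_nhdsGT hu) fun η hη ζ hζ => ?_
        obtain hle | hlt := le_or_gt ζ ν
        · exact hνs ⟨hζ.1, hle⟩
        · exact hus ⟨hlt, hζ.2.trans_lt hη.2⟩
    have hMμ : M ≤ μ := min_le_right _ _
    exact key ⟨hMμ, le_rfl⟩ ⟨hMμ, le_rfl⟩

end IsReduction

end Counting

/-! ### Branches of simple roots of a family of forms, and their Hessian. -/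

section Branch

variable {Y Y₁ Y₂ : Type*} [NormedAddCommGroup Y] [NormedSpace ℝ Y] [FiniteDimensional ℝ Y]
  [NormedAddCommGroup Y₁] [NormedSpace ℝ Y₁] [FiniteDimensional ℝ Y₁]
  [NormedAddCommGroup Y₂] [NormedSpace ℝ Y₂] [FiniteDimensional ℝ Y₂]

/-- Negative indices add up along orthogonal subspaces. -/
theorem negIndex_add_negIndex_le {B : Y →L[ℝ] Y →L[ℝ] ℝ} (hB : ∀ x y, B x y = B y x)
    (A₁ : Y₁ →L[ℝ] Y) (A₂ : Y₂ →L[ℝ] Y) (h : ∀ a b, B (A₁ a) (A₂ b) = 0) :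
    negIndex (B.bilinearComp A₁ A₁) + negIndex (B.bilinearComp A₂ A₂) ≤ negIndex B := by
  obtain ⟨U₁, h₁, n₁⟩ := exists_finrank_eq_negIndex (B.bilinearComp A₁ A₁)
  obtain ⟨U₂, h₂, n₂⟩ := exists_finrank_eq_negIndex (B.bilinearComp A₂ A₂)
  simp only [ContinuousLinearMap.bilinearComp_apply] at n₁ n₂
  let A : U₁ × U₂ →ₗ[ℝ] Y :=
    (A₁.toLinearMap.comp U₁.subtype).coprod (A₂.toLinearMap.comp U₂.subtype)
  have hA : ∀ p : U₁ × U₂, A p = A₁ p.1 + A₂ p.2 := fun p => by simp [A]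
  have hneg : ∀ p : U₁ × U₂, p ≠ 0 → B (A p) (A p) < 0 := by
    rintro ⟨a, b⟩ hp
    have e : B (A (a, b)) (A (a, b)) = B (A₁ a) (A₁ a) + B (A₂ b) (A₂ b) := by
      rw [hA]
      simp [h, hB (A₂ b) (A₁ a)]
    rw [e]
    have ha : B (A₁ a) (A₁ a) ≤ 0 := by
      by_cases ha : a = 0
      · simp [ha]
      · exact (n₁ a a.2 (by simpa using ha)).le
    by_cases hb : b = 0
    · have ha0 : a ≠ 0 := fun ha0 => hp (by simp [ha0, hb])
      have := n₁ a a.2 (by simpa using ha0)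
      simp [hb, this]
    · have := n₂ b b.2 (by simpa using hb)
      linarith
  -- Injectivity comes from the negativity of `B` on the range, so `A₁` and `A₂` need not be
  -- injective themselves.
  have hinj : Function.Injective A := by
    rw [← LinearMap.ker_eq_bot, LinearMap.ker_eq_bot']
    intro p hp
    by_contra hp0
    have := hneg p hp0
    simp [hp] at this
  rw [← h₁, ← h₂, ← Module.finrank_prod, ← LinearMap.finrank_range_of_inj hinj]
  refine le_negIndex ?_
  rintro _ ⟨p, rfl⟩ hp
  exact hneg p fun h0 => hp (by simp [h0])

variable {J : Type*} [Fintype J]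

/-- The implicit function theorem for a simple root of a family of symmetric forms: the bordered
derivative is invertible. -/
theorem bordered_isInvertible {B : Y →L[ℝ] Y →L[ℝ] ℝ} (hB : ∀ x y, B x y = B y x)
    {R' : Y →L[ℝ] Y →L[ℝ] ℝ} {ψ : Y} (hψ : B ψ = 0) (hker : ∀ x, B x = 0 → ∃ a : ℝ, x = a • ψ)
    (hR' : R' ψ ψ ≠ 0) {ℓ : Y →L[ℝ] ℝ} (hℓ : ℓ ψ = 1) {T : ℝ × Y →L[ℝ] (Y →L[ℝ] ℝ) × ℝ}
    (hT : ∀ a x, T (a, x) = (a • R' ψ + B x, ℓ x)) : T.IsInvertible := by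
  have hinj : Function.Injective T := by
    rw [← ContinuousLinearMap.coe_coe, ← LinearMap.ker_eq_bot, LinearMap.ker_eq_bot']
    rintro ⟨a, x⟩ h
    have h' : T (a, x) = 0 := h
    rw [hT, Prod.mk_eq_zero] at h'
    -- Evaluation at `ψ` kills `B x` by symmetry and leaves `a * R' ψ ψ = 0`. Then `x` is a multiple
    -- of `ψ`, and `ℓ` forces it to be zero.
    have e := congrArg (fun g : Y →L[ℝ] ℝ => g ψ) h'.1
    have hx : B x ψ = 0 := by rw [hB, hψ]; rfl
    simp only [add_apply, smul_apply, hx, smul_eq_mul, add_zero, zero_apply, mul_eq_zero,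
      hR', or_false] at e
    obtain ⟨c, rfl⟩ := hker x (by simpa [e] using h'.1)
    have h2 := h'.2
    simp only [map_smul, hℓ, smul_eq_mul, mul_one] at h2
    simp [e, h2]
  have hdim : Module.finrank ℝ (ℝ × Y) = Module.finrank ℝ ((Y →L[ℝ] ℝ) × ℝ) := by
    have : Module.finrank ℝ (Y →L[ℝ] ℝ) = Module.finrank ℝ Y := by
      rw [← (LinearMap.toContinuousLinearMap (𝕜 := ℝ) (E := Y) (F' := ℝ)).finrank_eq]
      exact Subspace.dual_finrank_eq
    rw [Module.finrank_prod, Module.finrank_prod, this, add_comm]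
  have hsurj : Function.Surjective T :=
    (LinearMap.injective_iff_surjective_of_finrank_eq_finrank (f := T.toLinearMap) hdim).mp hinj
  exact ⟨(LinearEquiv.ofBijective T.toLinearMap ⟨hinj, hsurj⟩).toContinuousLinearEquiv, rfl⟩

theorem hasDerivAt_form_apply {Z : Type*} [NormedAddCommGroup Z] [NormedSpace ℝ Z]
    {R : ℝ → Y →L[ℝ] Z} (D : (J → ℝ) →L[ℝ] Y →L[ℝ] Z)
    {μ : ℝ → ℝ} {μ' : ℝ} {γ : ℝ → J → ℝ} {δ : J → ℝ} {w : ℝ → Y} {w' : Y} {t : ℝ}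
    (hR : DifferentiableAt ℝ R (μ t)) (hμ : HasDerivAt μ μ' t) (hγ : HasDerivAt γ δ t)
    (hw : HasDerivAt w w' t) :
    HasDerivAt (fun s => (R (μ s) + D (γ s)) (w s))
      (μ' • deriv R (μ t) (w t) + D δ (w t) + (R (μ t) + D (γ t)) w') t := by
  have h1 : HasDerivAt (fun s => R (μ s)) (μ' • deriv R (μ t)) t :=
    HasDerivAt.scomp t hR.hasDerivAt hμ
  have h2 : HasDerivAt (fun s => D (γ s)) (D δ) t := D.hasFDerivAt.comp_hasDerivAt t hγ
  exact (h1.add h2).clm_apply hw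

theorem hasDerivAt_line {X : Type*} [NormedAddCommGroup X] [NormedSpace ℝ X] (x v : X) :
    HasDerivAt (fun t : ℝ => x + t • v) v 0 := by
  simpa using ((hasDerivAt_id (0 : ℝ)).smul_const v).const_add x

theorem DifferentiableAt.hasDerivAt_line {X F : Type*} [NormedAddCommGroup X] [NormedSpace ℝ X]
    [NormedAddCommGroup F] [NormedSpace ℝ F] {f : X → F} {x : X} (hf : DifferentiableAt ℝ f x)
    (v : X) : HasDerivAt (fun t : ℝ => f (x + t • v)) (fderiv ℝ f x v) 0 := by
  have : HasFDerivAt f (fderiv ℝ f x) (x + (0 : ℝ) • v) := by simpa using hf.hasFDerivAt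
  exact this.comp_hasDerivAt (0 : ℝ) (_root_.hasDerivAt_line x v)

/-- A `C³` solution `(μ, w)` of `(R μ + D γ) w = 0` near a simple root. -/
theorem exists_local_root {R : ℝ → Y →L[ℝ] Y →L[ℝ] ℝ}
    (hsymm : ∀ μ x y, R μ x y = R μ y x) {ξ : ℝ} (hR : ContDiffAt ℝ 3 R ξ)
    (D : (J → ℝ) →L[ℝ] Y →L[ℝ] Y →L[ℝ] ℝ) (hD : ∀ γ x y, D γ x y = D γ y x) {γ₀ : J → ℝ} {ψ : Y}
    (hψ0 : ψ ≠ 0) (hψ : (R ξ + D γ₀) ψ = 0)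
    (hker : ∀ x, (R ξ + D γ₀) x = 0 → ∃ a : ℝ, x = a • ψ) (hR' : deriv R ξ ψ ψ < 0) :
    ∃ (Λ : (J → ℝ) → ℝ) (w : (J → ℝ) → Y), ContDiffAt ℝ 3 Λ γ₀ ∧ ContDiffAt ℝ 3 w γ₀ ∧
      Λ γ₀ = ξ ∧ w γ₀ = ψ ∧ ∀ᶠ γ in 𝓝 γ₀, (R (Λ γ) + D γ) (w γ) = 0 := by
  have hBs : ∀ x y, (R ξ + D γ₀) x y = (R ξ + D γ₀) y x := fun x y => by
    simp [hsymm ξ x y, hD γ₀ x y]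
  -- The normalisation by `ℓ` makes the system square: the unknowns `(μ, w)` lie in `ℝ × Y`, the
  -- equations in the dual of `Y` times `ℝ`.
  obtain ⟨ℓ, hℓ⟩ := SeparatingDual.exists_eq_one (R := ℝ) hψ0
  let Φ : (J → ℝ) × (ℝ × Y) → (Y →L[ℝ] ℝ) × ℝ :=
    fun p => ((R p.2.1 + D p.1) p.2.2, ℓ p.2.2)
  have hΦ : ContDiffAt ℝ 3 Φ (γ₀, (ξ, ψ)) := by
    have h1 : ContDiffAt ℝ 3 (fun p : (J → ℝ) × (ℝ × Y) => R p.2.1) (γ₀, (ξ, ψ)) :=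
      ContDiffAt.comp (γ₀, (ξ, ψ)) hR (by fun_prop)
    fun_prop
  have hRd : DifferentiableAt ℝ R ξ := hR.differentiableAt (by norm_num)
  have hT : ∀ a x, (fderiv ℝ Φ (γ₀, (ξ, ψ)) ∘L .inr ℝ (J → ℝ) (ℝ × Y)) (a, x) =
      (a • deriv R ξ ψ + (R ξ + D γ₀) x, ℓ x) := by
    intro a x
    have hl := hasDerivAt_line ((γ₀, (ξ, ψ)) : (J → ℝ) × (ℝ × Y)) (0, (a, x))
    have h1 := (hΦ.differentiableAt (by norm_num)).hasDerivAt_line (0, (a, x))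
    have h2 := (hasDerivAt_form_apply (Z := Y →L[ℝ] ℝ) (R := R) D (t := 0) (by simpa using hRd)
      hl.snd.fst hl.fst hl.snd.snd).prodMk (ℓ.hasFDerivAt.comp_hasDerivAt (0 : ℝ) hl.snd.snd)
    have := h1.unique h2
    simpa using this
  have hinv := bordered_isInvertible hBs hψ hker hR'.ne hℓ hT
  have hgc : ContDiffAt ℝ 3 (hΦ.implicitFunction (by norm_num) hinv) γ₀ :=
    hΦ.contDiffAt_implicitFunction (by norm_num) hinv
  have hg0 : hΦ.implicitFunction (by norm_num) hinv γ₀ = (ξ, ψ) :=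
    hΦ.implicitFunction_apply_self (by norm_num) hinv
  have hge : ∀ᶠ γ in 𝓝 γ₀, Φ (γ, hΦ.implicitFunction (by norm_num) hinv γ) = Φ (γ₀, (ξ, ψ)) :=
    hΦ.eventually_apply_implicitFunction (by norm_num) hinv
  refine ⟨fun γ => (hΦ.implicitFunction (by norm_num) hinv γ).1,
    fun γ => (hΦ.implicitFunction (by norm_num) hinv γ).2, contDiffAt_fst.comp γ₀ hgc,
    contDiffAt_snd.comp γ₀ hgc, by simp [hg0], by simp [hg0], ?_⟩
  filter_upwards [hge] with γ hγ
  simp only [Φ, Prod.mk.injEq] at hγ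
  rw [hγ.1, hψ]

/-- First-order perturbation of a root. -/
theorem fderiv_root {R : ℝ → Y →L[ℝ] Y →L[ℝ] ℝ} (D : (J → ℝ) →L[ℝ] Y →L[ℝ] Y →L[ℝ] ℝ)
    {Λ : (J → ℝ) → ℝ} {w : (J → ℝ) → Y} {γ : J → ℝ} (hΛ : DifferentiableAt ℝ Λ γ)
    (hw : DifferentiableAt ℝ w γ) (hR : DifferentiableAt ℝ R (Λ γ))
    (h : ∀ᶠ γ in 𝓝 γ, (R (Λ γ) + D γ) (w γ) = 0) (δ : J → ℝ) :
    fderiv ℝ Λ γ δ • deriv R (Λ γ) (w γ) + D δ (w γ) +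
      (R (Λ γ) + D γ) (fderiv ℝ w γ δ) = 0 := by
  have hd := hasDerivAt_form_apply (Z := Y →L[ℝ] ℝ) (R := R) D (t := 0) (by simpa using hR)
    (hΛ.hasDerivAt_line δ) (hasDerivAt_line γ δ) (hw.hasDerivAt_line δ)
  have hcont : Tendsto (fun t : ℝ => γ + t • δ) (𝓝 0) (𝓝 γ) := by
    simpa using (hasDerivAt_line γ δ).continuousAt.tendsto
  have := hd.unique ((hasDerivAt_const (0 : ℝ) (0 : Y →L[ℝ] ℝ)).congr_of_eventuallyEq
    (hcont.eventually h))
  simpa using this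

/-- Second-order perturbation of a root at a critical point. -/
theorem fderiv_fderiv_root {R' : ℝ → Y →L[ℝ] Y →L[ℝ] ℝ} (D : (J → ℝ) →L[ℝ] Y →L[ℝ] Y →L[ℝ] ℝ)
    {Λ : (J → ℝ) → ℝ} {w : (J → ℝ) → Y} {γ : J → ℝ} (hΛ : DifferentiableAt ℝ Λ γ)
    (hΛ2 : DifferentiableAt ℝ (fderiv ℝ Λ) γ)
    (hw : DifferentiableAt ℝ w γ) (hR : DifferentiableAt ℝ R' (Λ γ)) (hd0 : fderiv ℝ Λ γ = 0)
    (δ δ' : J → ℝ)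
    (h : ∀ᶠ γ in 𝓝 γ, fderiv ℝ Λ γ δ' * R' (Λ γ) (w γ) (w γ) + D δ' (w γ) (w γ) = 0) :
    fderiv ℝ (fderiv ℝ Λ) γ δ δ' * R' (Λ γ) (w γ) (w γ) + D δ' (fderiv ℝ w γ δ) (w γ) +
      D δ' (w γ) (fderiv ℝ w γ δ) = 0 := by
  have a1 := (hΛ2.hasDerivAt_line δ).clm_apply (hasDerivAt_const (0 : ℝ) δ')
  have aw := hw.hasDerivAt_line δ
  have aΛ := hΛ.hasDerivAt_line δ
  have a2 : DifferentiableAt ℝ (fun t : ℝ => R' (Λ (γ + t • δ)) (w (γ + t • δ))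
      (w (γ + t • δ))) 0 := by
    have b : DifferentiableAt ℝ (fun t : ℝ => R' (Λ (γ + t • δ))) 0 :=
      DifferentiableAt.comp (G := Y →L[ℝ] Y →L[ℝ] ℝ) (0 : ℝ) (by simpa using hR)
        aΛ.differentiableAt
    have b' : DifferentiableAt ℝ (fun t : ℝ => R' (Λ (γ + t • δ)) (w (γ + t • δ))) 0 :=
      b.clm_apply aw.differentiableAt
    exact b'.clm_apply aw.differentiableAt
  have a3 : HasDerivAt (fun t : ℝ => D δ' (w (γ + t • δ)) (w (γ + t • δ)))
      (D δ' (fderiv ℝ w γ δ) (w (γ + (0 : ℝ) • δ)) +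
        D δ' (w (γ + (0 : ℝ) • δ)) (fderiv ℝ w γ δ)) 0 :=
    ((D δ').hasFDerivAt.comp_hasDerivAt (0 : ℝ) aw).clm_apply aw
  have a4 := (a1.mul a2.hasDerivAt).add a3
  have hcont : Tendsto (fun t : ℝ => γ + t • δ) (𝓝 0) (𝓝 γ) := by
    simpa using (hasDerivAt_line γ δ).continuousAt.tendsto
  have := a4.unique ((hasDerivAt_const (0 : ℝ) (0 : ℝ)).congr_of_eventuallyEq
    (hcont.eventually h))
  simp only [zero_smul, add_zero, map_zero, hd0, zero_apply, zero_mul] at this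
  linarith

/-- The local branch of roots `Λ γ` of `R (Λ γ) + D γ` through a simple root. -/
theorem exists_local_branch {R : ℝ → Y →L[ℝ] Y →L[ℝ] ℝ}
    (hsymm : ∀ μ x y, R μ x y = R μ y x) {ξ : ℝ} (hR : ContDiffAt ℝ 3 R ξ)
    (D : (J → ℝ) →L[ℝ] Y →L[ℝ] Y →L[ℝ] ℝ) (hD : ∀ γ x y, D γ x y = D γ y x) {γ₀ : J → ℝ} {ψ : Y}
    (hψ0 : ψ ≠ 0) (hψ : (R ξ + D γ₀) ψ = 0)
    (hker : ∀ x, (R ξ + D γ₀) x = 0 → ∃ a : ℝ, x = a • ψ)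
    (hR' : deriv R ξ ψ ψ < 0) (hDψ : ∀ γ, D γ ψ ψ = 0) :
    ∃ (Λ : (J → ℝ) → ℝ) (A : (J → ℝ) →L[ℝ] Y) (k : ℝ), k < 0 ∧ ContDiffAt ℝ 2 Λ γ₀ ∧ Λ γ₀ = ξ ∧
      fderiv ℝ Λ γ₀ = 0 ∧ (∀ δ, D δ ψ + (R ξ + D γ₀) (A δ) = 0) ∧
      (∀ δ δ', fderiv ℝ (fderiv ℝ Λ) γ₀ δ δ' = k * (R ξ + D γ₀) (A δ) (A δ')) ∧
      ∀ᶠ γ in 𝓝 γ₀, ∃ w ≠ 0, (R (Λ γ) + D γ) w = 0 := by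
  have hBs : ∀ x y, (R ξ + D γ₀) x y = (R ξ + D γ₀) y x := fun x y => by
    simp [hsymm ξ x y, hD γ₀ x y]
  obtain ⟨Λ, w, hg1, hg2, hΛ0, hw0, hEq⟩ := exists_local_root hsymm hR D hD hψ0 hψ hker hR'
  have hRe : ∀ᶠ γ in 𝓝 γ₀, ContDiffAt ℝ 3 R (Λ γ) := by
    have : ∀ᶠ μ in 𝓝 (Λ γ₀), ContDiffAt ℝ 3 R μ := by
      rw [hΛ0]; exact hR.eventually (by norm_num)
    exact hg1.continuousAt.eventually this
  have first : ∀ᶠ γ in 𝓝 γ₀, ∀ δ, fderiv ℝ Λ γ δ • deriv R (Λ γ) (w γ) + D δ (w γ) +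
      (R (Λ γ) + D γ) (fderiv ℝ w γ δ) = 0 := by
    filter_upwards [hEq.eventually_nhds, hRe, hg1.eventually (by norm_num),
      hg2.eventually (by norm_num)] with γ h1 h2 h3 h4 δ
    exact fderiv_root D (h3.differentiableAt (by norm_num)) (h4.differentiableAt (by norm_num))
      (h2.differentiableAt (by norm_num)) h1 δ
  -- Evaluating the first-order identity at `w γ` removes the term with the derivative of `w`,
  -- because `w γ` is in the kernel of a symmetric form.
  have second : ∀ᶠ γ in 𝓝 γ₀, ∀ δ, fderiv ℝ Λ γ δ * deriv R (Λ γ) (w γ) (w γ) +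
      D δ (w γ) (w γ) = 0 := by
    filter_upwards [first, hEq] with γ h1 h2 δ
    have e := congrArg (fun g : Y →L[ℝ] ℝ => g (w γ)) (h1 δ)
    have hz : (R (Λ γ) + D γ) (fderiv ℝ w γ δ) (w γ) = 0 := by
      have : (R (Λ γ) + D γ) (fderiv ℝ w γ δ) (w γ) = (R (Λ γ) + D γ) (w γ) (fderiv ℝ w γ δ) := by
        simp [hsymm (Λ γ) _ (w γ), hD γ _ (w γ)]
      rw [this, h2]; rfl
    simp only [add_apply, smul_apply, smul_eq_mul, zero_apply] at e hz
    linarith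
  -- Criticality is exactly the vanishing of `D δ ψ ψ`.
  have hd0 : fderiv ℝ Λ γ₀ = 0 := by
    ext1 δ
    have := second.self_of_nhds δ
    rw [hΛ0, hw0, hDψ, add_zero, mul_eq_zero] at this
    simpa using this.resolve_right hR'.ne
  have third : ∀ δ, D δ ψ + (R ξ + D γ₀) (fderiv ℝ w γ₀ δ) = 0 := by
    intro δ
    have := first.self_of_nhds δ
    rw [hΛ0, hw0, hd0] at this
    simpa using this
  -- Differentiating `second` at the critical point gives the Hessian times `R' ψ ψ` plus `2 D δ' ψ
  -- (A δ)`, with sum zero. By `third` this last term is `-2 B (A δ') (A δ)`, whence the factor `2 /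
  -- R' ψ ψ`.
  refine ⟨Λ, fderiv ℝ w γ₀, 2 / deriv R ξ ψ ψ, div_neg_of_pos_of_neg two_pos hR',
    hg1.of_le (by norm_num), hΛ0, hd0, third, fun δ δ' => ?_, ?_⟩
  · have hΛ2 : DifferentiableAt ℝ (fderiv ℝ Λ) γ₀ :=
      (hg1.fderiv_right (m := 1) (by norm_num)).differentiableAt (by norm_num)
    have hRd2 : DifferentiableAt ℝ (deriv R) (Λ γ₀) := by
      rw [hΛ0]
      have := (hR.fderiv_right (m := 1) (by norm_num)).differentiableAt (by norm_num)
      exact this.clm_apply (differentiableAt_const (1 : ℝ))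
    have := fderiv_fderiv_root D (hg1.differentiableAt (by norm_num)) hΛ2
      (hg2.differentiableAt (by norm_num)) hRd2 hd0 δ δ' (second.mono fun γ h => h δ')
    rw [hΛ0, hw0] at this
    have e := congrArg (fun g : Y →L[ℝ] ℝ => g (fderiv ℝ w γ₀ δ)) (third δ')
    have hs := hBs (fderiv ℝ w γ₀ δ') (fderiv ℝ w γ₀ δ)
    simp only [add_apply, zero_apply] at e hs ⊢
    rw [hD δ' _ ψ] at this
    rw [div_mul_eq_mul_div, eq_div_iff hR'.ne]
    linarith
  · have hne : ∀ᶠ γ in 𝓝 γ₀, w γ ≠ 0 :=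
      hg2.continuousAt.eventually_ne (by rwa [hw0])
    filter_upwards [hEq, hne] with γ hγ hγ0
    exact ⟨w γ, hγ0, hγ⟩

theorem negIndex_smul_of_neg {C H : Y →L[ℝ] Y →L[ℝ] ℝ} {k : ℝ} (hk : k < 0)
    (h : ∀ x, H x x = k * C x x) : negIndex H = negIndex (-C) := by
  apply le_antisymm
  · obtain ⟨U, hU, hneg⟩ := exists_finrank_eq_negIndex H
    rw [← hU]
    refine le_negIndex fun x hx hx0 => ?_
    have := hneg x hx hx0
    rw [h] at this
    simpa using pos_of_mul_neg_right this hk.le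
  · obtain ⟨U, hU, hneg⟩ := exists_finrank_eq_negIndex (-C)
    rw [← hU]
    refine le_negIndex fun x hx hx0 => ?_
    have := hneg x hx hx0
    rw [h]
    exact mul_neg_of_neg_of_pos hk (by simpa using this)

theorem finrank_ker_eq_one {B : Y →L[ℝ] Y →L[ℝ] ℝ} {ψ : Y} (hψ0 : ψ ≠ 0) (hψ : B ψ = 0)
    (hker : ∀ x, B x = 0 → ∃ a : ℝ, x = a • ψ) :
    Module.finrank ℝ (LinearMap.ker B.toLinearMap) = 1 := by
  have : LinearMap.ker B.toLinearMap = Submodule.span ℝ {ψ} := by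
    ext x
    rw [LinearMap.mem_ker, Submodule.mem_span_singleton]
    constructor
    · intro h
      obtain ⟨a, ha⟩ := hker x h
      exact ⟨a, ha.symm⟩
    · rintro ⟨a, rfl⟩
      simp [hψ]
  rw [this, finrank_span_singleton hψ0]

/-- The branch of simple roots of `R (Λ γ) + D γ` has a non-degenerate critical point at `γ₀`, whose
Morse index is determined by the indices of the form and of its restriction to the common kernel
of the functionals `p j - m j`. -/
theorem exists_branch {R : ℝ → Y →L[ℝ] Y →L[ℝ] ℝ}
    (hsymm : ∀ μ x y, R μ x y = R μ y x) {ξ : ℝ} (hR : ContDiffAt ℝ 3 R ξ)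
    (D : (J → ℝ) →L[ℝ] Y →L[ℝ] Y →L[ℝ] ℝ) (p m : J → Y →L[ℝ] ℝ)
    (hD : ∀ γ x y, D γ x y = ∑ j, γ j * (p j x * p j y - m j x * m j y)) {γ₀ : J → ℝ} {ψ : Y}
    (hψ0 : ψ ≠ 0) (hψ : (R ξ + D γ₀) ψ = 0)
    (hker : ∀ x, (R ξ + D γ₀) x = 0 → ∃ a : ℝ, x = a • ψ)
    (hR' : deriv R ξ ψ ψ < 0) (hpm : ∀ j, p j ψ = m j ψ) (hp0 : ∀ j, p j ψ ≠ 0)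
    (hind : ∀ v : J → ℝ, ∃ z, ∀ j, p j z - m j z = v j)
    (Y₀ : Submodule ℝ Y) (hY₀ : ∀ x, x ∈ Y₀ ↔ ∀ j, p j x = m j x)
    (hker₀ : ∀ x ∈ Y₀, (∀ z ∈ Y₀, (R ξ + D γ₀) x z = 0) → ∃ a : ℝ, x = a • ψ) :
    ∃ Λ : (J → ℝ) → ℝ, IsNondegenerateCriticalPoint Λ γ₀ ∧ Λ γ₀ = ξ ∧
      (morseIndex Λ γ₀ : ℤ) =
        negIndex ((R ξ + D γ₀).bilinearComp Y₀.subtypeL Y₀.subtypeL) + Fintype.card J -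
          negIndex (R ξ + D γ₀) ∧
      ∀ᶠ γ in 𝓝 γ₀, (∃ w ≠ 0, (R (Λ γ) + D γ) w = 0) ∧
        negIndex (R (Λ γ) + D γ) = negIndex (R ξ + D γ₀) := by
  classical
  have hDs : ∀ γ x y, D γ x y = D γ y x := fun γ x y => by
    rw [hD, hD]; exact Finset.sum_congr rfl fun j _ => by ring
  have hBs : ∀ x y, (R ξ + D γ₀) x y = (R ξ + D γ₀) y x := fun x y => by
    simp [hsymm ξ x y, hDs γ₀ x y]
  have hDψ : ∀ γ, D γ ψ ψ = 0 := fun γ => by simp [hD, hpm]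
  have hDψz : ∀ γ z, D γ ψ z = ∑ j, γ j * (p j ψ * (p j z - m j z)) := fun γ z => by
    rw [hD]; exact Finset.sum_congr rfl fun j _ => by rw [hpm]; ring
  obtain ⟨Λ, A, k, hk, hΛ, hΛ0, hd0, hA, hH, hroot⟩ :=
    exists_local_branch hsymm hR D hDs hψ0 hψ hker hR' hDψ
  have hBA : ∀ δ z, (R ξ + D γ₀) (A δ) z = -∑ j, δ j * (p j ψ * (p j z - m j z)) := by
    intro δ z
    have e := congrArg (fun g : Y →L[ℝ] ℝ => g z) (hA δ)
    have e' : D δ ψ z + (R ξ + D γ₀) (A δ) z = 0 := e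
    rw [hDψz] at e'
    linarith
  -- By `hBA`, the functional `B (A δ)` depends only on the jumps `p j z - m j z`, which vanish on
  -- `Y₀`.
  have horth : ∀ δ, ∀ z : Y₀, (R ξ + D γ₀) (A δ) (Y₀.subtypeL z) = 0 := by
    intro δ z
    rw [hBA]
    simp [(hY₀ z).mp z.2]
  set B := R ξ + D γ₀ with hB
  set C := B.bilinearComp A A with hC
  have hCs : ∀ x y, C x y = C y x := fun x y => by simp [hC, hBs (A x) (A y)]
  -- If `δ` is in the kernel of `C`, testing with unit vectors shows that `A δ` has no jumps, so it
  -- lies in `Y₀` and in the kernel of `B` restricted there. It is therefore a multiple of `ψ`, so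
  -- `B (A δ) = 0`. As the jumps can be prescribed freely, `δ = 0`.
  have hCker : ∀ δ, (∀ δ', C δ δ' = 0) → δ = 0 := by
    intro δ h
    have h1 : A δ ∈ Y₀ := by
      rw [hY₀]
      intro j
      have h2 := h (Pi.single j 1)
      rw [hCs, hC, ContinuousLinearMap.bilinearComp_apply, hBA] at h2
      simp only [Pi.single_apply, ite_mul, one_mul, zero_mul, Finset.sum_ite_eq',
        Finset.mem_univ, if_true, neg_eq_zero, mul_eq_zero, hp0 j, false_or] at h2
      linarith
    obtain ⟨a, ha⟩ := hker₀ _ h1 fun z hz => horth δ ⟨z, hz⟩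
    have h3 : ∀ z, B (A δ) z = 0 := fun z => by rw [ha, map_smul, hψ]; simp
    funext j
    obtain ⟨z, hz⟩ := hind (Pi.single j 1)
    have h4 := h3 z
    rw [hBA] at h4
    simp only [hz, Pi.single_apply, mul_ite, mul_one, mul_zero, Finset.sum_ite_eq',
      Finset.mem_univ, if_true, neg_eq_zero, mul_eq_zero, hp0 j, or_false] at h4
    simpa using h4
  have hHC : ∀ δ δ', fderiv ℝ (fderiv ℝ Λ) γ₀ δ δ' = k * C δ δ' := by
    intro δ δ'
    rw [hH]; rfl
  refine ⟨Λ, ⟨hΛ, hd0, ?_⟩, hΛ0, ?_, ?_⟩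
  · constructor
    · intro δ h
      refine hCker δ fun δ' => ?_
      have h' : fderiv ℝ (fderiv ℝ Λ) γ₀ δ δ' = 0 := h δ'
      rw [hHC] at h'
      exact (mul_eq_zero.mp h').resolve_left hk.ne
    · intro δ h
      refine hCker δ fun δ' => ?_
      have h' : fderiv ℝ (fderiv ℝ Λ) γ₀ δ' δ = 0 := h δ'
      rw [hHC, hCs] at h'
      exact (mul_eq_zero.mp h').resolve_left hk.ne
  · have e₁ : morseIndex Λ γ₀ = negIndex (-C) := negIndex_smul_of_neg hk fun δ => hHC δ δ
    set B₀ := B.bilinearComp Y₀.subtypeL Y₀.subtypeL with hB₀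
    have hB₀s : ∀ x y, B₀ x y = B₀ y x := fun x y => by
      simp only [hB₀, ContinuousLinearMap.bilinearComp_apply]
      exact hBs _ _
    have hψY : ψ ∈ Y₀ := (hY₀ ψ).mpr hpm
    -- The indices of `C` and `B₀` add up to at most that of `B`, and likewise for the opposite
    -- forms. With kernels of dimension 0, 1, 1 and `dim Y = dim Y₀ + card J`, Sylvester's law for
    -- the three forms forces equality in both.
    have i₁ := negIndex_add_negIndex_le hBs A Y₀.subtypeL horth
    have i₂ := negIndex_add_negIndex_le (B := -B) (fun x y => by simp [hBs x y]) A Y₀.subtypeL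
      fun a b => by simpa using horth a b
    have n₁ : (-B).bilinearComp A A = -C := rfl
    have n₂ : (-B).bilinearComp Y₀.subtypeL Y₀.subtypeL = -B₀ := rfl
    rw [n₁, n₂] at i₂
    rw [← hC, ← hB₀] at i₁
    have d₁ := negIndex_neg_add hBs
    rw [finrank_ker_eq_one hψ0 hψ hker] at d₁
    have d₂ := negIndex_neg_add hB₀s
    rw [finrank_ker_eq_one (ψ := (⟨ψ, hψY⟩ : Y₀)) (by simpa using hψ0)
      (by ext z; simp only [hB₀, ContinuousLinearMap.bilinearComp_apply]; simp [hψ])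
      (by
        rintro ⟨x, hx⟩ h
        obtain ⟨a, ha⟩ := hker₀ x hx fun z hz => by
          have := congrArg (fun g : Y₀ →L[ℝ] ℝ => g ⟨z, hz⟩) h
          exact this
        exact ⟨a, Subtype.ext ha⟩)] at d₂
    have d₃ := negIndex_neg_add hCs
    have k₃ : LinearMap.ker C.toLinearMap = ⊥ := by
      rw [LinearMap.ker_eq_bot']
      intro δ h
      refine hCker δ fun δ' => ?_
      exact congrArg (fun g : (J → ℝ) →L[ℝ] ℝ => g δ') h
    rw [k₃, finrank_bot, Module.finrank_fintype_fun_eq_card] at d₃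
    have d₄ : Module.finrank ℝ Y = Module.finrank ℝ Y₀ + Fintype.card J := by
      let T : Y →ₗ[ℝ] (J → ℝ) := LinearMap.pi fun j => (p j - m j).toLinearMap
      have hT : LinearMap.ker T = Y₀ := by
        ext x
        rw [LinearMap.mem_ker, hY₀, funext_iff]
        refine forall_congr' fun j => ?_
        change p j x - m j x = 0 ↔ _
        rw [sub_eq_zero]
      have hTs : LinearMap.range T = ⊤ := by
        rw [LinearMap.range_eq_top]
        intro v
        obtain ⟨z, hz⟩ := hind v
        exact ⟨z, funext hz⟩
      have := LinearMap.finrank_range_add_finrank_ker T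
      rw [hT, hTs, finrank_top, Module.finrank_fintype_fun_eq_card] at this
      omega
    rw [e₁]
    omega
  -- Along the branch the kernel always contains `w γ`, so its dimension does not fall below 1 and
  -- the index is locally constant.
  · have hc : ContinuousAt (fun γ => R (Λ γ) + D γ) γ₀ := by
      have h1 : ContinuousAt (fun γ => R (Λ γ)) γ₀ := by
        refine ContinuousAt.comp (g := R) ?_ hΛ.continuousAt
        rw [hΛ0]; exact hR.continuousAt
      have : ContinuousAdd (Y →L[ℝ] Y →L[ℝ] ℝ) :=
        ContinuousLinearMap.topologicalAddGroup.toContinuousAdd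
      exact h1.add D.continuous.continuousAt
    have hB' : R (Λ γ₀) + D γ₀ = B := by rw [hΛ0]
    have := eventually_negIndex_eq (R := fun γ => R (Λ γ) + D γ)
      (fun γ x y => by simp [hsymm (Λ γ) x y, hDs γ x y]) hc ?_
    · filter_upwards [hroot, this] with γ h1 h2
      exact ⟨h1, by rw [h2, hB']⟩
    · filter_upwards [hroot] with γ ⟨w, hw0, hw⟩
      rw [hB', finrank_ker_eq_one hψ0 hψ hker, Nat.one_le_iff_ne_zero, ne_eq,
        Submodule.finrank_eq_zero, Submodule.eq_bot_iff]
      intro h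
      exact hw0 (h w hw)

end Branch

/-! ### Bounded potentials and classical solutions, with differential equations imposed off
countable sets. -/

section Potential

/-- Bounded potentials that are continuous off a finite set. -/
structure IsPotential (q : ℝ → ℝ) (a b : ℝ) : Prop where
  cont : ∃ S : Finset ℝ, ContinuousOn q (Set.Icc a b \ S)
  bdd : ∃ K, ∀ x ∈ Set.Icc a b, |q x| ≤ K

/-- One-sided limits give local boundedness at every point, and compactness of the interval makes
the bound global. -/
theorem PiecewiseContinuous.isPotential {q : ℝ → ℝ} {a b : ℝ} (h : PiecewiseContinuous q a b) :
    IsPotential q a b := by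
  obtain ⟨hS, h₁, h₂⟩ := h
  refine ⟨hS, ?_⟩
  refine isCompact_Icc.induction_on (p := fun s => ∃ K, ∀ x ∈ s, |q x| ≤ K) ⟨0, by simp⟩ ?_ ?_ ?_
  · rintro s t hst ⟨K, hK⟩
    exact ⟨K, fun x hx => hK x (hst hx)⟩
  · rintro s t ⟨K, hK⟩ ⟨K', hK'⟩
    refine ⟨max K K', ?_⟩
    rintro x (hx | hx)
    · exact (hK x hx).trans (le_max_left _ _)
    · exact (hK' x hx).trans (le_max_right _ _)
  · intro x hx
    have hlim : ∀ {F : Filter ℝ}, (∃ l, Tendsto q F (𝓝 l)) → ∃ K, ∀ᶠ y in F, |q y| ≤ K := by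
      rintro F ⟨l, hl⟩
      refine ⟨|l| + 1, ?_⟩
      filter_upwards [hl.abs.eventually (gt_mem_nhds (lt_add_one |l|))] with y hy using hy.le
    have hr : ∃ K, ∀ᶠ y in 𝓝[>] x, y ∈ Set.Icc a b → |q y| ≤ K := by
      obtain hxb | hxb := hx.2.lt_or_eq
      · obtain ⟨K, hK⟩ := hlim (h₁ x ⟨hx.1, hxb⟩)
        exact ⟨K, hK.mono fun y hy _ => hy⟩
      · refine ⟨0, ?_⟩
        filter_upwards [self_mem_nhdsWithin] with y hy hyI
        exact absurd hyI.2 (not_le.mpr (hxb ▸ hy))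
    have hl : ∃ K, ∀ᶠ y in 𝓝[<] x, y ∈ Set.Icc a b → |q y| ≤ K := by
      obtain hxa | hxa := hx.1.lt_or_eq
      · obtain ⟨K, hK⟩ := hlim (h₂ x ⟨hxa, hx.2⟩)
        exact ⟨K, hK.mono fun y hy _ => hy⟩
      · refine ⟨0, ?_⟩
        filter_upwards [self_mem_nhdsWithin] with y hy hyI
        exact absurd hyI.1 (not_le.mpr (hxa ▸ hy))
    obtain ⟨K₁, hK₁⟩ := hl
    obtain ⟨K₂, hK₂⟩ := hr
    have : ∀ᶠ y in 𝓝 x, y ∈ Set.Icc a b → |q y| ≤ max (max K₁ K₂) |q x| := by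
      rw [← nhdsLT_sup_nhdsGE, ← nhdsGT_sup_nhdsWithin_singleton]
      refine eventually_sup.mpr ⟨?_, eventually_sup.mpr ⟨?_, ?_⟩⟩
      · exact hK₁.mono fun y hy hyI =>
          (hy hyI).trans ((le_max_left _ _).trans (le_max_left _ _))
      · exact hK₂.mono fun y hy hyI =>
          (hy hyI).trans ((le_max_right _ _).trans (le_max_left _ _))
      · filter_upwards [self_mem_nhdsWithin] with y hy _
        rw [Set.mem_singleton_iff.mp hy]
        exact le_max_right _ _
    refine ⟨_, inter_mem_nhdsWithin _ this, max (max K₁ K₂) |q x|, ?_⟩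
    rintro y ⟨hy, hy'⟩
    exact hy' hy

namespace IsPotential

variable {q : ℝ → ℝ} {a b : ℝ}

theorem mono (h : IsPotential q a b) {a' b' : ℝ} (ha : a ≤ a') (hb : b' ≤ b) :
    IsPotential q a' b' := by
  obtain ⟨⟨S, hS⟩, K, hK⟩ := h
  exact ⟨⟨S, hS.mono (Set.sdiff_subset_sdiff_left (Set.Icc_subset_Icc ha hb))⟩, K,
    fun x hx => hK x (Set.Icc_subset_Icc ha hb hx)⟩

theorem sub_const (h : IsPotential q a b) (μ : ℝ) : IsPotential (fun x => q x - μ) a b := by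
  obtain ⟨⟨S, hS⟩, K, hK⟩ := h
  exact ⟨⟨S, hS.sub continuousOn_const⟩, K + |μ|,
    fun x hx => (abs_sub _ _).trans (add_le_add_left (hK x hx) _)⟩

theorem integrableOn (h : IsPotential q a b) : IntegrableOn q (Set.Icc a b) := by
  obtain ⟨⟨S, hS⟩, K, hK⟩ := h
  have hm : AEStronglyMeasurable q (volume.restrict (Set.Icc a b)) := by
    have h1 := hS.aestronglyMeasurable (μ := volume)
      (measurableSet_Icc.diff S.measurableSet)
    have h2 : (Set.Icc a b \ (S : Set ℝ) : Set ℝ) =ᵐ[volume] Set.Icc a b :=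
      sdiff_null_ae_eq_self (S.finite_toSet.measure_zero _)
    rwa [Measure.restrict_congr_set h2] at h1
  refine Integrable.of_bound hm K ?_
  filter_upwards [ae_restrict_mem measurableSet_Icc] with x hx using hK x hx

theorem continuousAt (h : IsPotential q a b) :
    ∃ S : Finset ℝ, ∀ x ∈ Set.Ioo a b \ S, ContinuousAt q x := by
  obtain ⟨⟨S, hS⟩, -⟩ := h
  refine ⟨S, fun x hx => ?_⟩
  refine hS.continuousAt ?_
  rw [Set.sdiff_eq]
  exact inter_mem (Icc_mem_nhds hx.1.1 hx.1.2) (S.finite_toSet.isClosed.isOpen_compl.mem_nhds hx.2)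

end IsPotential

/-- `h` is continuously differentiable on `[a, b]` with derivative `h'`. -/
structure IsC1 (a b : ℝ) (h h' : ℝ → ℝ) : Prop where
  cont : ContinuousOn h (Set.Icc a b)
  cont' : ContinuousOn h' (Set.Icc a b)
  deriv : ∃ S : Set ℝ, S.Countable ∧ ∀ x ∈ Set.Ioo a b \ S, HasDerivAt h (h' x) x

/-- `f` solves `f'' = Q f` on `[a, b]`, and `f'` is its derivative. -/
structure IsSol (Q : ℝ → ℝ) (a b : ℝ) (f f' : ℝ → ℝ) : Prop extends IsC1 a b f f' where
  deriv2 : ∃ S : Set ℝ, S.Countable ∧ ∀ x ∈ Set.Ioo a b \ S, HasDerivAt f' (Q x * f x) x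

variable {Q : ℝ → ℝ} {a b : ℝ} {f f' h h' g g' : ℝ → ℝ}

theorem IsC1.mono (hh : IsC1 a b h h') {x y : ℝ} (hx : a ≤ x) (hy : y ≤ b) : IsC1 x y h h' := by
  obtain ⟨c, c', S, hS, d⟩ := hh
  exact ⟨c.mono (Set.Icc_subset_Icc hx hy), c'.mono (Set.Icc_subset_Icc hx hy), S, hS,
    fun z hz => d z ⟨Set.Ioo_subset_Ioo hx hy hz.1, hz.2⟩⟩

theorem IsC1.lin (hh : IsC1 a b h h') (hg : IsC1 a b g g') (α β : ℝ) :
    IsC1 a b (fun x => α * h x + β * g x) (fun x => α * h' x + β * g' x) := by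
  obtain ⟨c, c', S, hS, d⟩ := hh
  obtain ⟨e, e', S', hS', d'⟩ := hg
  refine ⟨by fun_prop, by fun_prop, S ∪ S', hS.union hS', fun x hx => ?_⟩
  exact ((d x ⟨hx.1, fun h => hx.2 (Or.inl h)⟩).const_mul α).add
    ((d' x ⟨hx.1, fun h => hx.2 (Or.inr h)⟩).const_mul β)

theorem IsSol.mono (hf : IsSol Q a b f f') {x y : ℝ} (hx : a ≤ x) (hy : y ≤ b) :
    IsSol Q x y f f' := by
  obtain ⟨S, hS, d⟩ := hf.deriv2
  exact ⟨hf.toIsC1.mono hx hy, S, hS,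
    fun z hz => d z ⟨Set.Ioo_subset_Ioo hx hy hz.1, hz.2⟩⟩

theorem IsSol.lin (hf : IsSol Q a b f f') (hg : IsSol Q a b g g') (α β : ℝ) :
    IsSol Q a b (fun x => α * f x + β * g x) (fun x => α * f' x + β * g' x) := by
  obtain ⟨S, hS, d⟩ := hf.deriv2
  obtain ⟨S', hS', d'⟩ := hg.deriv2
  refine ⟨hf.toIsC1.lin hg.toIsC1 α β, S ∪ S', hS.union hS', fun x hx => ?_⟩
  have := ((d x ⟨hx.1, fun h => hx.2 (Or.inl h)⟩).const_mul α).add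
    ((d' x ⟨hx.1, fun h => hx.2 (Or.inr h)⟩).const_mul β)
  convert! this using 1
  ring

theorem ContinuousOn.intervalIntegrable_mul {q u : ℝ → ℝ} (hab : a ≤ b)
    (hu : ContinuousOn u (Set.Icc a b)) (hq : IntegrableOn q (Set.Icc a b)) :
    IntervalIntegrable (fun x => q x * u x) volume a b := by
  have : IntervalIntegrable q volume a b := by
    rw [intervalIntegrable_iff_integrableOn_Icc_of_le hab]; exact hq
  exact this.mul_continuousOn (by rwa [Set.uIcc_of_le hab])

/-- Green's identity. -/
theorem IsSol.green (hab : a ≤ b) (hQ : IsPotential Q a b) (hf : IsSol Q a b f f')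
    (hh : IsC1 a b h h') :
    ∫ x in a..b, (f' x * h' x + Q x * (f x * h x)) = f' b * h b - f' a * h a := by
  obtain ⟨S, hS, d⟩ := hf.deriv2
  obtain ⟨S', hS', d'⟩ := hh.deriv
  have hi1 : IntervalIntegrable (fun x => f' x * h' x) volume a b := by
    refine ContinuousOn.intervalIntegrable ?_
    rw [Set.uIcc_of_le hab]
    exact hf.cont'.mul hh.cont'
  have hi2 := (hf.cont.mul hh.cont).intervalIntegrable_mul hab hQ.integrableOn
  refine integral_eq_of_hasDerivAt_off_countable_of_le (fun x => f' x * h x) _ hab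
    (hS.union hS') (hf.cont'.mul hh.cont) (fun x hx => ?_) (hi1.add hi2)
  convert! (d x ⟨hx.1, fun h => hx.2 (Or.inl h)⟩).mul
    (d' x ⟨hx.1, fun h => hx.2 (Or.inr h)⟩) using 1
  ring

theorem IsC1.integral_eq (hab : a ≤ b) (hh : IsC1 a b h h') :
    ∫ x in a..b, h' x = h b - h a := by
  obtain ⟨S', hS', d'⟩ := hh.deriv
  refine integral_eq_of_hasDerivAt_off_countable_of_le h h' hab hS' hh.cont d' ?_
  refine ContinuousOn.intervalIntegrable ?_
  rw [Set.uIcc_of_le hab]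
  exact hh.cont'

theorem IsSol.integral_eq (hab : a ≤ b) (hQ : IsPotential Q a b) (hf : IsSol Q a b f f') :
    ∫ x in a..b, Q x * f x = f' b - f' a := by
  obtain ⟨S, hS, d⟩ := hf.deriv2
  exact integral_eq_of_hasDerivAt_off_countable_of_le f' _ hab hS hf.cont' d
    (hf.cont.intervalIntegrable_mul hab hQ.integrableOn)

/-- The exceptional set disappears: `h` is the primitive of the continuous function `h'`, hence
differentiable everywhere. -/
theorem IsC1.hasDerivWithinAt (hh : IsC1 a b h h') {x : ℝ} (hx : x ∈ Set.Icc a b) :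
    HasDerivWithinAt h (h' x) (Set.Icc a b) x := by
  have hab : a ≤ b := hx.1.trans hx.2
  have hI : IntervalIntegrable h' volume a b := by
    refine ContinuousOn.intervalIntegrable ?_
    rw [Set.uIcc_of_le hab]
    exact hh.cont'
  have key : ∀ y ∈ Set.Icc a b, h y = h a + ∫ t in a..y, h' t := fun y hy => by
    rw [(hh.mono le_rfl hy.2).integral_eq hy.1]; ring
  have hfact : Fact (x ∈ Set.Icc a b) := ⟨hx⟩
  have hd : HasDerivWithinAt (fun y => ∫ t in a..y, h' t) (h' x) (Set.Icc a b) x := by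
    refine intervalIntegral.integral_hasDerivWithinAt_right (t := Set.Icc a b)
      (hI.mono_set ?_) ?_ (hh.cont' x hx)
    · rw [Set.uIcc_of_le hab, Set.uIcc_of_le hx.1]
      exact Set.Icc_subset_Icc le_rfl hx.2
    · exact hh.cont'.stronglyMeasurableAtFilter_nhdsWithin measurableSet_Icc x
  exact (hd.const_add (h a)).congr key (key x hx)

end Potential

/-! ### The initial value problem by Volterra operators, with smooth dependence on the spectral
parameter. -/

section Volterra

variable {a b : ℝ}

theorem IsPotential.intervalIntegrable_extend (hab : a ≤ b) {r : ℝ → ℝ} (hr : IsPotential r a b)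
    (u : C(Set.Icc a b, ℝ)) {x : ℝ} (hx : x ∈ Set.Icc a b) :
    IntervalIntegrable (fun t => r t * u (Set.projIcc a b hab t)) volume a x :=
  ContinuousOn.intervalIntegrable_mul hx.1 (by fun_prop) (hr.mono le_rfl hx.2).integrableOn

/-- The Volterra operator `u ↦ ∫ₐˣ r u`. -/
noncomputable def volterra (hab : a ≤ b) {r : ℝ → ℝ} (hr : IsPotential r a b) :
    C(Set.Icc a b, ℝ) →L[ℝ] C(Set.Icc a b, ℝ) :=
  LinearMap.mkContinuousOfExistsBound
    { toFun := fun u => ⟨fun x => ∫ t in a..(x : ℝ), r t * u (Set.projIcc a b hab t), by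
        have := intervalIntegral.continuousOn_primitive_interval (μ := volume) (a := a) (b := b)
          (f := fun t => r t * u (Set.projIcc a b hab t)) (by
            rw [Set.uIcc_of_le hab, ← intervalIntegrable_iff_integrableOn_Icc_of_le hab]
            exact hr.intervalIntegrable_extend hab u ⟨hab, le_rfl⟩)
        rw [Set.uIcc_of_le hab] at this
        exact this.domRestrict⟩
      map_add' := fun u v => by
        ext x
        simp only [ContinuousMap.coe_mk, ContinuousMap.add_apply, mul_add]
        exact intervalIntegral.integral_add (hr.intervalIntegrable_extend hab u x.2)
          (hr.intervalIntegrable_extend hab v x.2)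
      map_smul' := fun c u => by
        ext x
        change ∫ t in a..(x : ℝ), r t * (c * u (Set.projIcc a b hab t)) =
          c * ∫ t in a..(x : ℝ), r t * u (Set.projIcc a b hab t)
        rw [← intervalIntegral.integral_const_mul]
        congr 1
        ext t
        ring } (by
    obtain ⟨K, hK⟩ := hr.bdd
    have hK0 : 0 ≤ K := (abs_nonneg _).trans (hK a ⟨le_rfl, hab⟩)
    refine ⟨K * (b - a), fun u => ?_⟩
    rw [ContinuousMap.norm_le _ (mul_nonneg (mul_nonneg hK0 (by linarith)) (norm_nonneg _))]
    intro x
    refine (intervalIntegral.norm_integral_le_of_norm_le_const (C := K * ‖u‖) ?_).trans ?_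
    · intro t ht
      rw [Set.uIoc_of_le x.2.1] at ht
      rw [norm_mul]
      exact mul_le_mul (hK t ⟨ht.1.le, ht.2.trans x.2.2⟩) (u.norm_coe_le_norm _)
        (norm_nonneg _) hK0
    · rw [abs_of_nonneg (by linarith [x.2.1])]
      nlinarith [x.2.2, mul_nonneg hK0 (norm_nonneg u)])

theorem volterra_apply (hab : a ≤ b) {r : ℝ → ℝ} (hr : IsPotential r a b)
    (u : C(Set.Icc a b, ℝ)) (x : Set.Icc a b) :
    volterra hab hr u x = ∫ t in a..(x : ℝ), r t * u (Set.projIcc a b hab t) := rfl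

theorem isPotential_one : IsPotential (fun _ => 1) a b :=
  ⟨⟨∅, continuousOn_const⟩, 1, by simp⟩

/-- The operator is affine in `μ`; all smoothness in the spectral parameter comes from this. -/
theorem volterra_sub_const (hab : a ≤ b) {q : ℝ → ℝ} (hq : IsPotential q a b) (μ : ℝ) :
    volterra hab (hq.sub_const μ) =
      volterra hab hq - μ • volterra hab (isPotential_one (a := a) (b := b)) := by
  ext u x
  simp only [sub_apply, smul_apply, ContinuousMap.sub_apply, ContinuousMap.smul_apply,
    volterra_apply, smul_eq_mul]
  rw [← intervalIntegral.integral_const_mul, ← intervalIntegral.integral_sub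
    (hq.intervalIntegrable_extend hab u x.2)
    ((isPotential_one.intervalIntegrable_extend hab u x.2).const_mul μ)]
  congr 1
  ext t
  ring

/-- The integral operator of the initial value problem for `f'' = r f`. -/
noncomputable def volterra₂ (hab : a ≤ b) {r : ℝ → ℝ} (hr : IsPotential r a b) :
    C(Set.Icc a b, ℝ) →L[ℝ] C(Set.Icc a b, ℝ) :=
  volterra hab isPotential_one * volterra hab hr

/-- The outer integration of `(t - a) ^ n` produces the factor `1 / (n + 1)`. Iterating it yields
the factorial that makes large powers small. -/
theorem volterra₂_bound (hab : a ≤ b) {r : ℝ → ℝ} (hr : IsPotential r a b) {K : ℝ}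
    (hK : ∀ x ∈ Set.Icc a b, |r x| ≤ K) {v : C(Set.Icc a b, ℝ)} {M : ℝ} {n : ℕ}
    (hv : ∀ x : Set.Icc a b, |v x| ≤ M * ((x : ℝ) - a) ^ n) (x : Set.Icc a b) :
    |volterra₂ hab hr v x| ≤ K * M * (b - a) / (n + 1) * ((x : ℝ) - a) ^ (n + 1) := by
  have hK0 : 0 ≤ K := (abs_nonneg _).trans (hK a ⟨le_rfl, hab⟩)
  have h1 : ∀ y : Set.Icc a b, |volterra hab hr v y| ≤ K * M * (b - a) * ((y : ℝ) - a) ^ n := by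
    intro y
    have hy : 0 ≤ (y : ℝ) - a := by linarith [y.2.1]
    have hM : 0 ≤ M * ((y : ℝ) - a) ^ n := (abs_nonneg _).trans (hv y)
    rw [volterra_apply, ← Real.norm_eq_abs]
    refine (intervalIntegral.norm_integral_le_of_norm_le_const
      (C := K * (M * ((y : ℝ) - a) ^ n)) ?_).trans ?_
    · intro t ht
      rw [Set.uIoc_of_le y.2.1] at ht
      have htI : t ∈ Set.Icc a b := ⟨ht.1.le, ht.2.trans y.2.2⟩
      rw [norm_mul, Set.projIcc_of_mem hab htI]
      refine mul_le_mul (hK t htI) ((hv _).trans ?_) (norm_nonneg _) hK0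
      have hM' : 0 ≤ M := by
        have h0 : 0 < t - a := by linarith [ht.1]
        have := (abs_nonneg _).trans (hv ⟨t, htI⟩)
        exact nonneg_of_mul_nonneg_left this (pow_pos h0 n)
      refine mul_le_mul_of_nonneg_left ?_ hM'
      exact pow_le_pow_left₀ (by linarith [ht.1]) (by simpa using ht.2) n
    · rw [abs_of_nonneg hy]
      have : (y : ℝ) - a ≤ b - a := by linarith [y.2.2]
      calc K * (M * ((y : ℝ) - a) ^ n) * (y - a) ≤ K * (M * ((y : ℝ) - a) ^ n) * (b - a) :=
            mul_le_mul_of_nonneg_left this (mul_nonneg hK0 hM)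
        _ = _ := by ring
  change |volterra hab isPotential_one (volterra hab hr v) x| ≤ _
  rw [volterra_apply, ← Real.norm_eq_abs]
  refine (intervalIntegral.norm_integral_le_of_norm_le (g := fun t => K * M * (b - a) *
    (t - a) ^ n) x.2.1 ?_ (Continuous.intervalIntegrable (by fun_prop) _ _)).trans (le_of_eq ?_)
  · refine Eventually.of_forall fun t ht => ?_
    have htI : t ∈ Set.Icc a b := ⟨ht.1.le, ht.2.trans x.2.2⟩
    rw [one_mul, Set.projIcc_of_mem hab htI]
    exact h1 ⟨t, htI⟩
  · rw [intervalIntegral.integral_const_mul,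
      intervalIntegral.integral_comp_sub_right (fun t => t ^ n), integral_pow]
    simp
    ring

theorem volterra₂_pow_bound (hab : a ≤ b) {r : ℝ → ℝ} (hr : IsPotential r a b) {K : ℝ}
    (hK : ∀ x ∈ Set.Icc a b, |r x| ≤ K) (v : C(Set.Icc a b, ℝ)) (n : ℕ) (x : Set.Icc a b) :
    |(volterra₂ hab hr ^ n) v x| ≤
      ((K * (b - a)) ^ n / n.factorial * ‖v‖) * ((x : ℝ) - a) ^ n := by
  induction n generalizing x with
  | zero => simpa using v.norm_coe_le_norm x
  | succ n ih =>
    rw [pow_succ']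
    refine (volterra₂_bound hab hr hK ih x).trans (le_of_eq ?_)
    rw [Nat.factorial_succ]
    push_cast
    field_simp
    ring

/-- Some power `T ^ n` has norm less than 1, so `1 - T ^ n` is invertible. As `1 - T` is a commuting
factor of it, `1 - T` is invertible on an interval of any length. -/
theorem isUnit_one_sub_volterra₂ (hab : a ≤ b) {r : ℝ → ℝ} (hr : IsPotential r a b) :
    IsUnit (1 - volterra₂ hab hr) := by
  obtain ⟨K, hK⟩ := hr.bdd
  have hK0 : 0 ≤ K := (abs_nonneg _).trans (hK a ⟨le_rfl, hab⟩)
  have hba : 0 ≤ b - a := by linarith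
  obtain ⟨n, hn⟩ : ∃ n : ℕ, (K * (b - a) * (b - a)) ^ n / n.factorial < 1 :=
    ((FloorSemiring.tendsto_pow_div_factorial_atTop (K * (b - a) * (b - a))).eventually
      (gt_mem_nhds one_pos)).exists
  have hT : ‖volterra₂ hab hr ^ n‖ < 1 := by
    refine lt_of_le_of_lt (ContinuousLinearMap.opNorm_le_bound _ (by positivity) fun v => ?_) hn
    rw [ContinuousMap.norm_le _ (by positivity)]
    intro x
    refine (volterra₂_pow_bound hab hr hK v n x).trans ?_
    have : ((x : ℝ) - a) ^ n ≤ (b - a) ^ n :=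
      pow_le_pow_left₀ (by linarith [x.2.1]) (by linarith [x.2.2]) n
    calc _ ≤ ((K * (b - a)) ^ n / n.factorial * ‖v‖) * (b - a) ^ n :=
          mul_le_mul_of_nonneg_left this (by positivity)
      _ = _ := by rw [mul_pow (K * (b - a))]; ring
  have h1 : IsUnit (1 - volterra₂ hab hr ^ n) := 
    isUnit_one_sub_of_norm_lt_one (R := C(Set.Icc a b, ℝ) →L[ℝ] C(Set.Icc a b, ℝ)) hT
  rw [← mul_neg_geom_sum] at h1
  have hc : Commute (1 - volterra₂ hab hr) (∑ i ∈ Finset.range n, volterra₂ hab hr ^ i) := by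
    refine Commute.sum_right _ _ _ fun i _ => ?_
    exact ((Commute.one_left _).sub_left ((Commute.refl _).pow_right i))
  exact (hc.isUnit_mul_iff.mp h1).1

theorem contDiff_sub_smul {F : Type*} [NormedAddCommGroup F] [NormedSpace ℝ F] (A B : F) :
    ContDiff ℝ 3 fun μ : ℝ => A - μ • B := by
  fun_prop

/-- The solution with initial values `α`, `β` at `a`, depending smoothly on the spectral
parameter. -/
theorem exists_isSol (hab : a < b) {q : ℝ → ℝ} (hq : IsPotential q a b) (α β : ℝ) :
    ∃ f f' : ℝ → ℝ → ℝ, (∀ μ, IsSol (fun x => q x - μ) a b (f μ) (f' μ)) ∧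
      (∀ μ, f μ a = α) ∧ (∀ μ, f' μ a = β) ∧
      ∀ x, ContDiff ℝ 3 (fun μ => f μ x) ∧ ContDiff ℝ 3 (fun μ => f' μ x) := by
  have hab' := hab.le
  let U : ℝ → C(Set.Icc a b, ℝ) →L[ℝ] C(Set.Icc a b, ℝ) :=
    fun μ => 1 - volterra₂ hab' (hq.sub_const μ)
  have hUs : ContDiff ℝ 3 fun μ => volterra hab' (hq.sub_const μ) := by
    have : (fun μ => volterra hab' (hq.sub_const μ)) = fun μ => volterra hab' hq -
        μ • volterra hab' (isPotential_one (a := a) (b := b)) :=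
      funext fun μ => volterra_sub_const hab' hq μ
    rw [this]
    exact contDiff_sub_smul (F := C(Set.Icc a b, ℝ) →L[ℝ] C(Set.Icc a b, ℝ)) _ _
  have hU : ContDiff ℝ 3 U := by
    refine contDiff_const.sub ?_
    exact ContDiff.clm_comp contDiff_const hUs
  -- Inversion is smooth at the units of the algebra of operators.
  have hinv : ContDiff ℝ 3 fun μ => Ring.inverse (U μ) := by
    rw [contDiff_iff_contDiffAt]
    intro μ
    obtain ⟨u, hu⟩ := isUnit_one_sub_volterra₂ hab' (hq.sub_const μ)
    have h1 : ContDiffAt ℝ 3 Ring.inverse (U μ) := by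
      have := contDiffAt_ringInverse ℝ (n := 3)
        (R := C(Set.Icc a b, ℝ) →L[ℝ] C(Set.Icc a b, ℝ)) u
      rwa [hu] at this
    exact h1.comp μ hU.contDiffAt
  -- Integrating `f'' = (q - μ) f` twice from `a` gives `f = v₀ + volterra₂ f`, where `v₀` is the
  -- affine function with the same Cauchy data at `a`.
  let v₀ : C(Set.Icc a b, ℝ) := ⟨fun x => α + β * ((x : ℝ) - a), by fun_prop⟩
  let u : ℝ → C(Set.Icc a b, ℝ) := fun μ => Ring.inverse (U μ) v₀
  have hu : ContDiff ℝ 3 u := hinv.clm_apply contDiff_const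
  let w : ℝ → C(Set.Icc a b, ℝ) := fun μ => volterra hab' (hq.sub_const μ) (u μ)
  have hw : ContDiff ℝ 3 w := hUs.clm_apply hu
  have heq : ∀ μ x, u μ x = α + β * ((x : ℝ) - a) +
      ∫ t in a..(x : ℝ), w μ (Set.projIcc a b hab' t) := by
    intro μ x
    have h1 : U μ (u μ) = v₀ := by
      have : (U μ * Ring.inverse (U μ)) v₀ = v₀ := by
        rw [Ring.mul_inverse_cancel _ (isUnit_one_sub_volterra₂ hab' (hq.sub_const μ))]
        rfl
      exact this
    have h2 : U μ (u μ) = u μ - volterra hab' isPotential_one (w μ) := rfl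
    rw [h2] at h1
    have h3 := congrArg (fun g : C(Set.Icc a b, ℝ) => g x) h1
    simp only [ContinuousMap.sub_apply, volterra_apply, one_mul, v₀, ContinuousMap.coe_mk] at h3
    linarith
  have hev : ∀ (x : Set.Icc a b) (g : ℝ → C(Set.Icc a b, ℝ)), ContDiff ℝ 3 g →
      ContDiff ℝ 3 fun μ => g μ x := fun x g hg =>
    (ContinuousMap.evalCLM ℝ x : C(Set.Icc a b, ℝ) →L[ℝ] ℝ).contDiff.comp hg
  refine ⟨fun μ x => u μ (Set.projIcc a b hab' x), fun μ x => β + w μ (Set.projIcc a b hab' x),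
    fun μ => ⟨⟨by fun_prop, by fun_prop, ∅, Set.countable_empty, ?_⟩, ?_⟩, ?_, ?_,
    fun x => ⟨hev _ u hu, contDiff_const.add (hev _ w hw)⟩⟩
  · intro x hx
    have hx1 : x ∈ Set.Icc a b := Set.Ioo_subset_Icc_self hx.1
    have h1 : HasDerivAt (fun x => α + β * (x - a) +
        ∫ t in a..x, w μ (Set.projIcc a b hab' t)) (β + w μ (Set.projIcc a b hab' x)) x := by
      have h2 : HasDerivAt (fun x => α + β * (x - a)) β x := by
        simpa using (((hasDerivAt_id x).sub_const a).const_mul β).const_add α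
      refine h2.add ?_
      have hc : Continuous fun t => w μ (Set.projIcc a b hab' t) := by fun_prop
      exact intervalIntegral.integral_hasDerivAt_right (hc.intervalIntegrable _ _)
        (hc.stronglyMeasurableAtFilter _ _) hc.continuousAt
    refine h1.congr_of_eventuallyEq ?_
    filter_upwards [Icc_mem_nhds hx.1.1 hx.1.2] with y hy
    rw [Set.projIcc_of_mem hab' hy, heq]
  · obtain ⟨S, hS⟩ := (hq.sub_const μ).continuousAt
    refine ⟨S, S.finite_toSet.countable, fun x hx => ?_⟩
    have hx1 : x ∈ Set.Icc a b := Set.Ioo_subset_Icc_self hx.1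
    have h1 : HasDerivAt (fun x => β + ∫ t in a..x, (q t - μ) * u μ (Set.projIcc a b hab' t))
        ((q x - μ) * u μ (Set.projIcc a b hab' x)) x := by
      refine HasDerivAt.const_add β ?_
      have hc : Continuous fun t => u μ (Set.projIcc a b hab' t) := by fun_prop
      refine intervalIntegral.integral_hasDerivAt_right
        ((hq.sub_const μ).intervalIntegrable_extend hab' (u μ) hx1) ?_
        ((hS x hx).mul hc.continuousAt)
      have hi := (hq.sub_const μ).intervalIntegrable_extend hab' (u μ) ⟨hab', le_rfl⟩
      rw [intervalIntegrable_iff_integrableOn_Icc_of_le hab'] at hi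
      exact ⟨Set.Icc a b, Icc_mem_nhds hx.1.1 hx.1.2, hi.aestronglyMeasurable⟩
    refine h1.congr_of_eventuallyEq ?_
    filter_upwards [Icc_mem_nhds hx.1.1 hx.1.2] with y hy
    rw [Set.projIcc_of_mem hab' hy, volterra_apply]
  · intro μ
    have := heq μ ⟨a, le_rfl, hab'⟩
    simpa [Set.projIcc_left] using this
  · intro μ
    simp [Set.projIcc_left, w, volterra_apply]

/-- With zero Cauchy data, `f` is a fixed point of `volterra₂`, and `1 - volterra₂` is injective. -/
theorem IsSol.eq_zero {Q : ℝ → ℝ} (hab : a < b) (hQ : IsPotential Q a b) {f f' : ℝ → ℝ}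
    (hf : IsSol Q a b f f') (h0 : f a = 0) (h0' : f' a = 0) {x : ℝ} (hx : x ∈ Set.Icc a b) :
    f x = 0 ∧ f' x = 0 := by
  have hab' := hab.le
  let u : C(Set.Icc a b, ℝ) :=
    ⟨fun x => f x, hf.cont.comp_continuous continuous_subtype_val fun x => x.2⟩
  let v : C(Set.Icc a b, ℝ) :=
    ⟨fun x => f' x, hf.cont'.comp_continuous continuous_subtype_val fun x => x.2⟩
  have h1 : volterra hab' hQ u = v := by
    ext y
    rw [volterra_apply]
    have := (hf.mono le_rfl y.2.2).integral_eq y.2.1 (hQ.mono le_rfl y.2.2)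
    rw [h0', sub_zero] at this
    change _ = f' y
    rw [← this]
    refine intervalIntegral.integral_congr fun t ht => ?_
    rw [Set.uIcc_of_le y.2.1] at ht
    have htI : t ∈ Set.Icc a b := ⟨ht.1, ht.2.trans y.2.2⟩
    simp only [u, ContinuousMap.coe_mk]
    rw [Set.projIcc_of_mem hab' htI]
  have h2 : volterra hab' isPotential_one v = u := by
    ext y
    rw [volterra_apply]
    have := (hf.toIsC1.mono le_rfl y.2.2).integral_eq y.2.1
    rw [h0, sub_zero] at this
    change _ = f y
    rw [← this]
    refine intervalIntegral.integral_congr fun t ht => ?_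
    rw [Set.uIcc_of_le y.2.1] at ht
    have htI : t ∈ Set.Icc a b := ⟨ht.1, ht.2.trans y.2.2⟩
    simp only [v, ContinuousMap.coe_mk]
    rw [Set.projIcc_of_mem hab' htI, one_mul]
  have h3 : (1 - volterra₂ hab' hQ) u = 0 := by
    change u - volterra hab' isPotential_one (volterra hab' hQ u) = 0
    rw [h1, h2, sub_self]
  have hu : u = 0 := by
    obtain ⟨e, he⟩ := isUnit_one_sub_volterra₂ hab' hQ
    rw [← he] at h3
    have : ((↑e⁻¹ : C(Set.Icc a b, ℝ) →L[ℝ] C(Set.Icc a b, ℝ)) * e) u = 0 := by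
      change (↑e⁻¹ : C(Set.Icc a b, ℝ) →L[ℝ] C(Set.Icc a b, ℝ)) (e.val u) = 0
      rw [h3, map_zero]
    simpa using this
  have hv : v = 0 := by rw [← h1, hu, map_zero]
  exact ⟨congrArg (fun g : C(Set.Icc a b, ℝ) => g ⟨x, hx⟩) hu,
    congrArg (fun g : C(Set.Icc a b, ℝ) => g ⟨x, hx⟩) hv⟩

end Volterra

/-! ### Energy inequalities on short intervals. -/

section Energy

variable {Q : ℝ → ℝ} {x y : ℝ} {f f' h h' g g' : ℝ → ℝ}

/-- The energy `∫ (h'² + Q h²)`. -/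
noncomputable def energy (Q : ℝ → ℝ) (x y : ℝ) (h h' : ℝ → ℝ) : ℝ :=
  ∫ z in x..y, (h' z ^ 2 + Q z * h z ^ 2)

theorem IsC1.intervalIntegrable_sq (hxy : x ≤ y) (hh : IsC1 x y h h') :
    IntervalIntegrable (fun z => h' z ^ 2) volume x y := by
  refine ContinuousOn.intervalIntegrable ?_
  rw [Set.uIcc_of_le hxy]
  exact hh.cont'.pow 2

theorem IsC1.intervalIntegrable_energy (hxy : x ≤ y) (hQ : IsPotential Q x y) (hh : IsC1 x y h h') :
    IntervalIntegrable (fun z => h' z ^ 2 + Q z * h z ^ 2) volume x y :=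
  (hh.intervalIntegrable_sq hxy).add ((hh.cont.pow 2).intervalIntegrable_mul hxy hQ.integrableOn)

/-- Cauchy–Schwarz for `h z = ∫ h'`, read off from `∫ (h' - s) ^ 2 ≥ 0` with `s` the mean slope on
`[x, z]`. -/
theorem IsC1.sq_le (hh : IsC1 x y h h') (h0 : h x = 0) {z : ℝ} (hz : z ∈ Set.Icc x y) :
    h z ^ 2 ≤ (y - x) * ∫ t in x..y, h' t ^ 2 := by
  have hxy := hz.1.trans hz.2
  have hI := hh.intervalIntegrable_sq hxy
  have hnn : 0 ≤ ∫ t in x..y, h' t ^ 2 :=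
    intervalIntegral.integral_nonneg hxy fun t _ => sq_nonneg _
  obtain rfl | hlt := hz.1.eq_or_lt
  · rw [h0]
    have : 0 ≤ y - x := by linarith
    simpa using mul_nonneg this hnn
  have hz' := hh.mono le_rfl hz.2
  have hc : ContinuousOn h' (Set.uIcc x z) := by rw [Set.uIcc_of_le hz.1]; exact hz'.cont'
  set s := h z / (z - x) with hs
  have h1 : 0 ≤ ∫ t in x..z, (h' t - s) ^ 2 :=
    intervalIntegral.integral_nonneg hz.1 fun t _ => sq_nonneg _
  have h2 : ∫ t in x..z, (h' t - s) ^ 2 =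
      (∫ t in x..z, h' t ^ 2) - 2 * s * h z + s ^ 2 * (z - x) := by
    have e : ∀ t, (h' t - s) ^ 2 = h' t ^ 2 - 2 * s * h' t + s ^ 2 := fun t => by ring
    simp_rw [e]
    rw [intervalIntegral.integral_add, intervalIntegral.integral_sub,
      intervalIntegral.integral_const_mul, hz'.integral_eq hz.1, h0]
    · simp; ring
    · exact hz'.intervalIntegrable_sq hz.1
    · exact (hc.intervalIntegrable).const_mul _
    · exact (hz'.intervalIntegrable_sq hz.1).sub ((hc.intervalIntegrable).const_mul _)
    · exact intervalIntegrable_const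
  have h3 : ∫ t in x..z, h' t ^ 2 ≤ ∫ t in x..y, h' t ^ 2 := by
    refine intervalIntegral.integral_mono_interval le_rfl hz.1 hz.2 ?_ hI
    exact Eventually.of_forall fun t => sq_nonneg _
  have hzx : 0 < z - x := by linarith
  have h4 : h z ^ 2 ≤ (z - x) * ∫ t in x..z, h' t ^ 2 := by
    rw [h2] at h1
    have : s * (z - x) = h z := by rw [hs]; field_simp
    nlinarith
  calc h z ^ 2 ≤ (z - x) * ∫ t in x..z, h' t ^ 2 := h4
    _ ≤ (z - x) * ∫ t in x..y, h' t ^ 2 := mul_le_mul_of_nonneg_left h3 hzx.le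
    _ ≤ _ := mul_le_mul_of_nonneg_right (by linarith [hz.2]) hnn

/-- On a short interval the energy is positive on functions vanishing at the left end. -/
theorem IsC1.sq_le_energy (hQ : IsPotential Q x y) {k : ℝ} (hk : 0 ≤ k)
    (hkQ : ∀ z ∈ Set.Icc x y, -k ≤ Q z) (hshort : k * (y - x) ^ 2 < 1) (hh : IsC1 x y h h')
    (h0 : h x = 0) {z : ℝ} (hz : z ∈ Set.Icc x y) :
    (1 - k * (y - x) ^ 2) * h z ^ 2 ≤ (y - x) * energy Q x y h h' := by
  have hxy := hz.1.trans hz.2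
  set I := ∫ t in x..y, h' t ^ 2 with hI
  -- Pointwise `Q h ^ 2 ≥ -k h ^ 2 ≥ -k (y - x) I`; integration over an interval of length `y - x`
  -- gives the second factor `y - x`.
  have h1 : (1 - k * (y - x) ^ 2) * I ≤ energy Q x y h h' := by
    have h2 : ∫ t in x..y, (h' t ^ 2 - k * ((y - x) * I)) ≤ energy Q x y h h' := by
      refine intervalIntegral.integral_mono_on hxy
        ((hh.intervalIntegrable_sq hxy).sub intervalIntegrable_const)
        (hh.intervalIntegrable_energy hxy hQ) fun t ht => ?_
      have h3 := hh.sq_le h0 ht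
      have h4 := mul_le_mul_of_nonneg_right (hkQ t ht) (sq_nonneg (h t))
      have h5 := mul_le_mul_of_nonneg_left h3 hk
      linarith
    rw [intervalIntegral.integral_sub (hh.intervalIntegrable_sq hxy) intervalIntegrable_const]
      at h2
    simp only [intervalIntegral.integral_const, smul_eq_mul] at h2
    rw [← hI] at h2
    linarith
  have h3 := hh.sq_le h0 hz
  have h6 := mul_le_mul_of_nonneg_left h3 (by linarith : 0 ≤ 1 - k * (y - x) ^ 2)
  have h7 := mul_le_mul_of_nonneg_left h1 (by linarith : 0 ≤ y - x)
  linarith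

theorem IsC1.energy_nonneg (hxy : x ≤ y) (hQ : IsPotential Q x y) {k : ℝ} (hk : 0 ≤ k)
    (hkQ : ∀ z ∈ Set.Icc x y, -k ≤ Q z) (hshort : k * (y - x) ^ 2 < 1) (hh : IsC1 x y h h')
    (h0 : h x = 0) : 0 ≤ energy Q x y h h' := by
  obtain rfl | hlt := hxy.eq_or_lt
  · simp [energy]
  have := hh.sq_le_energy hQ hk hkQ hshort h0 (z := x) ⟨le_rfl, hxy⟩
  rw [h0] at this
  by_contra hneg
  nlinarith

theorem IsSol.energy_eq (hxy : x ≤ y) (hQ : IsPotential Q x y) (hf : IsSol Q x y f f') :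
    energy Q x y f f' = f' y * f y - f' x * f x := by
  rw [← hf.green hxy hQ hf.toIsC1, energy]
  congr 1
  ext z
  ring

/-- A solution minimises the energy among the functions with the same boundary values. -/
theorem IsSol.energy_le (hxy : x ≤ y) (hQ : IsPotential Q x y) {k : ℝ} (hk : 0 ≤ k)
    (hkQ : ∀ z ∈ Set.Icc x y, -k ≤ Q z) (hshort : k * (y - x) ^ 2 < 1) (hf : IsSol Q x y f f')
    (hh : IsC1 x y h h') (hx : f x = h x) (hy : f y = h y) :
    energy Q x y f f' ≤ energy Q x y h h' := by
  have hd := hh.lin hf.toIsC1 1 (-1)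
  have h1 := hd.energy_nonneg hxy hQ hk hkQ hshort (by simp [hx])
  have h2 := hf.green hxy hQ hd
  -- Expand the energy of `h = f + (h - f)`. The cross term vanishes by Green's identity because `h
  -- - f` is zero at both ends, and the last energy is non-negative because the interval is short.
  have e : energy Q x y h h' = energy Q x y f f' +
      2 * (∫ z in x..y, (f' z * (1 * h' z + -1 * f' z) + Q z * (f z * (1 * h z + -1 * f z)))) +
      energy Q x y (fun x => 1 * h x + -1 * f x) (fun x => 1 * h' x + -1 * f' x) := by
    have i1 := hf.toIsC1.intervalIntegrable_energy hxy hQ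
    have i3 := hd.intervalIntegrable_energy hxy hQ
    have i2 : IntervalIntegrable (fun z => f' z * (1 * h' z + -1 * f' z) +
        Q z * (f z * (1 * h z + -1 * f z))) volume x y := by
      refine IntervalIntegrable.add ?_ ((hf.cont.mul hd.cont).intervalIntegrable_mul hxy
        hQ.integrableOn)
      refine ContinuousOn.intervalIntegrable ?_
      rw [Set.uIcc_of_le hxy]
      exact hf.cont'.mul hd.cont'
    rw [energy, energy, energy, ← intervalIntegral.integral_const_mul,
      ← intervalIntegral.integral_add i1 (i2.const_mul 2),
      ← intervalIntegral.integral_add (i1.add (i2.const_mul 2)) i3]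
    congr 1
    ext z
    ring
  rw [e, h2]
  simp only [hx, hy]
  nlinarith

/-- A trace inequality at both ends of an interval. -/
theorem IsC1.trace_le (hxy : x < y) (hh : IsC1 x y h h') {L : ℝ} (hL : 0 < L) :
    L * (h x ^ 2 + h y ^ 2) ≤
      ∫ z in x..y, (h' z ^ 2 + 2 * L * (2 * L + 1 / (y - x)) * h z ^ 2) := by
  have hl : 0 < y - x := by linarith
  obtain ⟨S, hS, hd⟩ := hh.deriv
  have hcu : Set.uIcc x y = Set.Icc x y := Set.uIcc_of_le hxy.le
  have ch := hh.cont
  have ch' := hh.cont'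
  have i0 : IntervalIntegrable (fun z => h' z ^ 2 + 2 * L * (2 * L + 1 / (y - x)) * h z ^ 2)
      volume x y := by
    refine ContinuousOn.intervalIntegrable ?_
    rw [hcu]; fun_prop
  -- The weight `p + p' z` will be the affine function equal to 1 at one end and 0 at the other.
  -- Integrating the derivative of the weight times `h ^ 2` isolates one boundary value, and `2 L |2
  -- h h'| ≤ h' ^ 2 + (2 L h) ^ 2` controls the mixed term.
  have key : ∀ (p p' : ℝ), |p'| ≤ 1 / (y - x) → (∀ z ∈ Set.Icc x y, |p + p' * z| ≤ 1) →
      |(p + p' * y) * h y ^ 2 - (p + p' * x) * h x ^ 2| * (2 * L) ≤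
        ∫ z in x..y, (h' z ^ 2 + 2 * L * (2 * L + 1 / (y - x)) * h z ^ 2) := by
    intro p p' hp' hp
    have i1 : IntervalIntegrable (fun z => p' * h z ^ 2 + (p + p' * z) * (2 * h z * h' z))
        volume x y := by
      refine ContinuousOn.intervalIntegrable ?_
      rw [hcu]; fun_prop
    have h1 := integral_eq_of_hasDerivAt_off_countable_of_le
      (fun z => (p + p' * z) * h z ^ 2)
      (fun z => p' * h z ^ 2 + (p + p' * z) * (2 * h z * h' z)) hxy.le hS (by fun_prop)
      (fun z hz => by
        have a1 : HasDerivAt (fun z => p + p' * z) p' z := by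
          simpa using ((hasDerivAt_id z).const_mul p').const_add p
        have a2 := a1.mul ((hd z hz).pow 2)
        convert! a2 using 1
        simp) i1
    rw [← h1, ← Real.norm_eq_abs, mul_comm]
    have h2 := intervalIntegral.norm_integral_le_integral_norm (μ := volume)
      (f := fun z => p' * h z ^ 2 + (p + p' * z) * (2 * h z * h' z)) hxy.le
    refine (mul_le_mul_of_nonneg_left h2 (by linarith : 0 ≤ 2 * L)).trans ?_
    rw [← intervalIntegral.integral_const_mul]
    refine intervalIntegral.integral_mono_on hxy.le (i1.norm.const_mul _) i0 fun z hz => ?_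
    rw [Real.norm_eq_abs]
    have b1 : |p' * h z ^ 2| ≤ 1 / (y - x) * h z ^ 2 := by
      rw [abs_mul, abs_of_nonneg (sq_nonneg (h z))]
      exact mul_le_mul_of_nonneg_right hp' (sq_nonneg _)
    have b2 : |(p + p' * z) * (2 * h z * h' z)| ≤ |2 * h z * h' z| := by
      rw [abs_mul]
      exact mul_le_of_le_one_left (abs_nonneg _) (hp z hz)
    have b3 : 2 * L * |2 * h z * h' z| ≤ h' z ^ 2 + 2 * L * (2 * L) * h z ^ 2 := by
      have : 2 * L * |2 * h z * h' z| = 2 * ((2 * L * |h z|) * |h' z|) := by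
        rw [abs_mul, abs_mul]; norm_num; ring
      rw [this, ← sq_abs (h z), ← sq_abs (h' z)]
      nlinarith [sq_nonneg (2 * L * |h z| - |h' z|)]
    have b4 := abs_add_le (p' * h z ^ 2) ((p + p' * z) * (2 * h z * h' z))
    have b5 := mul_le_mul_of_nonneg_left (b4.trans (add_le_add b1 b2)) (by linarith : 0 ≤ 2 * L)
    linarith
  have k1 := key (-(x / (y - x))) (1 / (y - x)) (by rw [abs_of_pos (by positivity)]) (by
    intro z hz
    have e : -(x / (y - x)) + 1 / (y - x) * z = (z - x) / (y - x) := by field_simp; ring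
    rw [e, abs_of_nonneg (div_nonneg (by linarith [hz.1]) hl.le), div_le_one hl]
    linarith [hz.2])
  have k2 := key (y / (y - x)) (-(1 / (y - x))) (by rw [abs_neg, abs_of_pos (by positivity)]) (by
    intro z hz
    have e : y / (y - x) + -(1 / (y - x)) * z = (y - z) / (y - x) := by field_simp; ring
    rw [e, abs_of_nonneg (div_nonneg (by linarith [hz.2]) hl.le), div_le_one hl]
    linarith [hz.1])
  have e1 : (-(x / (y - x)) + 1 / (y - x) * y) = 1 := by field_simp; ring
  have e2 : (-(x / (y - x)) + 1 / (y - x) * x) = 0 := by field_simp; ring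
  have e3 : (y / (y - x) + -(1 / (y - x)) * y) = 0 := by field_simp; ring
  have e4 : (y / (y - x) + -(1 / (y - x)) * x) = 1 := by field_simp; ring
  rw [e1, e2, one_mul, zero_mul, sub_zero, abs_of_nonneg (sq_nonneg _)] at k1
  rw [e3, e4, one_mul, zero_mul, zero_sub, abs_neg, abs_of_nonneg (sq_nonneg _)] at k2
  linarith

end Energy

/-! ### Fundamental systems and Dirichlet-to-Neumann forms of short intervals. -/

/-- The fundamental system of solutions of `-f'' + q f = μ f` on `[a, b]`, normalised at `a`. -/
structure FundSys (q : ℝ → ℝ) (a b : ℝ) where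
  c : ℝ → ℝ → ℝ
  c' : ℝ → ℝ → ℝ
  s : ℝ → ℝ → ℝ
  s' : ℝ → ℝ → ℝ
  isSol_c : ∀ μ, IsSol (fun x => q x - μ) a b (c μ) (c' μ)
  isSol_s : ∀ μ, IsSol (fun x => q x - μ) a b (s μ) (s' μ)
  c_left : ∀ μ, c μ a = 1
  c'_left : ∀ μ, c' μ a = 0
  s_left : ∀ μ, s μ a = 0
  s'_left : ∀ μ, s' μ a = 1
  contDiff_c : ∀ x, ContDiff ℝ 3 fun μ => c μ x
  contDiff_c' : ∀ x, ContDiff ℝ 3 fun μ => c' μ x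
  contDiff_s : ∀ x, ContDiff ℝ 3 fun μ => s μ x
  contDiff_s' : ∀ x, ContDiff ℝ 3 fun μ => s' μ x

theorem nonempty_fundSys {q : ℝ → ℝ} {a b : ℝ} (hab : a < b) (hq : IsPotential q a b) :
    Nonempty (FundSys q a b) := by
  obtain ⟨c, c', h1, h2, h3, h4⟩ := exists_isSol hab hq 1 0
  obtain ⟨s, s', k1, k2, k3, k4⟩ := exists_isSol hab hq 0 1
  exact ⟨⟨c, c', s, s', h1, k1, h2, h3, k2, k3, fun x => (h4 x).1, fun x => (h4 x).2,
    fun x => (k4 x).1, fun x => (k4 x).2⟩⟩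

/-- `[x, y]` is so short that the Dirichlet energy of `q - K` is positive definite. -/
def IsShort (q : ℝ → ℝ) (K x y : ℝ) : Prop :=
  ∃ k, 0 ≤ k ∧ k * (y - x) ^ 2 < 1 ∧ ∀ z ∈ Set.Icc x y, -k ≤ q z - K

namespace FundSys

variable {q : ℝ → ℝ} {a b : ℝ} (F : FundSys q a b)

/-- The solution with Cauchy data `0`, `1` at `x`, evaluated at `y`. -/
noncomputable def σ (μ x y : ℝ) : ℝ := F.c μ x * F.s μ y - F.s μ x * F.c μ y

/-- The diagonal coefficients of the Dirichlet-to-Neumann form of `[x, y]`. -/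
noncomputable def coeffL (μ x y : ℝ) : ℝ :=
  (F.c μ y * F.s' μ x - F.s μ y * F.c' μ x) / F.σ μ x y

noncomputable def coeffR (μ x y : ℝ) : ℝ :=
  (F.c μ x * F.s' μ y - F.s μ x * F.c' μ y) / F.σ μ x y

/-- The Dirichlet-to-Neumann form of `[x, y]`. -/
noncomputable def form (μ x y α β α' β' : ℝ) : ℝ :=
  F.coeffL μ x y * (α * α') - (F.σ μ x y)⁻¹ * (α * β' + β * α') + F.coeffR μ x y * (β * β')

variable {F}

theorem isSol_σ (μ x : ℝ) :
    IsSol (fun x => q x - μ) a b (fun y => F.σ μ x y)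
      (fun y => F.c μ x * F.s' μ y - F.s μ x * F.c' μ y) := by
  have e₁ : (fun y => F.σ μ x y) = fun y => F.c μ x * F.s μ y + -F.s μ x * F.c μ y := by
    ext y; simp only [FundSys.σ]; ring
  have e₂ : (fun y => F.c μ x * F.s' μ y - F.s μ x * F.c' μ y) =
      fun y => F.c μ x * F.s' μ y + -F.s μ x * F.c' μ y := by
    ext y; ring
  rw [e₁, e₂]
  exact (F.isSol_s μ).lin (F.isSol_c μ) (F.c μ x) (-F.s μ x)

/-- The solution of the Dirichlet problem on `[x, y]`. -/
theorem exists_interp {μ x y : ℝ} (hσ : F.σ μ x y ≠ 0) (α β : ℝ) :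
    ∃ A B : ℝ, A * F.c μ x + B * F.s μ x = α ∧ A * F.c μ y + B * F.s μ y = β := by
  refine ⟨(α * F.s μ y - β * F.s μ x) / F.σ μ x y, (β * F.c μ x - α * F.c μ y) / F.σ μ x y,
    ?_, ?_⟩ <;> field_simp <;> simp only [FundSys.σ] <;> ring

theorem contDiffAt_coeff {μ x y : ℝ} (hσ : F.σ μ x y ≠ 0) :
    ContDiffAt ℝ 3 (fun μ => F.coeffL μ x y) μ ∧ ContDiffAt ℝ 3 (fun μ => (F.σ μ x y)⁻¹) μ ∧
      ContDiffAt ℝ 3 (fun μ => F.coeffR μ x y) μ := by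
  have c := fun x => (F.contDiff_c x).contDiffAt (x := μ)
  have c' := fun x => (F.contDiff_c' x).contDiffAt (x := μ)
  have s := fun x => (F.contDiff_s x).contDiffAt (x := μ)
  have s' := fun x => (F.contDiff_s' x).contDiffAt (x := μ)
  have hσs : ContDiffAt ℝ 3 (fun μ => F.σ μ x y) μ :=
    ((c x).mul (s y)).sub ((s x).mul (c y))
  exact ⟨(((c y).mul (s' x)).sub ((s y).mul (c' x))).div hσs hσ, hσs.inv hσ,
    (((c x).mul (s' y)).sub ((s x).mul (c' y))).div hσs hσ⟩

theorem wronskian (hq : IsPotential q a b)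
    (μ : ℝ) {x : ℝ} (hx : x ∈ Set.Icc a b) :
    F.c μ x * F.s' μ x - F.c' μ x * F.s μ x = 1 := by
  have hq' := (hq.sub_const μ).mono le_rfl hx.2
  have hc := (F.isSol_c μ).mono le_rfl hx.2
  have hs := (F.isSol_s μ).mono le_rfl hx.2
  have h1 := hc.green hx.1 hq' hs.toIsC1
  have h2 := hs.green hx.1 hq' hc.toIsC1
  have e : ∀ z, F.c' μ z * F.s' μ z + (q z - μ) * (F.c μ z * F.s μ z) =
      F.s' μ z * F.c' μ z + (q z - μ) * (F.s μ z * F.c μ z) := fun z => by ring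
  simp_rw [e] at h1
  rw [h1, F.c_left, F.c'_left, F.s_left, F.s'_left] at h2
  linarith

theorem eq_lin (hab : a < b) (hq : IsPotential q a b)
    {μ : ℝ} {f f' : ℝ → ℝ} (hf : IsSol (fun x => q x - μ) a b f f') {x : ℝ}
    (hx : x ∈ Set.Icc a b) :
    f x = f a * F.c μ x + f' a * F.s μ x ∧ f' x = f a * F.c' μ x + f' a * F.s' μ x := by
  have h1 := hf.lin ((F.isSol_c μ).lin (F.isSol_s μ) (f a) (f' a)) 1 (-1)
  have h2 := h1.eq_zero hab (hq.sub_const μ) (by simp [F.c_left, F.s_left])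
    (by simp [F.c'_left, F.s'_left]) hx
  constructor <;> linarith [h2.1, h2.2]

/-- The value at `y` in terms of the Cauchy data at `x`. -/
theorem eq_of_cauchy (hab : a < b) (hq : IsPotential q a b)
    {μ : ℝ} {f f' : ℝ → ℝ} (hf : IsSol (fun x => q x - μ) a b f f') {x y : ℝ}
    (hx : x ∈ Set.Icc a b) (hy : y ∈ Set.Icc a b) (h0 : f x = 0) : f y = f' x * F.σ μ x y := by
  obtain ⟨h1, h2⟩ := F.eq_lin hab hq hf hx
  obtain ⟨h3, -⟩ := F.eq_lin hab hq hf hy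
  have hw := F.wronskian hq μ hx
  rw [h2, h3, FundSys.σ]
  rw [h0] at h1
  linear_combination (-(f a * F.c μ y) - f' a * F.s μ y) * hw +
    (F.c' μ x * F.s μ y - F.s' μ x * F.c μ y) * h1

/-- Otherwise the solution `σ μ x` vanishes at both ends, so its energy is zero. On a short interval
this makes it vanish identically, against its slope 1 at `x`. -/
theorem σ_ne_zero (hq : IsPotential q a b)
    {K μ x y : ℝ} (hμ : μ ≤ K) (hx : a ≤ x) (hxy : x < y) (hy : y ≤ b)
    (hs : IsShort q K x y) : F.σ μ x y ≠ 0 := by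
  intro h0
  obtain ⟨k, hk, hks, hkq⟩ := hs
  have hsol := (F.isSol_σ μ x).mono hx hy
  have hpot := (hq.sub_const μ).mono hx hy
  have hxx : F.σ μ x x = 0 := by simp only [FundSys.σ]; ring
  have he := hsol.energy_eq hxy.le hpot
  rw [h0, hxx, mul_zero, mul_zero, sub_zero] at he
  have hz : ∀ z ∈ Set.Icc x y, F.σ μ x z = 0 := by
    intro z hz
    have := hsol.toIsC1.sq_le_energy hpot hk (fun z hz => by linarith [hkq z hz]) hks hxx hz
    rw [he, mul_zero] at this
    have h2 : F.σ μ x z ^ 2 ≤ 0 := by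
      by_contra hneg
      nlinarith
    exact pow_eq_zero_iff two_ne_zero |>.mp (le_antisymm h2 (sq_nonneg _))
  have hxI : x ∈ Set.Icc x y := ⟨le_rfl, hxy.le⟩
  have hd := hsol.toIsC1.hasDerivWithinAt hxI
  have hd0 : HasDerivWithinAt (fun y => F.σ μ x y) 0 (Set.Icc x y) x :=
    (hasDerivWithinAt_const x _ (0 : ℝ)).congr hz hxx
  have := (uniqueDiffOn_Icc hxy x hxI).eq_deriv _ hd hd0
  have hw := F.wronskian hq μ (x := x) ⟨hx, hxy.le.trans hy⟩
  linarith

/-- Positivity holds just to the right of `x` because the slope there is 1. A non-positive value at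
`y` would create a zero in `(x, y]`, which `σ_ne_zero` excludes on the still shorter interval. -/
theorem σ_pos (hq : IsPotential q a b)
    {K μ x y : ℝ} (hμ : μ ≤ K) (hx : a ≤ x) (hxy : x < y) (hy : y ≤ b)
    (hs : IsShort q K x y) : 0 < F.σ μ x y := by
  have hsol := (F.isSol_σ μ x).mono hx hy
  have hxx : F.σ μ x x = 0 := by simp only [FundSys.σ]; ring
  have hxI : x ∈ Set.Icc x y := ⟨le_rfl, hxy.le⟩
  have hd := (hsol.toIsC1.hasDerivWithinAt hxI)
  have hw := F.wronskian hq μ (x := x) ⟨hx, hxy.le.trans hy⟩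
  have hev : ∀ᶠ z in 𝓝[Set.Ioc x y] x, 0 < F.σ μ x z := by
    have h1 := (hasDerivWithinAt_iff_tendsto_slope' (by simp)).mp
      (hd.mono Set.Ioc_subset_Icc_self)
    have h2 : 0 < F.c μ x * F.s' μ x - F.s μ x * F.c' μ x := by linarith
    filter_upwards [h1.eventually (lt_mem_nhds h2), self_mem_nhdsWithin] with z hz hzI
    rw [slope_def_field, hxx, sub_zero] at hz
    have : 0 < z - x := by linarith [hzI.1]
    exact (div_pos_iff_of_pos_right this).mp hz
  have hne : (𝓝[Set.Ioc x y] x).NeBot := by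
    rw [nhdsWithin_Ioc_eq_nhdsGT hxy]
    infer_instance
  obtain ⟨z, hz, hzI⟩ := (hev.and self_mem_nhdsWithin).exists
  by_contra hneg
  have hc : ContinuousOn (fun y => F.σ μ x y) (Set.Icc z y) :=
    hsol.cont.mono (Set.Icc_subset_Icc hzI.1.le le_rfl)
  obtain ⟨w, hw, hw0⟩ := intermediate_value_Icc' hzI.2 hc ⟨not_lt.mp hneg, hz.le⟩
  obtain ⟨k, hk, hks, hkq⟩ := hs
  have hxw : x < w := hzI.1.trans_le hw.1
  refine F.σ_ne_zero hq hμ hx hxw (hw.2.trans hy) ⟨k, hk, ?_, fun t ht =>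
    hkq t ⟨ht.1, ht.2.trans hw.2⟩⟩ hw0
  refine lt_of_le_of_lt (mul_le_mul_of_nonneg_left ?_ hk) hks
  exact pow_le_pow_left₀ (by linarith) (by linarith [hw.2]) 2

/-- The boundary term of a solution is its Dirichlet-to-Neumann form. -/
theorem form_eq (hab : a < b) (hq : IsPotential q a b)
    {μ x y : ℝ} (hx : x ∈ Set.Icc a b) (hy : y ∈ Set.Icc a b) (hσ : F.σ μ x y ≠ 0)
    {f f' : ℝ → ℝ} (hf : IsSol (fun x => q x - μ) a b f f') (α' β' : ℝ) :
    F.form μ x y (f x) (f y) α' β' = f' y * β' - f' x * α' := by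
  obtain ⟨h1, h2⟩ := F.eq_lin hab hq hf hx
  obtain ⟨h3, h4⟩ := F.eq_lin hab hq hf hy
  have hwx := F.wronskian hq μ hx
  have hwy := F.wronskian hq μ hy
  rw [h1, h2, h3, h4, form, coeffL, coeffR]
  field_simp
  simp only [FundSys.σ]
  linear_combination (α' * (f a * F.c μ y + f' a * F.s μ y)) * hwx +
    (β' * (f a * F.c μ x + f' a * F.s μ x)) * hwy

/-- The form is the energy of the solution with the same boundary values, and this solution
minimises the energy. -/
theorem form_le_energy (hab : a < b) (hq : IsPotential q a b)
    {K μ x y : ℝ} (hμ : μ ≤ K) (hx : a ≤ x) (hxy : x < y) (hy : y ≤ b)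
    (hs : IsShort q K x y) {h h' : ℝ → ℝ} (hh : IsC1 x y h h') :
    F.form μ x y (h x) (h y) (h x) (h y) ≤ energy (fun z => q z - μ) x y h h' := by
  have hσ := F.σ_ne_zero hq hμ hx hxy hy hs
  obtain ⟨A, B, h1, h2⟩ := F.exists_interp hσ (h x) (h y)
  have hsol := (F.isSol_c μ).lin (F.isSol_s μ) A B
  have hpot := (hq.sub_const μ).mono hx hy
  obtain ⟨k, hk, hks, hkq⟩ := hs
  have h3 := (hsol.mono hx hy).energy_le hxy.le hpot hk (fun z hz => by linarith [hkq z hz]) hks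
    hh h1 h2
  have h4 := F.form_eq hab hq ⟨hx, hxy.le.trans hy⟩ ⟨hx.trans hxy.le, hy⟩ hσ hsol (h x) (h y)
  rw [(hsol.mono hx hy).energy_eq hxy.le hpot] at h3
  simp only [h1, h2] at h3 h4
  rw [h4]
  exact h3

/-- Once `μ` is so negative that `q - μ` exceeds the coefficient of `h ^ 2` in `IsC1.trace_le`, that
inequality bounds the energy of the solution from below. -/
theorem exists_forall_le_form (hab : a < b) (hq : IsPotential q a b)
    {K x y : ℝ} (hx : a ≤ x) (hxy : x < y) (hy : y ≤ b)
    (hs : IsShort q K x y) {L : ℝ} (hL : 0 < L) :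
    ∃ M, ∀ μ ≤ M, ∀ α β, L * (α ^ 2 + β ^ 2) ≤ F.form μ x y α β α β := by
  obtain ⟨C, hC⟩ := hq.bdd
  refine ⟨min K (-C - 2 * L * (2 * L + 1 / (y - x))), fun μ hμ α β => ?_⟩
  have hμK := hμ.trans (min_le_left _ _)
  have hμC := hμ.trans (min_le_right _ _)
  have hσ := F.σ_ne_zero hq hμK hx hxy hy hs
  obtain ⟨A, B, h1, h2⟩ := F.exists_interp hσ α β
  have hsol := (F.isSol_c μ).lin (F.isSol_s μ) A B
  have hpot := (hq.sub_const μ).mono hx hy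
  have h4 := F.form_eq hab hq ⟨hx, hxy.le.trans hy⟩ ⟨hx.trans hxy.le, hy⟩ hσ hsol α β
  have h5 := (hsol.mono hx hy).toIsC1.trace_le hxy hL
  have h6 := (hsol.mono hx hy).energy_eq hxy.le hpot
  simp only [h1, h2] at h4 h5 h6
  rw [h4, ← h6]
  refine h5.trans ?_
  have hc := (hsol.mono hx hy).cont
  have hc' := (hsol.mono hx hy).cont'
  refine intervalIntegral.integral_mono_on hxy.le ?_
    ((hsol.mono hx hy).toIsC1.intervalIntegrable_energy hxy.le hpot) fun z hz => ?_
  · refine ContinuousOn.intervalIntegrable ?_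
    rw [Set.uIcc_of_le hxy.le]
    fun_prop
  · have hb := (abs_le.mp (hC z ⟨hx.trans hz.1, hz.2.trans hy⟩)).1
    refine add_le_add le_rfl (mul_le_mul_of_nonneg_right ?_ (sq_nonneg _))
    linarith

end FundSys

/-! ### Meshes, nodal vectors and the nodal form. -/

/-- Edges `[lo e, hi e]` with potentials, fundamental systems and subdivisions into pieces that are
short with respect to the level `K`. -/
structure Mesh (E : Type*) (K : ℝ) where
  lo : E → ℝ
  hi : E → ℝ
  q : E → ℝ → ℝ
  lo_lt_hi : ∀ e, lo e < hi e
  pot : ∀ e, IsPotential (q e) (lo e) (hi e)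
  sys : ∀ e, FundSys (q e) (lo e) (hi e)
  N : ℕ
  t : E → Fin (N + 1) → ℝ
  t_zero : ∀ e, t e 0 = lo e
  t_last : ∀ e, t e (Fin.last N) = hi e
  t_lt : ∀ e (i : Fin N), t e i.castSucc < t e i.succ
  short : ∀ e (i : Fin N), IsShort (q e) K (t e i.castSucc) (t e i.succ)

theorem Fin.sum_succ_sub_castSucc {N : ℕ} (g : Fin (N + 1) → ℝ) :
    ∑ i : Fin N, (g i.succ - g i.castSucc) = g (Fin.last N) - g 0 := by
  have h1 := Fin.sum_univ_succ g
  have h2 := Fin.sum_univ_castSucc g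
  rw [Finset.sum_sub_distrib]
  linarith

theorem contDiffAt_smul_sub_add {F : Type*} [NormedAddCommGroup F] [NormedSpace ℝ F]
    {a b c : ℝ → ℝ} {μ : ℝ} (ha : ContDiffAt ℝ 3 a μ) (hb : ContDiffAt ℝ 3 b μ)
    (hc : ContDiffAt ℝ 3 c μ) (A B C : F) :
    ContDiffAt ℝ 3 (fun ν => a ν • A - b ν • B + c ν • C) μ := by
  fun_prop

namespace Mesh

variable {V E : Type*} [Fintype V] [Fintype E] {K : ℝ} (m : Mesh E K)

theorem strictMono (e : E) : StrictMono (m.t e) :=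
  Fin.strictMono_iff_lt_succ.mpr (m.t_lt e)

theorem mem_Icc (e : E) (i : Fin (m.N + 1)) : m.t e i ∈ Set.Icc (m.lo e) (m.hi e) := by
  rw [← m.t_zero, ← m.t_last]
  exact ⟨(m.strictMono e).monotone (Fin.zero_le i), (m.strictMono e).monotone (Fin.le_last i)⟩

theorem N_pos (e : E) : 0 < m.N := by
  by_contra h
  have h0 : m.N = 0 := by omega
  have h1 : (Fin.last m.N) = 0 := Fin.ext (by simp [h0])
  have h2 := m.t_last e
  rw [h1, m.t_zero] at h2
  exact (m.lo_lt_hi e).ne h2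

theorem σ_pos {μ : ℝ} (hμ : μ ≤ K) (e : E) (i : Fin m.N) :
    0 < (m.sys e).σ μ (m.t e i.castSucc) (m.t e i.succ) :=
  (m.sys e).σ_pos (m.pot e) hμ (m.mem_Icc e _).1 (m.t_lt e i) (m.mem_Icc e _).2
    (m.short e i)

theorem sum_energy {Q : ℝ → ℝ} {e : E} (hQ : IsPotential Q (m.lo e) (m.hi e)) {h h' : ℝ → ℝ}
    (hh : IsC1 (m.lo e) (m.hi e) h h') :
    ∑ i : Fin m.N, energy Q (m.t e i.castSucc) (m.t e i.succ) h h' =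
      energy Q (m.lo e) (m.hi e) h h' := by
  have hI := hh.intervalIntegrable_energy (m.lo_lt_hi e).le hQ
  have hsub : ∀ i, IntervalIntegrable (fun z => h' z ^ 2 + Q z * h z ^ 2) volume
      (m.lo e) (m.t e i) := fun i => hI.mono_set (by
    rw [Set.uIcc_of_le (m.mem_Icc e i).1, Set.uIcc_of_le (m.lo_lt_hi e).le]
    exact Set.Icc_subset_Icc le_rfl (m.mem_Icc e i).2)
  have h1 := Fin.sum_succ_sub_castSucc fun i : Fin (m.N + 1) =>
    energy Q (m.lo e) (m.t e i) h h'
  rw [m.t_last, m.t_zero] at h1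
  have h0 : energy Q (m.lo e) (m.lo e) h h' = 0 := by simp [energy]
  rw [h0, sub_zero] at h1
  rw [← h1]
  refine Finset.sum_congr rfl fun i _ => ?_
  exact (intervalIntegral.integral_interval_sub_left (hsub _) (hsub _)).symm

/-- Nodal vectors: values at the vertices and at the points of the subdivision. -/
abbrev Nodal (V : Type*) {E : Type*} {K : ℝ} (m : Mesh E K) : Type _ :=
  (V → ℝ) × (E → Fin (m.N + 1) → ℝ)

variable (V) in
/-- The value at the `i`-th point of the subdivision of `e`. -/
noncomputable def node (e : E) (i : Fin (m.N + 1)) : Nodal V m →L[ℝ] ℝ :=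
  (ContinuousLinearMap.proj (R := ℝ) (φ := fun _ : Fin (m.N + 1) => ℝ) i).comp
    ((ContinuousLinearMap.proj (R := ℝ) (φ := fun _ : E => Fin (m.N + 1) → ℝ) e).comp
      (ContinuousLinearMap.snd ℝ (V → ℝ) _))

@[simp] theorem node_apply (e : E) (i : Fin (m.N + 1)) (y : Nodal V m) :
    m.node V e i y = y.2 e i := rfl

/-- The value at a vertex. -/
noncomputable def vertex (v : V) : Nodal V m →L[ℝ] ℝ :=
  (ContinuousLinearMap.proj v).comp (ContinuousLinearMap.fst ℝ _ _)

@[simp] theorem vertex_apply (v : V) (y : Nodal V m) : m.vertex v y = y.1 v := rfl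

variable (V) in
/-- The sum of the Dirichlet-to-Neumann forms of the pieces. -/
noncomputable def edgeForm (μ : ℝ) : Nodal V m →L[ℝ] Nodal V m →L[ℝ] ℝ :=
  ∑ e, ∑ i : Fin m.N,
    ((m.sys e).coeffL μ (m.t e i.castSucc) (m.t e i.succ) •
        (m.node V e i.castSucc).smulRight (m.node V e i.castSucc) -
      ((m.sys e).σ μ (m.t e i.castSucc) (m.t e i.succ))⁻¹ •
        ((m.node V e i.castSucc).smulRight (m.node V e i.succ) +
          (m.node V e i.succ).smulRight (m.node V e i.castSucc)) +
      (m.sys e).coeffR μ (m.t e i.castSucc) (m.t e i.succ) •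
        (m.node V e i.succ).smulRight (m.node V e i.succ))

theorem edgeForm_apply (μ : ℝ) (y z : Nodal V m) :
    m.edgeForm V μ y z = ∑ e, ∑ i : Fin m.N, (m.sys e).form μ (m.t e i.castSucc) (m.t e i.succ)
      (y.2 e i.castSucc) (y.2 e i.succ) (z.2 e i.castSucc) (z.2 e i.succ) := by
  simp only [edgeForm, sum_apply]
  refine Finset.sum_congr rfl fun e _ => Finset.sum_congr rfl fun i _ => ?_
  simp only [add_apply, sub_apply, smul_apply, ContinuousLinearMap.smulRight_apply, node_apply,
    smul_eq_mul, FundSys.form]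

theorem contDiffAt_edgeForm {μ : ℝ} (hμ : μ < K) : ContDiffAt ℝ 3 (m.edgeForm V) μ := by
  refine ContDiffAt.sum fun e _ => ContDiffAt.sum fun i _ => ?_
  obtain ⟨h1, h2, h3⟩ := (m.sys e).contDiffAt_coeff (m.σ_pos hμ.le e i).ne'
  exact contDiffAt_smul_sub_add (F := Nodal V m →L[ℝ] Nodal V m →L[ℝ] ℝ) h1 h2 h3 _ _ _

theorem edgeForm_symm (μ : ℝ) (y z : Nodal V m) : m.edgeForm V μ y z = m.edgeForm V μ z y := by
  rw [edgeForm_apply, edgeForm_apply]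
  refine Finset.sum_congr rfl fun e _ => Finset.sum_congr rfl fun i _ => ?_
  simp only [FundSys.form]
  ring

/-- The contribution of the `δ`-type conditions. -/
noncomputable def vertexForm (χ : V → ℝ) : Nodal V m →L[ℝ] Nodal V m →L[ℝ] ℝ :=
  ∑ v, χ v • (m.vertex v).smulRight (m.vertex v)

theorem vertexForm_apply (χ : V → ℝ) (y z : Nodal V m) :
    m.vertexForm χ y z = ∑ v, χ v * (y.1 v * z.1 v) := by
  simp only [vertexForm, sum_apply]
  refine Finset.sum_congr rfl fun v _ => ?_
  simp

/-- The form of the quantum graph on nodal vectors. -/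
noncomputable def nodalForm (χ : V → ℝ) (μ : ℝ) : Nodal V m →L[ℝ] Nodal V m →L[ℝ] ℝ :=
  m.edgeForm V μ + m.vertexForm χ

theorem nodalForm_apply (χ : V → ℝ) (μ : ℝ) (y z : Nodal V m) :
    m.nodalForm χ μ y z = m.edgeForm V μ y z + ∑ v, χ v * (y.1 v * z.1 v) := by
  rw [nodalForm, add_apply, add_apply, vertexForm_apply]

theorem nodalForm_symm (χ : V → ℝ) (μ : ℝ) (y z : Nodal V m) :
    m.nodalForm χ μ y z = m.nodalForm χ μ z y := by
  rw [nodalForm_apply, nodalForm_apply, edgeForm_symm]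
  congr 1
  exact Finset.sum_congr rfl fun v _ => by ring

theorem contDiffAt_nodalForm (χ : V → ℝ) {μ : ℝ} (hμ : μ < K) :
    ContDiffAt ℝ 3 (m.nodalForm χ) μ :=
  (m.contDiffAt_edgeForm hμ).add contDiffAt_const

/-- The form in terms of the boundary values of the solutions on the edges. -/
theorem edgeForm_of_isSol {μ : ℝ} (hμ : μ ≤ K) {f f' : E → ℝ → ℝ}
    (hf : ∀ e, IsSol (fun x => m.q e x - μ) (m.lo e) (m.hi e) (f e) (f' e)) {y : Nodal V m}
    (hy : ∀ e i, y.2 e i = f e (m.t e i)) (z : Nodal V m) :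
    m.edgeForm V μ y z = ∑ e, (f' e (m.hi e) * z.2 e (Fin.last _) - f' e (m.lo e) * z.2 e 0) := by
  rw [edgeForm_apply]
  refine Finset.sum_congr rfl fun e _ => ?_
  have htel := Fin.sum_succ_sub_castSucc fun i => f' e (m.t e i) * z.2 e i
  rw [m.t_last e, m.t_zero e] at htel
  rw [← htel]
  refine Finset.sum_congr rfl fun i _ => ?_
  rw [hy, hy]
  exact (m.sys e).form_eq (m.lo_lt_hi e) (m.pot e) (m.mem_Icc e _) (m.mem_Icc e _)
    (m.σ_pos hμ e i).ne' (hf e) _ _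

theorem edgeForm_le_energy {μ : ℝ} (hμ : μ ≤ K) {h h' : E → ℝ → ℝ}
    (hh : ∀ e, IsC1 (m.lo e) (m.hi e) (h e) (h' e)) {y : Nodal V m}
    (hy : ∀ e i, y.2 e i = h e (m.t e i)) :
    m.edgeForm V μ y y ≤ ∑ e, energy (fun x => m.q e x - μ) (m.lo e) (m.hi e) (h e) (h' e) := by
  rw [edgeForm_apply]
  refine Finset.sum_le_sum fun e _ => ?_
  rw [← m.sum_energy ((m.pot e).sub_const μ) (hh e)]
  refine Finset.sum_le_sum fun i _ => ?_
  rw [hy, hy]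
  exact (m.sys e).form_le_energy (m.lo_lt_hi e) (m.pot e) hμ (m.mem_Icc e _).1 (m.t_lt e i)
    (m.mem_Icc e _).2 (m.short e i) ((hh e).mono (m.mem_Icc e _).1 (m.mem_Icc e _).2)

theorem exists_forall_le_edgeForm {L : ℝ} (hL : 0 < L) : ∃ M, ∀ μ ≤ M, ∀ y : Nodal V m,
    L * ∑ e, ∑ i : Fin m.N, (y.2 e i.castSucc ^ 2 + y.2 e i.succ ^ 2) ≤ m.edgeForm V μ y y := by
  choose M hM using fun (e : E) (i : Fin m.N) => (m.sys e).exists_forall_le_form (m.lo_lt_hi e)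
    (m.pot e) (m.mem_Icc e _).1 (m.t_lt e i) (m.mem_Icc e _).2 (m.short e i) hL
  obtain ⟨M₀, hM₀⟩ := (Set.finite_range fun p : E × Fin m.N => M p.1 p.2).bddBelow
  refine ⟨M₀, fun μ hμ y => ?_⟩
  rw [edgeForm_apply, Finset.mul_sum]
  refine Finset.sum_le_sum fun e _ => ?_
  rw [Finset.mul_sum]
  refine Finset.sum_le_sum fun i _ => ?_
  exact hM e i μ (hμ.trans (hM₀ ⟨(e, i), rfl⟩)) _ _

/-- If the node equations hold at the interior points of the subdivision, the nodal values are
those of solutions on the edges. -/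
theorem exists_isSol [DecidableEq E] {μ : ℝ} (hμ : μ ≤ K) (y : Nodal V m)
    (hy : ∀ z : Nodal V m, z.1 = 0 → (∀ e, z.2 e 0 = 0) → (∀ e, z.2 e (Fin.last _) = 0) →
      m.edgeForm V μ y z = 0) :
    ∃ A B : E → ℝ, ∀ e i,
      y.2 e i = A e * (m.sys e).c μ (m.t e i) + B e * (m.sys e).s μ (m.t e i) := by
  -- On each piece the two nodal values are interpolated by a solution. It remains to see that its
  -- coefficients do not change from piece to piece.
  choose A B hA hB using fun (e : E) (i : Fin m.N) =>
    (m.sys e).exists_interp (m.σ_pos hμ e i).ne' (y.2 e i.castSucc) (y.2 e i.succ)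
  have hform : ∀ (e : E) (i : Fin m.N) (α β : ℝ),
      (m.sys e).form μ (m.t e i.castSucc) (m.t e i.succ) (y.2 e i.castSucc) (y.2 e i.succ) α β =
      (A e i * (m.sys e).c' μ (m.t e i.succ) + B e i * (m.sys e).s' μ (m.t e i.succ)) * β -
      (A e i * (m.sys e).c' μ (m.t e i.castSucc) +
        B e i * (m.sys e).s' μ (m.t e i.castSucc)) * α := by
    intro e i α β
    have := (m.sys e).form_eq (m.lo_lt_hi e) (m.pot e) (m.mem_Icc e i.castSucc)
      (m.mem_Icc e i.succ) (m.σ_pos hμ e i).ne'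
      (((m.sys e).isSol_c μ).lin ((m.sys e).isSol_s μ) (A e i) (B e i)) α β
    simp only [hA, hB] at this
    exact this
  have hstep : ∀ (e : E) (k : ℕ) (hk : k + 1 < m.N),
      A e ⟨k, by omega⟩ = A e ⟨k + 1, hk⟩ ∧ B e ⟨k, by omega⟩ = B e ⟨k + 1, hk⟩ := by
    intro e k hk
    set i : Fin m.N := ⟨k, by omega⟩
    set j : Fin m.N := ⟨k + 1, hk⟩
    have hij : i.succ = j.castSucc := rfl
    -- Testing at a single interior node says that the one-sided derivatives agree there. The values
    -- agree as well, and since the Wronskian is 1, equal Cauchy data mean equal coefficients.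
    let z : Nodal V m := (0, Pi.single e (Pi.single i.succ 1))
    have hz := hy z rfl (fun e' => by
      by_cases h : e' = e
      · subst h
        have : (0 : Fin (m.N + 1)) ≠ i.succ := (Fin.succ_ne_zero i).symm
        simp [z, this]
      · simp [z, h]) (fun e' => by
      by_cases h : e' = e
      · subst h
        have : Fin.last m.N ≠ i.succ := by
          rw [hij]; exact (Fin.castSucc_lt_last j).ne'
        simp [z, this]
      · simp [z, h])
    rw [edgeForm_apply, Finset.sum_eq_single e] at hz
    · have hz' : ∀ k : Fin m.N, (z.2 e k.castSucc = if k = j then 1 else 0) ∧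
          (z.2 e k.succ = if k = i then 1 else 0) := by
        intro k
        constructor
        · simp only [z, Pi.single_eq_same, hij, Pi.single_apply, Fin.castSucc_inj]
        · simp only [z, Pi.single_eq_same, Pi.single_apply, Fin.succ_inj]
      simp only [hform, (hz' _).1, (hz' _).2, mul_ite, mul_one, mul_zero,
        Finset.sum_sub_distrib, Finset.sum_ite_eq', Finset.mem_univ, if_true] at hz
      have h1 := hB e i
      have h2 := hA e j
      rw [← hij] at h2 hz
      have hw := (m.sys e).wronskian (m.pot e) μ (m.mem_Icc e i.succ)
      rw [← h1] at h2
      generalize (m.sys e).c μ (m.t e i.succ) = c at *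
      generalize (m.sys e).s μ (m.t e i.succ) = s at *
      generalize (m.sys e).c' μ (m.t e i.succ) = c' at *
      generalize (m.sys e).s' μ (m.t e i.succ) = s' at *
      constructor
      · linear_combination (-(A e i) + A e j) * hw - s' * h2 - s * hz
      · linear_combination (-(B e i) + B e j) * hw + c' * h2 + c * hz
    · intro e' _ he'
      refine Finset.sum_eq_zero fun k _ => ?_
      simp [z, he', FundSys.form]
    · simp
  have hconst : ∀ (e : E) (k : ℕ) (hk : k < m.N),
      A e ⟨k, hk⟩ = A e ⟨0, m.N_pos e⟩ ∧ B e ⟨k, hk⟩ = B e ⟨0, m.N_pos e⟩ := by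
    intro e k
    induction k with
    | zero => intro hk; exact ⟨rfl, rfl⟩
    | succ k ih =>
      intro hk
      obtain ⟨h1, h2⟩ := ih (by omega)
      obtain ⟨h3, h4⟩ := hstep e k hk
      exact ⟨h3.symm.trans h1, h4.symm.trans h2⟩
  refine ⟨fun e => A e ⟨0, m.N_pos e⟩, fun e => B e ⟨0, m.N_pos e⟩, fun e i => ?_⟩
  induction i using Fin.lastCases with
  | last =>
    have hN := m.N_pos e
    have hl : Fin.last m.N = (⟨m.N - 1, by omega⟩ : Fin m.N).succ := Fin.ext (by simp; omega)
    obtain ⟨h1, h2⟩ := hconst e (m.N - 1) (by omega)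
    rw [hl, ← hB e ⟨m.N - 1, by omega⟩, h1, h2]
  | cast i =>
    obtain ⟨h1, h2⟩ := hconst e i i.2
    beta_reduce
    rw [← hA e i, ← h1, ← h2]

end Mesh

/-! ### Restriction of families of forms along a linear map. -/

section Restrict

variable {Y Z : Type*} [NormedAddCommGroup Y] [NormedSpace ℝ Y]
  [NormedAddCommGroup Z] [NormedSpace ℝ Z]

theorem contDiffAt_bilinearComp {R : ℝ → Y →L[ℝ] Y →L[ℝ] ℝ} {μ : ℝ} (hR : ContDiffAt ℝ 3 R μ)
    (A : Z →L[ℝ] Y) : ContDiffAt ℝ 3 (fun ν => (R ν).bilinearComp A A) μ := by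
  have h1 : ContDiffAt ℝ 3 (fun ν => (R ν).comp A) μ := hR.clm_comp contDiffAt_const
  have h2 : ContDiffAt ℝ 3 (fun ν => ((R ν).comp A).flip) μ := by
    let T : (Z →L[ℝ] Y →L[ℝ] ℝ) →L[ℝ] (Y →L[ℝ] Z →L[ℝ] ℝ) :=
      ((ContinuousLinearMap.flipₗᵢ ℝ Z Y ℝ).toContinuousLinearEquiv :
        (Z →L[ℝ] Y →L[ℝ] ℝ) →L[ℝ] (Y →L[ℝ] Z →L[ℝ] ℝ))
    have h := ContDiffAt.continuousLinearMap_comp (F := Z →L[ℝ] Y →L[ℝ] ℝ)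
      (G := Y →L[ℝ] Z →L[ℝ] ℝ) T h1
    exact h
  have h3 : ContDiffAt ℝ 3 (fun ν => ((R ν).comp A).flip.comp A) μ :=
    h2.clm_comp contDiffAt_const
  let T : (Z →L[ℝ] Z →L[ℝ] ℝ) →L[ℝ] (Z →L[ℝ] Z →L[ℝ] ℝ) :=
    ((ContinuousLinearMap.flipₗᵢ ℝ Z Z ℝ).toContinuousLinearEquiv :
      (Z →L[ℝ] Z →L[ℝ] ℝ) →L[ℝ] (Z →L[ℝ] Z →L[ℝ] ℝ))
  have h := ContDiffAt.continuousLinearMap_comp (F := Z →L[ℝ] Z →L[ℝ] ℝ)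
    (G := Z →L[ℝ] Z →L[ℝ] ℝ) T h3
  exact h

theorem deriv_bilinearComp {R : ℝ → Y →L[ℝ] Y →L[ℝ] ℝ} {μ : ℝ} (hR : ContDiffAt ℝ 3 R μ)
    (A : Z →L[ℝ] Y) (z : Z) :
    deriv (fun ν => (R ν).bilinearComp A A) μ z z = deriv (fun ν => R ν (A z) (A z)) μ := by
  have h1 := ((contDiffAt_bilinearComp hR A).differentiableAt (by norm_num)).hasDerivAt
  have h2 : HasDerivAt (fun ν => (R ν).bilinearComp A A z)
      (deriv (fun ν => (R ν).bilinearComp A A) μ z) μ := by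
    simpa using h1.clm_apply (hasDerivAt_const μ z)
  have h3 : HasDerivAt (fun ν => (R ν).bilinearComp A A z z)
      (deriv (fun ν => (R ν).bilinearComp A A) μ z z) μ := by
    simpa using h2.clm_apply (hasDerivAt_const μ z)
  exact h3.deriv.symm

end Restrict

/-! ### Passage between `H²` eigenfunctions and classical solutions. -/

section Sobolev

variable {q : ℝ → ℝ} {a b μ : ℝ} {f f' g g' : ℝ → ℝ}

theorem IsC1.congr (h : IsC1 a b f f') (hg : ∀ x ∈ Set.Icc a b, g x = f x)
    (hg' : ∀ x ∈ Set.Icc a b, g' x = f' x) : IsC1 a b g g' := by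
  obtain ⟨S, hS, hd⟩ := h.deriv
  refine ⟨h.cont.congr hg, h.cont'.congr hg', S, hS, fun x hx => ?_⟩
  rw [hg' x (Set.Ioo_subset_Icc_self hx.1)]
  refine (hd x hx).congr_of_eventuallyEq ?_
  filter_upwards [Icc_mem_nhds hx.1.1 hx.1.2] with y hy using hg y hy

theorem IsSol.congr {Q : ℝ → ℝ} (h : IsSol Q a b f f') (hg : ∀ x ∈ Set.Icc a b, g x = f x)
    (hg' : ∀ x ∈ Set.Icc a b, g' x = f' x) : IsSol Q a b g g' := by
  obtain ⟨S, hS, hd⟩ := h.deriv2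
  refine ⟨h.toIsC1.congr hg hg', S, hS, fun x hx => ?_⟩
  rw [hg x (Set.Ioo_subset_Icc_self hx.1)]
  refine (hd x hx).congr_of_eventuallyEq ?_
  filter_upwards [Icc_mem_nhds hx.1.1 hx.1.2] with y hy using hg' y hy

theorem IsC1.derivWithin_eq (hab : a < b) (h : IsC1 a b f f') {x : ℝ} (hx : x ∈ Set.Icc a b) :
    derivWithin f (Set.Icc a b) x = f' x :=
  (h.hasDerivWithinAt hx).derivWithin (uniqueDiffOn_Icc hab x hx)

/-- Almost everywhere `g = (q - μ) f`, so `f'` is a primitive of a function that is continuous at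
all but finitely many interior points, and is differentiable at those points. -/
theorem HasSobolevSecondDeriv.isSol (hab : a < b) (hq : IsPotential q a b)
    (hf : HasSobolevSecondDeriv a b f g)
    (hg : ∀ᵐ x ∂(volume.restrict (Set.Icc a b)), μ * f x = -g x + q x * f x) :
    IsSol (fun x => q x - μ) a b f (derivWithin f (Set.Icc a b)) := by
  have hgi : IntegrableOn g (Set.Icc a b) := hf.memLp.integrable (by norm_num)
  have hc := hf.differentiableOn.continuousOn
  have hqi := (hq.sub_const μ)
  have heq : ∀ x ∈ Set.Icc a b, derivWithin f (Set.Icc a b) x =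
      derivWithin f (Set.Icc a b) a + ∫ t in a..x, (q t - μ) * f t := by
    intro x hx
    rw [hf.deriv_eq x hx]
    congr 1
    refine intervalIntegral.integral_congr_ae_restrict ?_
    rw [Set.uIoc_of_le hx.1]
    have hsub : Set.Ioc a x ⊆ Set.Icc a b := fun y hy => ⟨hy.1.le, hy.2.trans hx.2⟩
    filter_upwards [ae_restrict_of_ae_restrict_of_subset hsub hg] with t ht
    linarith
  have hInt : IntervalIntegrable (fun t => (q t - μ) * f t) volume a b :=
    hc.intervalIntegrable_mul hab.le hqi.integrableOn
  have hInt' := hInt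
  rw [intervalIntegrable_iff_integrableOn_Icc_of_le hab.le] at hInt'
  have hcont : ContinuousOn (fun x => ∫ t in a..x, (q t - μ) * f t) (Set.Icc a b) := by
    have := intervalIntegral.continuousOn_primitive_interval (μ := volume) (a := a) (b := b)
      (f := fun t => (q t - μ) * f t) (by rwa [Set.uIcc_of_le hab.le])
    rwa [Set.uIcc_of_le hab.le] at this
  refine ⟨⟨hc, (continuousOn_const.add hcont).congr heq, ∅, Set.countable_empty, ?_⟩, ?_⟩
  · intro x hx
    have hx' := Set.Ioo_subset_Icc_self hx.1
    exact (hf.differentiableOn x hx').hasDerivWithinAt.hasDerivAt (Icc_mem_nhds hx.1.1 hx.1.2)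
  · obtain ⟨S, hS⟩ := hqi.continuousAt
    refine ⟨S, S.finite_toSet.countable, fun x hx => ?_⟩
    have hx' := Set.Ioo_subset_Icc_self hx.1
    have hnhds := Icc_mem_nhds hx.1.1 hx.1.2
    have h1 : HasDerivAt (fun x => derivWithin f (Set.Icc a b) a +
        ∫ t in a..x, (q t - μ) * f t) ((q x - μ) * f x) x := by
      refine HasDerivAt.const_add _ ?_
      refine intervalIntegral.integral_hasDerivAt_right
        (hInt.mono_set ?_) ?_ ((hS x hx).mul (hc.continuousAt hnhds))
      · rw [Set.uIcc_of_le hab.le, Set.uIcc_of_le hx'.1]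
        exact Set.Icc_subset_Icc le_rfl hx'.2
      · exact ⟨Set.Icc a b, hnhds, hInt'.aestronglyMeasurable⟩
    refine h1.congr_of_eventuallyEq ?_
    filter_upwards [hnhds] with y hy using heq y hy

theorem IsSol.hasSobolevSecondDeriv (hab : a < b) (hq : IsPotential q a b)
    (h0 : ∀ x ∉ Set.Icc a b, f x = 0) (hf : IsSol (fun x => q x - μ) a b f f') :
    HasSobolevSecondDeriv a b f (fun x => (q x - μ) * f x) := by
  have hqi := hq.sub_const μ
  refine ⟨h0, fun x hx => (hf.toIsC1.hasDerivWithinAt hx).differentiableWithinAt, ?_, ?_⟩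
  · obtain ⟨K, hK⟩ := hqi.bdd
    obtain ⟨C, hC⟩ := isCompact_Icc.exists_bound_of_continuousOn hf.cont
    have hInt := hf.cont.intervalIntegrable_mul hab.le hqi.integrableOn
    rw [intervalIntegrable_iff_integrableOn_Icc_of_le hab.le] at hInt
    refine MemLp.of_bound hInt.aestronglyMeasurable (K * C) ?_
    filter_upwards [ae_restrict_mem measurableSet_Icc] with x hx
    rw [norm_mul]
    exact mul_le_mul (hK x hx) (hC x hx) (norm_nonneg _) ((abs_nonneg _).trans (hK x hx))
  · intro x hx
    rw [hf.toIsC1.derivWithin_eq hab hx, hf.toIsC1.derivWithin_eq hab ⟨le_rfl, hab.le⟩,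
      (hf.mono le_rfl hx.2).integral_eq hx.1 (hqi.mono le_rfl hx.2)]
    ring

end Sobolev

/-! ### Eigenfunctions of a quantum graph as kernel vectors of the nodal form. -/

namespace QuantumGraph

variable {V E : Type*} [DecidableEq V] [Fintype E] (G : QuantumGraph V E)

/-- The vertex values allowed by the Dirichlet conditions. -/
def dirSpace : Submodule ℝ (V → ℝ) where
  carrier := {F | ∀ v ∈ G.dir, F v = 0}
  add_mem' h₁ h₂ v hv := by simp [h₁ v hv, h₂ v hv]
  zero_mem' v _ := rfl
  smul_mem' c F h v hv := by simp [h v hv]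

variable [Fintype V]

/-- `f` is an eigenfunction with vertex values `F`, where the vertex conditions are those of the
form with vertex values in `L`. -/
structure IsEigen (L : Submodule ℝ (V → ℝ)) (μ : ℝ) (f : E → ℝ → ℝ) (F : V → ℝ) : Prop where
  zero : ∀ e, ∀ x ∉ Set.Icc (G.lo e) (G.hi e), f e x = 0
  sol : ∀ e, IsSol (fun x => G.q e x - μ) (G.lo e) (G.hi e) (f e) (G.edgeDeriv f e)
  left : ∀ e, f e (G.lo e) = F (G.src e)
  right : ∀ e, f e (G.hi e) = F (G.tgt e)
  mem : F ∈ L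
  balance : ∀ z ∈ L, ∑ v, (G.flux f v - G.χ v * F v) * z v = 0

/-- The weak balance condition is localised by testing with the indicator of a single vertex outside
`dir`. Its advantage is that other spaces `L` of vertex values, such as `matchSpace`, fit into the
same definition. -/
theorem mem_eigenspace_iff {μ : ℝ} {f : E → ℝ → ℝ} :
    f ∈ G.eigenspace ℝ μ ↔ ∃ F, G.IsEigen G.dirSpace μ f F := by
  constructor
  · rintro ⟨g, h1, ⟨F, h2, h3, h4, h5⟩, h6⟩
    refine ⟨F, fun e => (h1 e).eq_zero, fun e => ?_, h2, h3, h5, fun z hz => ?_⟩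
    · exact (h1 e).isSol (G.lo_lt_hi e) (G.q_piecewise e).isPotential (h6 e)
    · refine Finset.sum_eq_zero fun v _ => ?_
      by_cases hv : v ∈ G.dir
      · rw [hz v hv, mul_zero]
      · have := h4 v hv
        simp only [RCLike.ofReal_real_eq_id, id_eq] at this
        rw [this, sub_self, zero_mul]
  · rintro ⟨F, h⟩
    refine ⟨fun e x => (G.q e x - μ) * f e x, fun e => (h.sol e).hasSobolevSecondDeriv
      (G.lo_lt_hi e) (G.q_piecewise e).isPotential (h.zero e), ⟨F, h.left, h.right, ?_, h.mem⟩,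
      fun e => ?_⟩
    · intro v hv
      have := h.balance (Pi.single v 1) (fun w hw => by
        have : w ≠ v := fun h => hv (h ▸ hw)
        simp [this])
      simp only [Pi.single_apply, mul_ite, mul_one, mul_zero, Finset.sum_ite_eq',
        Finset.mem_univ, if_true] at this
      simp only [RCLike.ofReal_real_eq_id, id_eq]
      linarith
    · refine Eventually.of_forall fun x => ?_
      simp
      ring

/-- The mesh lives on the edges of `G`. -/
structure _root_.Mesh.Fits {K : ℝ} (m : Mesh E K) (G : QuantumGraph V E) : Prop where
  lo : m.lo = G.lo
  hi : m.hi = G.hi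
  q : m.q = G.q

variable {G}

theorem sum_flux_mul (f : E → ℝ → ℝ) (z : V → ℝ) :
    ∑ v, G.flux f v * z v = ∑ e, (G.edgeDeriv f e (G.lo e) * z (G.src e) -
      G.edgeDeriv f e (G.hi e) * z (G.tgt e)) := by
  simp only [flux, Finset.sum_mul]
  rw [Finset.sum_comm]
  refine Finset.sum_congr rfl fun e _ => ?_
  simp only [add_mul, ite_mul, zero_mul, Finset.sum_add_distrib, Finset.sum_ite_eq,
    Finset.mem_univ, if_true]
  ring

variable {K : ℝ} {m : Mesh E K}

variable (G m) in
/-- The nodal vectors that are continuous at the vertices, with vertex values in `L`. -/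
def nodalSpace (L : Submodule ℝ (V → ℝ)) : Submodule ℝ (Mesh.Nodal V m) where
  carrier := {y | y.1 ∈ L ∧ ∀ e, y.2 e 0 = y.1 (G.src e) ∧ y.2 e (Fin.last _) = y.1 (G.tgt e)}
  add_mem' h₁ h₂ := ⟨add_mem h₁.1 h₂.1, fun e => by simp [h₁.2 e, h₂.2 e]⟩
  zero_mem' := ⟨zero_mem _, fun e => by simp⟩
  smul_mem' c y h := ⟨L.smul_mem c h.1, fun e => by simp [h.2 e]⟩

theorem mem_nodalSpace {L : Submodule ℝ (V → ℝ)} {y : Mesh.Nodal V m} :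
    y ∈ G.nodalSpace m L ↔
      y.1 ∈ L ∧ ∀ e, y.2 e 0 = y.1 (G.src e) ∧ y.2 e (Fin.last _) = y.1 (G.tgt e) := Iff.rfl

variable (m) in
/-- The nodal values of a function. -/
def nodalValues (f : E → ℝ → ℝ) (F : V → ℝ) : Mesh.Nodal V m := (F, fun e i => f e (m.t e i))

/-- The contributions of the pieces telescope along each edge, so against continuous test vectors
the form measures only the failure of the vertex conditions. -/
theorem nodalForm_of_isSol (hm : m.Fits G) {μ : ℝ} (hμ : μ ≤ K) {f : E → ℝ → ℝ}
    (hf : ∀ e, IsSol (fun x => G.q e x - μ) (G.lo e) (G.hi e) (f e) (G.edgeDeriv f e))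
    {y z : Mesh.Nodal V m} (hy : ∀ e i, y.2 e i = f e (m.t e i)) (hz : z ∈ G.nodalSpace m ⊤) :
    m.nodalForm G.χ μ y z = -∑ v, (G.flux f v - G.χ v * y.1 v) * z.1 v := by
  have h1 := m.edgeForm_of_isSol hμ (f' := G.edgeDeriv f)
    (fun e => by rw [hm.lo, hm.hi, hm.q]; exact hf e) hy z
  rw [Mesh.nodalForm_apply, h1]
  simp only [sub_mul, Finset.sum_sub_distrib, hm.lo, hm.hi]
  rw [sum_flux_mul]
  simp only [Finset.sum_sub_distrib, (hz.2 _).1, (hz.2 _).2, mul_assoc]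
  ring

theorem IsEigen.nodalForm_eq_zero (hm : m.Fits G) {L : Submodule ℝ (V → ℝ)} {μ : ℝ} (hμ : μ ≤ K)
    {f : E → ℝ → ℝ} {F : V → ℝ} (h : G.IsEigen L μ f F) {z : Mesh.Nodal V m}
    (hz : z ∈ G.nodalSpace m L) : m.nodalForm G.χ μ (nodalValues m f F) z = 0 := by
  rw [nodalForm_of_isSol hm hμ h.sol (fun e i => rfl) ⟨trivial, hz.2⟩]
  rw [neg_eq_zero]
  exact h.balance z.1 hz.1

theorem IsEigen.nodalValues_mem (hm : m.Fits G) {L : Submodule ℝ (V → ℝ)} {μ : ℝ}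
    {f : E → ℝ → ℝ} {F : V → ℝ} (h : G.IsEigen L μ f F) :
    nodalValues m f F ∈ G.nodalSpace m L := by
  refine ⟨h.mem, fun e => ⟨?_, ?_⟩⟩
  · simp only [nodalValues, m.t_zero, hm.lo, h.left]
  · simp only [nodalValues, m.t_last, hm.hi, h.right]

/-- Test vectors living on the interior nodes yield one solution per edge; test vectors with
arbitrary vertex values in `L` yield the balance condition. -/
theorem exists_isEigen [DecidableEq E] (hm : m.Fits G) {L : Submodule ℝ (V → ℝ)} {μ : ℝ}
    (hμ : μ ≤ K) {y : Mesh.Nodal V m} (hy : y ∈ G.nodalSpace m L)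
    (h : ∀ z ∈ G.nodalSpace m L, m.nodalForm G.χ μ y z = 0) :
    ∃ f, G.IsEigen L μ f y.1 ∧ nodalValues m f y.1 = y := by
  classical
  obtain ⟨A, B, hAB⟩ := m.exists_isSol hμ y fun z h1 h2 h3 => by
    have := h z ⟨by rw [h1]; exact zero_mem _, fun e => by simp [h1, h2, h3]⟩
    rw [Mesh.nodalForm_apply, h1] at this
    simpa using this
  let f : E → ℝ → ℝ := fun e x => if x ∈ Set.Icc (G.lo e) (G.hi e) then
    A e * (m.sys e).c μ x + B e * (m.sys e).s μ x else 0
  have hsol₀ : ∀ e, IsSol (fun x => G.q e x - μ) (G.lo e) (G.hi e)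
      (fun x => A e * (m.sys e).c μ x + B e * (m.sys e).s μ x)
      (fun x => A e * (m.sys e).c' μ x + B e * (m.sys e).s' μ x) := by
    intro e
    rw [← hm.lo, ← hm.hi, ← hm.q]
    exact ((m.sys e).isSol_c μ).lin ((m.sys e).isSol_s μ) (A e) (B e)
  have hfI : ∀ e, ∀ x ∈ Set.Icc (G.lo e) (G.hi e),
      f e x = A e * (m.sys e).c μ x + B e * (m.sys e).s μ x := fun e x hx => if_pos hx
  have hsol : ∀ e, IsSol (fun x => G.q e x - μ) (G.lo e) (G.hi e) (f e) (G.edgeDeriv f e) := by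
    intro e
    have h1 : IsSol (fun x => G.q e x - μ) (G.lo e) (G.hi e) (f e)
        (fun x => A e * (m.sys e).c' μ x + B e * (m.sys e).s' μ x) :=
      (hsol₀ e).congr (hfI e) fun _ _ => rfl
    exact h1.congr (fun _ _ => rfl) fun x hx => h1.toIsC1.derivWithin_eq (G.lo_lt_hi e) hx
  have hyf : ∀ e i, y.2 e i = f e (m.t e i) := by
    intro e i
    have := m.mem_Icc e i
    rw [hm.lo, hm.hi] at this
    rw [hfI e _ this, hAB]
  refine ⟨f, ⟨fun e x hx => if_neg hx, hsol, fun e => ?_, fun e => ?_, hy.1, fun z hz => ?_⟩, ?_⟩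
  · rw [← (hy.2 e).1, hyf, m.t_zero, hm.lo]
  · rw [← (hy.2 e).2, hyf, m.t_last, hm.hi]
  -- Any continuous extension of `z` would serve, as only its vertex values enter. The two ends of
  -- an edge are different nodes because `m.N` is positive.
  · let w : Mesh.Nodal V m := (z, fun e i => if i = 0 then z (G.src e) else
      if i = Fin.last _ then z (G.tgt e) else 0)
    have hw : w ∈ G.nodalSpace m L := by
      refine ⟨hz, fun e => ⟨by simp [w], ?_⟩⟩
      have : Fin.last m.N ≠ 0 := fun h0 => by
        have := congrArg Fin.val h0
        have hN := m.N_pos e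
        simp at this
        omega
      simp [w, this]
    have h1 := h w hw
    rw [nodalForm_of_isSol hm hμ hsol hyf ⟨trivial, hw.2⟩] at h1
    simpa using h1
  · refine Prod.ext rfl ?_
    funext e i
    exact (hyf e i).symm

end QuantumGraph

/-! ### The energy form and the reduction of a quantum graph to nodal vectors. -/

namespace QuantumGraph

variable {V E : Type*} [DecidableEq V] [Fintype E] [Fintype V] {G : QuantumGraph V E}
  {L : Submodule ℝ (V → ℝ)}

variable (G) in
/-- The form `∫ (f' h' + (q - μ) f h) + ∑ χ F H`. -/
noncomputable def crossEnergy (μ : ℝ) (f f' : E → ℝ → ℝ) (F : V → ℝ) (h h' : E → ℝ → ℝ)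
    (H : V → ℝ) : ℝ :=
  ∑ e, (∫ x in G.lo e..G.hi e, (f' e x * h' e x + (G.q e x - μ) * (f e x * h e x))) +
    ∑ v, G.χ v * (F v * H v)

variable (G) in
/-- The `L²` inner product. -/
noncomputable def cross (f h : E → ℝ → ℝ) : ℝ :=
  ∑ e, ∫ x in G.lo e..G.hi e, f e x * h e x

theorem crossEnergy_comm (μ : ℝ) (f f' : E → ℝ → ℝ) (F : V → ℝ) (h h' : E → ℝ → ℝ)
    (H : V → ℝ) : G.crossEnergy μ f f' F h h' H = G.crossEnergy μ h h' H f f' F := by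
  simp only [crossEnergy, mul_comm]

theorem cross_comm (f h : E → ℝ → ℝ) : G.cross f h = G.cross h f := by
  simp only [cross, mul_comm]

theorem intervalIntegrable_cross {μ : ℝ} {e : E} {f f' h h' : ℝ → ℝ}
    (hf : IsC1 (G.lo e) (G.hi e) f f') (hh : IsC1 (G.lo e) (G.hi e) h h') :
    IntervalIntegrable (fun x => f' x * h' x + (G.q e x - μ) * (f x * h x)) volume
      (G.lo e) (G.hi e) := by
  have hab := (G.lo_lt_hi e).le
  refine IntervalIntegrable.add (ContinuousOn.intervalIntegrable ?_) ?_
  · rw [Set.uIcc_of_le hab]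
    exact hf.cont'.mul hh.cont'
  · exact (hf.cont.mul hh.cont).intervalIntegrable_mul hab
      ((G.q_piecewise e).isPotential.sub_const μ).integrableOn

/-- The weak form of the eigenvalue equation: Green's identity on the edges, with the boundary terms
absorbed by the balance condition. -/
theorem IsEigen.crossEnergy_eq {ν : ℝ} {f : E → ℝ → ℝ} {F : V → ℝ} (hf : G.IsEigen L ν f F)
    (μ : ℝ) {h h' : E → ℝ → ℝ} {H : V → ℝ}
    (hh : ∀ e, IsC1 (G.lo e) (G.hi e) (h e) (h' e)) (hl : ∀ e, h e (G.lo e) = H (G.src e))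
    (hr : ∀ e, h e (G.hi e) = H (G.tgt e)) (hH : H ∈ L) :
    G.crossEnergy μ f (G.edgeDeriv f) F h h' H = (ν - μ) * G.cross f h := by
  have h1 : ∀ e, ∫ x in G.lo e..G.hi e,
      (G.edgeDeriv f e x * h' e x + (G.q e x - μ) * (f e x * h e x)) =
      (G.edgeDeriv f e (G.hi e) * H (G.tgt e) - G.edgeDeriv f e (G.lo e) * H (G.src e)) +
        (ν - μ) * ∫ x in G.lo e..G.hi e, f e x * h e x := by
    intro e
    have hab := (G.lo_lt_hi e).le
    have hg := (hf.sol e).green hab ((G.q_piecewise e).isPotential.sub_const ν) (hh e)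
    rw [hl, hr] at hg
    rw [← hg, ← intervalIntegral.integral_const_mul, ← intervalIntegral.integral_add
      (intervalIntegrable_cross (hf.sol e).toIsC1 (hh e))]
    · congr 1
      ext x
      ring
    · refine ContinuousOn.intervalIntegrable ?_
      rw [Set.uIcc_of_le hab]
      exact continuousOn_const.mul ((hf.sol e).cont.mul (hh e).cont)
  have h2 := hf.balance H hH
  simp only [sub_mul, Finset.sum_sub_distrib] at h2
  rw [sum_flux_mul] at h2
  rw [crossEnergy, Finset.sum_congr rfl fun e _ => h1 e, Finset.sum_add_distrib, ← Finset.mul_sum,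
    cross]
  simp only [Finset.sum_sub_distrib, mul_assoc] at h2 ⊢
  linarith

theorem cross_self_pos {f : E → ℝ → ℝ} (h0 : ∀ e, ∀ x ∉ Set.Icc (G.lo e) (G.hi e), f e x = 0)
    (hc : ∀ e, ContinuousOn (f e) (Set.Icc (G.lo e) (G.hi e))) (hf : f ≠ 0) :
    0 < G.cross f f := by
  have hnn : ∀ e, 0 ≤ ∫ x in G.lo e..G.hi e, f e x * f e x := fun e =>
    intervalIntegral.integral_nonneg (G.lo_lt_hi e).le fun x _ => mul_self_nonneg _
  obtain ⟨e, he⟩ := Function.ne_iff.mp hf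
  obtain ⟨x, hx⟩ := Function.ne_iff.mp he
  have hxI : x ∈ Set.Icc (G.lo e) (G.hi e) := by
    by_contra h
    exact hx (h0 e x h)
  have : 0 < ∫ x in G.lo e..G.hi e, f e x * f e x :=
    intervalIntegral.integral_pos (G.lo_lt_hi e) ((hc e).mul (hc e))
      (fun x _ => mul_self_nonneg _) ⟨x, hxI, mul_self_pos.mpr hx⟩
  exact this.trans_le (Finset.single_le_sum (f := fun e => ∫ x in G.lo e..G.hi e, f e x * f e x)
    (fun e _ => hnn e) (Finset.mem_univ e))

theorem IsEigen.cross_self_pos {ν : ℝ} {f : E → ℝ → ℝ} {F : V → ℝ} (hf : G.IsEigen L ν f F)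
    (h0 : f ≠ 0) : 0 < G.cross f f :=
  QuantumGraph.cross_self_pos hf.zero (fun e => (hf.sol e).cont) h0

theorem IsC1.sum {ι : Type*} (s : Finset ι) {a b : ℝ} {f f' : ι → ℝ → ℝ}
    (h : ∀ i, IsC1 a b (f i) (f' i)) :
    IsC1 a b (fun x => ∑ i ∈ s, f i x) (fun x => ∑ i ∈ s, f' i x) := by
  choose S hS hd using fun i => (h i).deriv
  refine ⟨continuousOn_finsetSum _ fun i _ => (h i).cont,
    continuousOn_finsetSum _ fun i _ => (h i).cont', ⋃ i ∈ s, S i, ?_, fun x hx => ?_⟩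
  · exact s.countable_toSet.biUnion fun i _ => hS i
  · refine HasDerivAt.fun_sum fun i hi => hd i x ⟨hx.1, fun h' => hx.2 ?_⟩
    exact Set.mem_biUnion hi h'

theorem crossEnergy_sum {ι : Type*} (s : Finset ι) {f f' : ι → E → ℝ → ℝ} (F : ι → V → ℝ)
    (h : ∀ i e, IsC1 (G.lo e) (G.hi e) (f i e) (f' i e)) (μ : ℝ) :
    G.crossEnergy μ (fun e x => ∑ i ∈ s, f i e x) (fun e x => ∑ i ∈ s, f' i e x)
      (fun v => ∑ i ∈ s, F i v) (fun e x => ∑ i ∈ s, f i e x) (fun e x => ∑ i ∈ s, f' i e x)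
      (fun v => ∑ i ∈ s, F i v) =
    ∑ i ∈ s, ∑ j ∈ s, G.crossEnergy μ (f i) (f' i) (F i) (f j) (f' j) (F j) := by
  simp only [crossEnergy, Finset.sum_add_distrib]
  congr 1
  · rw [Finset.sum_congr rfl fun i _ => Finset.sum_comm, Finset.sum_comm]
    refine Finset.sum_congr rfl fun e _ => ?_
    rw [Finset.sum_congr rfl fun i _ =>
      (intervalIntegral.integral_finsetSum
        (fun j _ => intervalIntegrable_cross (h i e) (h j e))).symm]
    rw [← intervalIntegral.integral_finsetSum]
    · congr 1
      ext x
      rw [Finset.sum_mul_sum, Finset.sum_mul_sum]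
      simp only [Finset.mul_sum, Finset.sum_add_distrib]
    · intro i _
      have := IntervalIntegrable.sum s fun j _ => intervalIntegrable_cross (μ := μ) (h i e) (h j e)
      refine this.congr fun x _ => ?_
      simp
  · rw [Finset.sum_congr rfl fun i _ => Finset.sum_comm, Finset.sum_comm]
    refine Finset.sum_congr rfl fun v _ => ?_
    rw [Finset.sum_mul_sum]
    simp only [Finset.mul_sum]

/-- Linear combinations of eigenfunctions with eigenvalues below `μ` have negative energy. -/
theorem crossEnergy_sum_neg {s : Finset ℝ} {f : ℝ → E → ℝ → ℝ} {F : ℝ → V → ℝ}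
    (hf : ∀ ν, G.IsEigen L ν (f ν) (F ν)) {μ : ℝ} (hs : ∀ ν ∈ s, ν < μ)
    (h0 : ∃ ν ∈ s, f ν ≠ 0) :
    G.crossEnergy μ (fun e x => ∑ i ∈ s, f i e x) (fun e x => ∑ i ∈ s, G.edgeDeriv (f i) e x)
      (fun v => ∑ i ∈ s, F i v) (fun e x => ∑ i ∈ s, f i e x)
      (fun e x => ∑ i ∈ s, G.edgeDeriv (f i) e x) (fun v => ∑ i ∈ s, F i v) < 0 := by
  rw [crossEnergy_sum s F fun i e => ((hf i).sol e).toIsC1]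
  have h1 : ∀ i j, G.crossEnergy μ (f i) (G.edgeDeriv (f i)) (F i) (f j) (G.edgeDeriv (f j)) (F j) =
      (i - μ) * G.cross (f i) (f j) := fun i j =>
    (hf i).crossEnergy_eq μ (fun e => ((hf j).sol e).toIsC1) (hf j).left (hf j).right (hf j).mem
  -- Eigenfunctions for different eigenvalues are orthogonal: compute their symmetric cross energy
  -- in both orders.
  have h2 : ∀ i j, i ≠ j → G.cross (f i) (f j) = 0 := by
    intro i j hij
    have h3 := h1 i j
    rw [crossEnergy_comm, h1 j i, cross_comm] at h3
    have : (i - j) * G.cross (f i) (f j) = 0 := by linarith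
    exact (mul_eq_zero.mp this).resolve_left (sub_ne_zero.mpr hij)
  have h3 : ∀ i ∈ s, ∑ j ∈ s, G.crossEnergy μ (f i) (G.edgeDeriv (f i)) (F i) (f j)
      (G.edgeDeriv (f j)) (F j) = (i - μ) * G.cross (f i) (f i) := by
    intro i hi
    rw [Finset.sum_eq_single_of_mem i hi, h1]
    intro j _ hj
    rw [h1, h2 i j hj.symm, mul_zero]
  rw [Finset.sum_congr rfl h3]
  have hnn : ∀ i, 0 ≤ G.cross (f i) (f i) := fun i => Finset.sum_nonneg fun e _ =>
    intervalIntegral.integral_nonneg (G.lo_lt_hi e).le fun x _ => mul_self_nonneg _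
  obtain ⟨ν, hν, hν0⟩ := h0
  refine Finset.sum_neg' (fun i hi => ?_) ⟨ν, hν, ?_⟩
  · exact mul_nonpos_of_nonpos_of_nonneg (by linarith [hs i hi]) (hnn i)
  · exact mul_neg_of_neg_of_pos (by linarith [hs ν hν]) ((hf ν).cross_self_pos hν0)

variable {K : ℝ} {m : Mesh E K}

/-- On each piece the Dirichlet-to-Neumann form is the least energy with the given end values. -/
theorem nodalForm_le_crossEnergy (hm : m.Fits G) {μ : ℝ} (hμ : μ ≤ K) {h h' : E → ℝ → ℝ}
    {H : V → ℝ} (hh : ∀ e, IsC1 (G.lo e) (G.hi e) (h e) (h' e)) :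
    m.nodalForm G.χ μ (nodalValues m h H) (nodalValues m h H) ≤ G.crossEnergy μ h h' H h h' H := by
  have h1 := m.edgeForm_le_energy (V := V) hμ (h := h) (h' := h')
    (by rw [hm.lo, hm.hi]; exact hh) (y := nodalValues m h H) fun e i => rfl
  rw [Mesh.nodalForm_apply, crossEnergy]
  refine add_le_add (h1.trans (le_of_eq ?_)) le_rfl
  rw [hm.lo, hm.hi, hm.q]
  simp only [energy, sq]

/-- On an eigenfunction the nodal form decreases in the spectral parameter. -/
theorem IsEigen.deriv_nodalForm_neg (hm : m.Fits G) {ξ : ℝ} (hξ : ξ < K) {f : E → ℝ → ℝ}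
    {F : V → ℝ} (hf : G.IsEigen L ξ f F) (h0 : f ≠ 0) :
    deriv (fun ν => m.nodalForm G.χ ν (nodalValues m f F) (nodalValues m f F)) ξ < 0 := by
  set w := nodalValues m f F
  set g : ℝ → ℝ := fun ν => m.nodalForm G.χ ν w w with hg
  set M := G.cross f f
  have hM : 0 < M := hf.cross_self_pos h0
  have hd : DifferentiableAt ℝ g ξ := by
    have h1 := (m.contDiffAt_nodalForm G.χ hξ).differentiableAt (by norm_num)
    exact (h1.clm_apply (differentiableAt_const w)).clm_apply (differentiableAt_const w)
  -- The energy of the fixed function `f` at level `ν` is `(ξ - ν) M`, and it dominates `g ν`, with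
  -- equality at `ξ`. So `g ν + (ν - ξ) M` has a local maximum at `ξ`, and the derivative of `g`
  -- there is `-M`.
  have hle : ∀ ν ≤ K, g ν + (ν - ξ) * M ≤ 0 := by
    intro ν hν
    have h1 := nodalForm_le_crossEnergy hm hν (H := F) fun e => (hf.sol e).toIsC1
    rw [hf.crossEnergy_eq ν (fun e => (hf.sol e).toIsC1) hf.left hf.right hf.mem] at h1
    have : g ν ≤ (ξ - ν) * M := h1
    linarith
  have heq : g ξ = 0 := hf.nodalForm_eq_zero hm hξ.le (hf.nodalValues_mem hm)
  have hmax : IsLocalMax (fun ν => g ν + (ν - ξ) * M) ξ := by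
    filter_upwards [Iio_mem_nhds hξ] with ν hν
    have := hle ν (le_of_lt hν)
    simpa [heq] using this
  have h2 : HasDerivAt (fun ν => g ν + (ν - ξ) * M) (deriv g ξ + 1 * M) ξ :=
    hd.hasDerivAt.add (((hasDerivAt_id ξ).sub_const ξ).mul_const M)
  have h3 := hmax.hasDerivAt_eq_zero h2
  linarith

/-- The space of continuous nodal vectors with vertex values in `L`. -/
def NodalSpace (G : QuantumGraph V E) (m : Mesh E K) (L : Submodule ℝ (V → ℝ)) : Type _ :=
  ↥(G.nodalSpace m L)

noncomputable instance : NormedAddCommGroup (G.NodalSpace m L) :=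
  inferInstanceAs (NormedAddCommGroup ↥(G.nodalSpace m L))

noncomputable instance : NormedSpace ℝ (G.NodalSpace m L) :=
  inferInstanceAs (NormedSpace ℝ ↥(G.nodalSpace m L))

instance : FiniteDimensional ℝ (G.NodalSpace m L) :=
  inferInstanceAs (FiniteDimensional ℝ ↥(G.nodalSpace m L))

variable (G m L) in
/-- The inclusion into the space of all nodal vectors. -/
noncomputable def nodalIncl : G.NodalSpace m L →L[ℝ] Mesh.Nodal V m := (G.nodalSpace m L).subtypeL

theorem nodalIncl_injective : Function.Injective (G.nodalIncl L m) := Subtype.val_injective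

theorem nodalIncl_mem (y : G.NodalSpace m L) : G.nodalIncl L m y ∈ G.nodalSpace m L := y.2

/-- A continuous nodal vector as an element of the space of such vectors. -/
def toNodal {y : Mesh.Nodal V m} (hy : y ∈ G.nodalSpace m L) : G.NodalSpace m L := ⟨y, hy⟩

@[simp] theorem nodalIncl_toNodal {y : Mesh.Nodal V m} (hy : y ∈ G.nodalSpace m L) :
    G.nodalIncl L m (toNodal hy) = y := rfl

/-- The nodal form on the continuous nodal vectors with vertex values in `L`. -/
noncomputable def reducedForm (G : QuantumGraph V E) (m : Mesh E K) (L : Submodule ℝ (V → ℝ))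
    (μ : ℝ) : G.NodalSpace m L →L[ℝ] G.NodalSpace m L →L[ℝ] ℝ :=
  (m.nodalForm G.χ μ).bilinearComp (G.nodalIncl L m) (G.nodalIncl L m)

@[simp] theorem reducedForm_apply (μ : ℝ) (x y : G.NodalSpace m L) :
    G.reducedForm m L μ x y = m.nodalForm G.χ μ (G.nodalIncl L m x) (G.nodalIncl L m y) := rfl

theorem contDiffAt_reducedForm {μ : ℝ} (hμ : μ < K) : ContDiffAt ℝ 3 (G.reducedForm m L) μ :=
  contDiffAt_bilinearComp (m.contDiffAt_nodalForm G.χ hμ) _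

/-- For very negative `μ` the edge part dominates any prescribed multiple of the squared nodal
values. The multiple `∑ |χ v| + 1` beats the vertex part, since by `hcov` every vertex value is also
a nodal value. -/
theorem exists_pos_reducedForm (hcov : ∀ v, ∃ e, G.src e = v ∨ G.tgt e = v) :
    ∃ M, ∀ μ ≤ M, ∀ y : G.NodalSpace m L, y ≠ 0 → 0 < G.reducedForm m L μ y y := by
  have hC : 0 ≤ ∑ v, |G.χ v| := Finset.sum_nonneg fun v _ => abs_nonneg _
  obtain ⟨M, hM⟩ := m.exists_forall_le_edgeForm (V := V) (L := ∑ v, |G.χ v| + 1) (by linarith)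
  refine ⟨M, fun μ hμ Y hY0 => ?_⟩
  rw [reducedForm_apply, Mesh.nodalForm_apply]
  set y := G.nodalIncl L m Y
  have hy : y ∈ G.nodalSpace m L := nodalIncl_mem Y
  have hy0 : y ≠ 0 := fun h => hY0 (nodalIncl_injective (by rw [map_zero]; exact h))
  have h1 := hM μ hμ y
  set S := ∑ e, ∑ i : Fin m.N, (y.2 e i.castSucc ^ 2 + y.2 e i.succ ^ 2) with hS
  have hpair : ∀ e (i : Fin m.N), y.2 e i.castSucc ^ 2 + y.2 e i.succ ^ 2 ≤ S := by
    intro e i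
    refine le_trans ?_ (Finset.single_le_sum (f := fun e => ∑ i : Fin m.N,
      (y.2 e i.castSucc ^ 2 + y.2 e i.succ ^ 2))
      (fun e _ => Finset.sum_nonneg fun i _ => by positivity) (Finset.mem_univ e))
    exact Finset.single_le_sum (f := fun i : Fin m.N =>
      (y.2 e i.castSucc ^ 2 + y.2 e i.succ ^ 2)) (fun i _ => by positivity) (Finset.mem_univ i)
  have hnode : ∀ e i, y.2 e i ^ 2 ≤ S := by
    intro e i
    have hN := m.N_pos e
    induction i using Fin.lastCases with
    | last =>
      have hl : Fin.last m.N = (⟨m.N - 1, by omega⟩ : Fin m.N).succ := Fin.ext (by simp; omega)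
      rw [hl]
      nlinarith [hpair e ⟨m.N - 1, by omega⟩,
        sq_nonneg (y.2 e (⟨m.N - 1, by omega⟩ : Fin m.N).castSucc)]
    | cast i => nlinarith [hpair e i, sq_nonneg (y.2 e i.succ)]
  have hvert : ∀ v, y.1 v ^ 2 ≤ S := by
    intro v
    obtain ⟨e, rfl | rfl⟩ := hcov v
    · rw [← (hy.2 e).1]; exact hnode _ _
    · rw [← (hy.2 e).2]; exact hnode _ _
  have hSpos : 0 < S := by
    by_contra hS0
    refine hy0 (Prod.ext (funext fun v => ?_) (funext fun e => funext fun i => ?_))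
    · have := hvert v
      exact pow_eq_zero_iff two_ne_zero |>.mp (le_antisymm (by linarith) (sq_nonneg (y.1 v)))
    · have := hnode e i
      exact pow_eq_zero_iff two_ne_zero |>.mp (le_antisymm (by linarith) (sq_nonneg (y.2 e i)))
  have h2 : -((∑ v, |G.χ v|) * S) ≤ ∑ v, G.χ v * (y.1 v * y.1 v) := by
    rw [Finset.sum_mul, ← Finset.sum_neg_distrib]
    refine Finset.sum_le_sum fun v _ => ?_
    have h3 := mul_le_mul_of_nonneg_left (hvert v) (abs_nonneg (G.χ v))
    have h4 := mul_le_mul_of_nonneg_right (neg_abs_le (G.χ v)) (sq_nonneg (y.1 v))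
    nlinarith
  nlinarith

/-- The eigenfunctions of a quantum graph reduce to the kernels of the nodal forms. -/
theorem exists_isReduction [DecidableEq E] (hm : m.Fits G)
    (hcov : ∀ v, ∃ e, G.src e = v ∨ G.tgt e = v) {𝓔 : ℝ → Submodule ℝ (E → ℝ → ℝ)}
    (h𝓔 : ∀ μ f, f ∈ 𝓔 μ ↔ ∃ F, G.IsEigen L μ f F) :
    ∃ τ : (E → ℝ → ℝ) →ₗ[ℝ] G.NodalSpace m L, IsReduction K 𝓔 τ (G.reducedForm m L) ∧
      ∀ μ f F, G.IsEigen L μ f F → G.nodalIncl L m (τ f) = nodalValues m f F := by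
  -- Each vertex value is read off at a fixed edge end, so that the trace is a linear map defined on
  -- all functions.
  obtain ⟨pt, hpt⟩ : ∃ pt : V → E × ℝ, ∀ (f : E → ℝ → ℝ) (F : V → ℝ),
      (∀ e, f e (G.lo e) = F (G.src e)) → (∀ e, f e (G.hi e) = F (G.tgt e)) →
      ∀ v, f (pt v).1 (pt v).2 = F v := by
    have : ∀ v, ∃ p : E × ℝ, ∀ (f : E → ℝ → ℝ) (F : V → ℝ),
      (∀ e, f e (G.lo e) = F (G.src e)) → (∀ e, f e (G.hi e) = F (G.tgt e)) → f p.1 p.2 = F v := by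
      intro v
      obtain ⟨e, rfl | rfl⟩ := hcov v
      · exact ⟨(e, G.lo e), fun f F h1 _ => h1 e⟩
      · exact ⟨(e, G.hi e), fun f F _ h2 => h2 e⟩
    choose pt hpt using this
    exact ⟨pt, fun f F h1 h2 v => hpt v f F h1 h2⟩
  let tr : (E → ℝ → ℝ) →ₗ[ℝ] Mesh.Nodal V m :=
    { toFun := fun f => (fun v => f (pt v).1 (pt v).2, fun e i => f e (m.t e i))
      map_add' := fun f g => rfl
      map_smul' := fun c f => rfl }
  -- The left inverse only extends the trace to functions that are discontinuous at the vertices; on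
  -- eigenfunctions it changes nothing.
  obtain ⟨π, hπ⟩ := LinearMap.exists_leftInverse_of_injective (G.nodalIncl L m).toLinearMap
    (LinearMap.ker_eq_bot.mpr nodalIncl_injective)
  have hπ' : ∀ y (hy : y ∈ G.nodalSpace m L), π y = toNodal hy := fun y hy =>
    LinearMap.congr_fun hπ (toNodal hy)
  have htr : ∀ μ f F, G.IsEigen L μ f F → tr f = nodalValues m f F := by
    intro μ f F h
    refine Prod.ext ?_ rfl
    funext v
    exact hpt f F h.left h.right v
  have hτ : ∀ μ f F, G.IsEigen L μ f F →
      G.nodalIncl L m ((π.comp tr) f) = nodalValues m f F := by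
    intro μ f F h
    rw [LinearMap.comp_apply, htr μ f F h, hπ' _ (h.nodalValues_mem hm), nodalIncl_toNodal]
  refine ⟨π.comp tr, ⟨?_, ?_, ?_, ?_, ?_, exists_pos_reducedForm hcov⟩, hτ⟩
  · exact fun μ x y => m.nodalForm_symm G.χ μ _ _
  · exact fun μ hμ => (contDiffAt_reducedForm hμ).continuousAt
  · intro μ hμ f hf
    obtain ⟨F, hF⟩ := (h𝓔 μ f).mp hf
    ext z
    rw [reducedForm_apply, hτ μ f F hF]
    exact hF.nodalForm_eq_zero hm hμ.le (nodalIncl_mem z)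
  · intro μ hμ y hy
    obtain ⟨f, hf, hfy⟩ := exists_isEigen hm hμ.le (nodalIncl_mem y) fun z hz =>
      DFunLike.congr_fun hy (toNodal hz)
    refine ⟨f, (h𝓔 μ f).mpr ⟨_, hf⟩, nodalIncl_injective ?_⟩
    rw [hτ μ f _ hf, hfy]
  · intro μ hμ f hf hf0
    obtain ⟨g, hg, rfl⟩ := (Submodule.mem_iSup_iff_exists_finsupp _ _).mp hf
    have hg' : ∀ ν, g ν ∈ 𝓔 ν := by
      intro ν
      by_cases hν : ν < μ
      · have := hg ν
        rwa [iSup_pos (show ν ∈ Set.Iio μ from hν)] at this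
      · have := hg ν
        rw [iSup_neg (show ν ∉ Set.Iio μ from hν), Submodule.mem_bot] at this
        rw [this]; exact zero_mem _
    have hs : ∀ ν ∈ g.support, ν < μ := by
      intro ν hν
      by_contra hlt
      have := hg ν
      rw [iSup_neg (show ν ∉ Set.Iio μ from hlt), Submodule.mem_bot] at this
      exact (Finsupp.mem_support_iff.mp hν) this
    choose F hF using fun ν => (h𝓔 ν (g ν)).mp (hg' ν)
    have hval : G.nodalIncl L m ((π.comp tr) (g.sum fun _ x => x)) =
        nodalValues m (fun e x => ∑ i ∈ g.support, g i e x) (fun v => ∑ i ∈ g.support, F i v) := by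
      rw [Finsupp.sum, map_sum, map_sum,
        Finset.sum_congr rfl fun ν _ => hτ ν (g ν) (F ν) (hF ν)]
      refine Prod.ext (funext fun v => ?_) (funext fun e => funext fun i => ?_)
      · simp [nodalValues, Prod.fst_sum]
      · simp [nodalValues, Prod.snd_sum]
    rw [reducedForm_apply, hval]
    refine (nodalForm_le_crossEnergy hm hμ.le fun e =>
      IsC1.sum g.support fun i => ((hF i).sol e).toIsC1).trans_lt ?_
    refine crossEnergy_sum_neg hF hs ?_
    by_contra hcon
    push Not at hcon
    exact hf0 (Finset.sum_eq_zero hcon)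

end QuantumGraph

/-! ### Existence of fine meshes with nodes in general position. -/

section Mesh

variable {V E : Type*} [DecidableEq V] [Fintype E] [Fintype V]

/-- Every quantum graph has arbitrarily fine meshes, whose interior nodes can be chosen outside
given sets with dense complements. -/
theorem QuantumGraph.exists_mesh (G : QuantumGraph V E) (K : ℝ) {A : E → Set ℝ}
    (hA : ∀ e, Dense (A e)ᶜ) : ∃ m : Mesh E K, m.Fits G ∧ 1 < m.N ∧
      ∀ e i, i ≠ 0 → i ≠ Fin.last m.N → m.t e i ∉ A e := by
  have hpot : ∀ e, IsPotential (G.q e) (G.lo e) (G.hi e) := fun e =>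
    (G.q_piecewise e).isPotential
  choose B hB using fun e => (hpot e).bdd
  have hk : ∀ e, ∀ z ∈ Set.Icc (G.lo e) (G.hi e), -(|B e| + |K|) ≤ G.q e z - K := by
    intro e z hz
    have h1 := neg_le_of_abs_le (hB e z hz)
    have h2 := le_abs_self (B e)
    have h3 := le_abs_self K
    linarith
  have hev : ∀ e, ∀ᶠ N : ℕ in atTop,
      (|B e| + |K|) * (3 / 2 * ((G.hi e - G.lo e) / N)) ^ 2 < 1 := by
    intro e
    have h1 : Tendsto (fun N : ℕ => (G.hi e - G.lo e) / (N : ℝ)) atTop (𝓝 0) :=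
      tendsto_const_div_atTop_nhds_zero_nat _
    have h2 := ((h1.const_mul (3 / 2)).pow 2).const_mul (|B e| + |K|)
    simp only [mul_zero, ne_eq, OfNat.ofNat_ne_zero, not_false_eq_true, zero_pow] at h2
    exact h2.eventually (gt_mem_nhds one_pos)
  obtain ⟨N, hN, hN1⟩ := ((eventually_all.mpr hev).and (eventually_gt_atTop 1)).exists
  have hNpos : 0 < N := by omega
  have hNR : (0 : ℝ) < N := by exact_mod_cast hNpos
  have hh : ∀ e, 0 < (G.hi e - G.lo e) / N := fun e => div_pos (sub_pos.mpr (G.lo_lt_hi e)) hNR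
  -- Equidistant nodes are moved by less than a quarter of the step, the end points excepted.
  -- Neighbours keep their order and stay within `3 / 2` of a step, the factor allowed for in `hev`.
  have hex : ∀ e (i : Fin (N + 1)), ∃ x,
      |x - (G.lo e + i * ((G.hi e - G.lo e) / N))| < (G.hi e - G.lo e) / N / 4 ∧
      (i = 0 → x = G.lo e) ∧ (i = Fin.last N → x = G.hi e) ∧
      (i ≠ 0 → i ≠ Fin.last N → x ∉ A e) := by
    intro e i
    have h4 := hh e
    by_cases h0 : i = 0
    · refine ⟨G.lo e, ?_, fun _ => rfl, fun h => ?_, fun h => absurd h0 h⟩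
      · simp [h0]; positivity
      · rw [h0] at h
        have := congrArg Fin.val h
        simp at this
        omega
    by_cases hl : i = Fin.last N
    · refine ⟨G.hi e, ?_, fun h => absurd h h0, fun _ => rfl, fun _ h => absurd hl h⟩
      have : G.hi e - (G.lo e + (i : ℕ) * ((G.hi e - G.lo e) / N)) = 0 := by
        rw [hl, Fin.val_last]
        field_simp
        ring
      rw [this]
      simp; positivity
    · obtain ⟨x, hx, hxA⟩ := Metric.dense_iff.mp (hA e)
        (G.lo e + i * ((G.hi e - G.lo e) / N)) ((G.hi e - G.lo e) / N / 4) (by positivity)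
      exact ⟨x, by rwa [Metric.mem_ball, Real.dist_eq] at hx, fun h => absurd h h0,
        fun h => absurd h hl, fun _ _ => hxA⟩
  choose t ht t0 tl tA using hex
  have hgap : ∀ e (i : Fin N), 0 < t e i.succ - t e i.castSucc ∧
      t e i.succ - t e i.castSucc ≤ 3 / 2 * ((G.hi e - G.lo e) / N) := by
    intro e i
    have h1 := abs_lt.mp (ht e i.succ)
    have h2 := abs_lt.mp (ht e i.castSucc)
    have h4 := hh e
    simp only [Fin.val_succ, Fin.val_castSucc, Nat.cast_add, Nat.cast_one] at h1 h2
    constructor <;> nlinarith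
  have hmono : ∀ e, Monotone (t e) := fun e => (Fin.strictMono_iff_lt_succ.mpr fun i => by
    linarith [(hgap e i).1]).monotone
  refine ⟨{ lo := G.lo, hi := G.hi, q := G.q, lo_lt_hi := G.lo_lt_hi, pot := hpot
            sys := fun e => (nonempty_fundSys (G.lo_lt_hi e) (hpot e)).some
            N := N, t := t
            t_zero := fun e => t0 e 0 rfl
            t_last := fun e => tl e _ rfl
            t_lt := fun e i => by linarith [(hgap e i).1]
            short := fun e i => ?_ }, ⟨rfl, rfl, rfl⟩, hN1, tA⟩
  refine ⟨|B e| + |K|, by positivity, ?_, fun z hz => hk e z ?_⟩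
  · refine lt_of_le_of_lt ?_ (hN e)
    have := hgap e i
    gcongr
    exact this.1.le
    exact this.2
  · rw [← t0 e 0 rfl, ← tl e _ rfl]
    exact ⟨(hmono e (Fin.zero_le _)).trans hz.1, hz.2.trans (hmono e (Fin.le_last _))⟩

end Mesh

/-! ### Eigenvalue counts and the existence of an eigenvalue of given number. -/

section Counting

variable {Y : Type*} [NormedAddCommGroup Y] [NormedSpace ℝ Y] [FiniteDimensional ℝ Y]
  {X : Type*} [AddCommGroup X] [Module ℝ X]

theorem toENat_rank_eq_finrank {M : Type*} [AddCommGroup M] [Module ℝ M] [Module.Finite ℝ M] :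
    Cardinal.toENat (Module.rank ℝ M) = Module.finrank ℝ M := by
  rw [← Module.finrank_eq_rank, map_natCast]

theorem iSup_Iic_eq {R M : Type*} [Ring R] [AddCommGroup M] [Module R M] (𝓔 : ℝ → Submodule R M)
    (μ : ℝ) : ⨆ ν ∈ Set.Iic μ, 𝓔 ν = (⨆ ν ∈ Set.Iio μ, 𝓔 ν) ⊔ 𝓔 μ := by
  rw [← Set.Iio_insert, iSup_insert, sup_comm]

namespace IsReduction

variable {K : ℝ} {𝓔 : ℝ → Submodule ℝ X} {τ : X →ₗ[ℝ] Y} {R : ℝ → Y →L[ℝ] Y →L[ℝ] ℝ}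

theorem count_Iio (h : IsReduction K 𝓔 τ R) {μ : ℝ} (hμ : μ < K) :
    Cardinal.toENat (Module.rank ℝ ↥(⨆ ν ∈ Set.Iio μ, 𝓔 ν)) = negIndex (R μ) := by
  have := h.finite_iSup_Iio hμ
  rw [toENat_rank_eq_finrank, h.finrank_iSup_Iio hμ]

theorem count_Iic (h : IsReduction K 𝓔 τ R) {μ : ℝ} (hμ : μ < K) :
    Cardinal.toENat (Module.rank ℝ ↥(⨆ ν ∈ Set.Iic μ, 𝓔 ν)) =
      (negIndex (R μ) + Module.finrank ℝ (LinearMap.ker (R μ).toLinearMap) : ℕ) := by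
  have := h.finite_iSup_Iio hμ
  have := h.finite hμ
  rw [iSup_Iic_eq, toENat_rank_eq_finrank, h.finrank_ker hμ, ← h.finrank_iSup_Iio hμ,
    ← Submodule.finrank_sup_add_finrank_inf_eq, (h.disjoint hμ).eq_bot, finrank_bot, add_zero]

/-- If there are `k` eigenvalues below `μ`, the `k`-th one exists. -/
theorem exists_isNth (h : IsReduction K 𝓔 τ R) {k : ℕ} (hk : 0 < k) {μ : ℝ} (hμ : μ < K)
    (hμk : k ≤ negIndex (R μ)) : ∃ ν < K, negIndex (R ν) < k ∧
      k ≤ negIndex (R ν) + Module.finrank ℝ (LinearMap.ker (R ν).toLinearMap) := by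
  have hmono : ∀ a b, a ≤ b → b < K → negIndex (R a) ≤ negIndex (R b) := by
    intro a b hab hb
    obtain rfl | hlt := hab.eq_or_lt
    · rfl
    · have := h.finrank_add_le hlt hb
      rw [h.finrank_iSup_Iio hb, h.finrank_iSup_Iio (hlt.trans hb)] at this
      omega
  obtain ⟨M, hM⟩ := h.pos
  have hMneg : ∀ ν ≤ M, negIndex (R ν) = 0 := by
    intro ν hν
    obtain ⟨U, hU, hneg⟩ := exists_finrank_eq_negIndex (R ν)
    rw [← hU, Submodule.finrank_eq_zero, Submodule.eq_bot_iff]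
    intro x hx
    by_contra hx0
    exact (hM ν hν x hx0).not_gt (hneg x hx hx0)
  -- The eigenvalue sought is the infimum of `s`. An index of at least `k` at the infimum would
  -- persist slightly to its left, by lower semicontinuity. An index plus nullity below `k` would
  -- keep the index below `k` slightly to its right.
  set s : Set ℝ := {ν | ν ≤ μ ∧ k ≤ negIndex (R ν)}
  have hsne : s.Nonempty := ⟨μ, le_rfl, hμk⟩
  have hsbdd : BddBelow s := by
    refine ⟨M, fun ν hν => ?_⟩
    by_contra hlt
    have := hMneg ν (not_le.mp hlt).le
    have := hν.2
    omega
  have hle : sInf s ≤ μ := csInf_le hsbdd ⟨le_rfl, hμk⟩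
  have hK := hle.trans_lt hμ
  refine ⟨sInf s, hK, ?_, ?_⟩
  · by_contra hcon
    have h1 := eventually_negIndex_le (h.continuousAt _ hK)
    obtain ⟨ν, hν1, hν2⟩ := ((h1.filter_mono (nhdsWithin_le_nhds (s := Set.Iio (sInf s)))).and
      self_mem_nhdsWithin).exists
    exact (csInf_le hsbdd ⟨(le_of_lt hν2).trans hle, (not_lt.mp hcon).trans hν1⟩).not_gt hν2
  · by_contra hcon
    have h1 := eventually_negIndex_le_add h.symm (h.continuousAt _ hK)
    obtain ⟨ε, hε, hball⟩ := Metric.eventually_nhds_iff.mp h1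
    obtain ⟨ν, hν, hνε⟩ := exists_lt_of_csInf_lt hsne (lt_add_of_pos_right (sInf s) hε)
    have h2 := csInf_le hsbdd hν
    have h3 := hball (y := ν) (by rw [Real.dist_eq, abs_of_nonneg (by linarith)]; linarith)
    have := hν.2
    omega

end IsReduction

end Counting

/-! ### Every eigenvalue number is attained. -/

namespace QuantumGraph

section Nth

variable {V E : Type*} [DecidableEq V] [Fintype E] {G : QuantumGraph V E}
  {𝕜 : Type*} [RCLike 𝕜]

theorem eigenvalueCount_mono {s t : Set ℝ} (h : s ⊆ t) :
    G.eigenvalueCount 𝕜 s ≤ G.eigenvalueCount 𝕜 t :=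
  Cardinal.toENat.monotone' (Submodule.rank_mono (biSup_mono h))

theorem IsNthEigenvalue.unique {k : ℕ} {μ ν : ℝ} (h₁ : G.IsNthEigenvalue 𝕜 k μ)
    (h₂ : G.IsNthEigenvalue 𝕜 k ν) : μ = ν := by
  by_contra hne
  wlog hlt : μ < ν generalizing μ ν
  · exact this h₂ h₁ (Ne.symm hne) (lt_of_le_of_ne (not_lt.mp hlt) (Ne.symm hne))
  have h3 : G.eigenvalueCount 𝕜 (Set.Iic μ) ≤ G.eigenvalueCount 𝕜 (Set.Iio ν) :=
    eigenvalueCount_mono (Set.Iic_subset_Iio.mpr hlt)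
  exact (h₁.2.trans h3).not_gt h₂.1

end Nth

variable {V E : Type*} [DecidableEq V] [Fintype E] [Fintype V] {G : QuantumGraph V E}
  {L : Submodule ℝ (V → ℝ)} {K : ℝ} {m : Mesh E K}

theorem isNthEigenvalue_iff {Y : Type*} [NormedAddCommGroup Y] [NormedSpace ℝ Y]
    [FiniteDimensional ℝ Y] {τ : (E → ℝ → ℝ) →ₗ[ℝ] Y} {R : ℝ → Y →L[ℝ] Y →L[ℝ] ℝ}
    (h : IsReduction K (G.eigenspace ℝ) τ R) {μ : ℝ} (hμ : μ < K) (k : ℕ) :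
    G.IsNthEigenvalue ℝ k μ ↔ negIndex (R μ) < k ∧
      k ≤ negIndex (R μ) + Module.finrank ℝ (LinearMap.ker (R μ).toLinearMap) := by
  rw [IsNthEigenvalue, eigenvalueCount, eigenvalueCount, h.count_Iio hμ, h.count_Iic hμ,
    Nat.cast_lt, Nat.cast_le]

/-- The quantum graph with the potential replaced by a constant. -/
def constPotential (G : QuantumGraph V E) (C : ℝ) : QuantumGraph V E :=
  { G with
    q := fun _ _ => C
    q_piecewise := fun _ => ⟨⟨∅, continuousOn_const⟩, fun _ _ => ⟨C, tendsto_const_nhds⟩,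
      fun _ _ => ⟨C, tendsto_const_nhds⟩⟩ }

theorem crossEnergy_le_constPotential {C μ : ℝ}
    (hC : ∀ e, ∀ x ∈ Set.Icc (G.lo e) (G.hi e), G.q e x ≤ C) {h h' : E → ℝ → ℝ} (H : V → ℝ)
    (hh : ∀ e, IsC1 (G.lo e) (G.hi e) (h e) (h' e)) :
    G.crossEnergy μ h h' H h h' H ≤ (G.constPotential C).crossEnergy μ h h' H h h' H := by
  refine add_le_add (Finset.sum_le_sum fun e _ => ?_) le_rfl
  refine intervalIntegral.integral_mono_on (G.lo_lt_hi e).le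
    (intervalIntegrable_cross (hh e) (hh e))
    (intervalIntegrable_cross (G := G.constPotential C) (hh e) (hh e)) fun x hx => ?_
  have h1 := mul_le_mul_of_nonneg_right (hC e x hx) (mul_self_nonneg (h e x))
  have h2 : (G.constPotential C).q e x = C := rfl
  rw [h2]
  linarith

/-- The Dirichlet eigenfunctions of a single edge for a constant potential. -/
theorem isEigen_sine [DecidableEq E] (C ω : ℝ) (e₀ : E)
    (hω : Real.sin (ω * (G.hi e₀ - G.lo e₀)) = 0) (a : ℝ) :
    (G.constPotential C).IsEigen ⊥ (C + ω ^ 2) (fun e x => a * (if e = e₀ ∧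
      x ∈ Set.Icc (G.lo e) (G.hi e) then Real.sin (ω * (x - G.lo e)) else 0)) 0 := by
  have hlt := G.lo_lt_hi
  set f : E → ℝ → ℝ := fun e x => a * (if e = e₀ ∧
      x ∈ Set.Icc (G.lo e) (G.hi e) then Real.sin (ω * (x - G.lo e)) else 0) with hf
  have hsol : ∀ e, ∃ f', IsSol (fun x => C - (C + ω ^ 2)) (G.lo e) (G.hi e) (f e) f' := by
    intro e
    by_cases he : e = e₀
    · refine ⟨fun x => a * (ω * Real.cos (ω * (x - G.lo e))), ?_⟩
      have h1 : ∀ x, HasDerivAt (fun x => a * Real.sin (ω * (x - G.lo e)))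
          (a * (ω * Real.cos (ω * (x - G.lo e)))) x := by
        intro x
        have := ((((hasDerivAt_id x).sub_const (G.lo e)).const_mul ω).sin).const_mul a
        convert! this using 1
        rw [id_eq]; ring
      have h2 : ∀ x, HasDerivAt (fun x => a * (ω * Real.cos (ω * (x - G.lo e))))
          ((C - (C + ω ^ 2)) * (a * Real.sin (ω * (x - G.lo e)))) x := by
        intro x
        have := (((((hasDerivAt_id x).sub_const (G.lo e)).const_mul ω).cos).const_mul ω).const_mul a
        convert! this using 1
        rw [id_eq]; ring
      have h3 : IsSol (fun x => C - (C + ω ^ 2)) (G.lo e) (G.hi e)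
          (fun x => a * Real.sin (ω * (x - G.lo e)))
          (fun x => a * (ω * Real.cos (ω * (x - G.lo e)))) :=
        ⟨⟨fun x _ => (h1 x).continuousAt.continuousWithinAt,
          fun x _ => (h2 x).continuousAt.continuousWithinAt, ∅, Set.countable_empty,
          fun x _ => h1 x⟩, ∅, Set.countable_empty, fun x _ => h2 x⟩
      refine h3.congr (fun x hx => ?_) fun _ _ => rfl
      simp only [hf]
      rw [if_pos ⟨he, hx⟩]
    · have hz : f e = fun _ => 0 := by
        funext x
        simp [hf, he]
      refine ⟨fun _ => 0, ⟨continuousOn_const.congr fun x _ => by rw [hz], continuousOn_const, ∅,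
        Set.countable_empty, fun x _ => ?_⟩, ∅, Set.countable_empty, fun x _ => ?_⟩
      · rw [hz]; exact hasDerivAt_const x 0
      · rw [hz, mul_zero]; exact hasDerivAt_const x 0
  refine ⟨fun e x hx => ?_, fun e => ?_, fun e => ?_, fun e => ?_, rfl, fun z hz => ?_⟩
  · have : ¬ (e = e₀ ∧ x ∈ Set.Icc (G.lo e) (G.hi e)) := fun h => hx h.2
    simp only [hf]
    rw [if_neg this, mul_zero]
  · obtain ⟨f', hf'⟩ := hsol e
    exact hf'.congr (fun _ _ => rfl) fun x hx => hf'.toIsC1.derivWithin_eq (hlt e) hx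
  · change a * (if e = e₀ ∧ G.lo e ∈ Set.Icc (G.lo e) (G.hi e) then
      Real.sin (ω * (G.lo e - G.lo e)) else 0) = 0
    simp
  · change a * (if e = e₀ ∧ G.hi e ∈ Set.Icc (G.lo e) (G.hi e) then
      Real.sin (ω * (G.hi e - G.lo e)) else 0) = 0
    by_cases he : e = e₀
    · rw [he, hω]; simp
    · simp [he]
  · rw [(Submodule.mem_bot ℝ).mp hz]
    simp

/-- There are arbitrarily many eigenvalues. -/
theorem exists_le_negIndex [DecidableEq E] [Nonempty E] (G : QuantumGraph V E) (k : ℕ) :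
    ∃ μ, ∀ (K : ℝ) (m : Mesh E K) (L : Submodule ℝ (V → ℝ)), m.Fits G → μ ≤ K →
      k ≤ negIndex (G.reducedForm m L μ) := by
  classical
  obtain ⟨e₀⟩ := ‹Nonempty E›
  -- Replace `q` by a constant `C ≥ q` and take `k` Dirichlet sine functions on one edge. Above
  -- their eigenvalues all their non-zero combinations have negative energy, and passing from `C`
  -- back to `q` only lowers it. As these functions vanish at all vertices, their nodal vectors
  -- belong to every `nodalSpace m L`.
  choose B hB using fun e => (G.q_piecewise e).isPotential.bdd
  set C := ∑ e, |B e|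
  have hC : ∀ e, ∀ x ∈ Set.Icc (G.lo e) (G.hi e), G.q e x ≤ C := fun e x hx =>
    ((le_abs_self _).trans ((hB e x hx).trans (le_abs_self _))).trans
      (Finset.single_le_sum (f := fun e => |B e|) (fun e _ => abs_nonneg _) (Finset.mem_univ e))
  set ℓ := G.hi e₀ - G.lo e₀
  have hℓ : 0 < ℓ := sub_pos.mpr (G.lo_lt_hi e₀)
  let ω : ℕ → ℝ := fun j => (j + 1 : ℕ) * Real.pi / ℓ
  have hωpos : ∀ j, 0 < ω j := fun j => by positivity
  have hωinj : Function.Injective fun j => C + ω j ^ 2 := by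
    intro i j hij
    have h1 : ω i ^ 2 = ω j ^ 2 := by simpa using hij
    have h2 := (pow_left_inj₀ (hωpos i).le (hωpos j).le two_ne_zero).mp h1
    have h3 : ((i + 1 : ℕ) : ℝ) = (j + 1 : ℕ) := by
      simp only [ω] at h2
      field_simp at h2
      exact h2
    exact Nat.succ_injective (by exact_mod_cast h3)
  set s : Finset ℝ := (Finset.range k).image fun j => C + ω j ^ 2 with hs
  have hcard : s.card = k := by
    rw [hs, Finset.card_image_of_injective _ hωinj, Finset.card_range]
  have hsω : ∀ ν ∈ s, ∃ w, 0 < w ∧ ν = C + w ^ 2 ∧ Real.sin (w * ℓ) = 0 := by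
    intro ν hν
    obtain ⟨j, -, rfl⟩ := Finset.mem_image.mp hν
    have h1 : ω j * ℓ = (j + 1 : ℕ) * Real.pi := by simp only [ω]; field_simp
    exact ⟨ω j, hωpos j, rfl, by rw [h1, Real.sin_nat_mul_pi]⟩
  obtain ⟨μ₁, hμ₁⟩ := s.bddAbove
  -- `crossEnergy_sum_neg` takes a family indexed by all real numbers; outside `s` the zero function
  -- is used.
  have hg : ∀ ν, ∃ g : E → ℝ → ℝ, (∀ a : ℝ, (G.constPotential C).IsEigen ⊥ ν
      (fun e x => a * g e x) 0) ∧ (ν ∈ s → g ≠ 0) := by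
    intro ν
    by_cases hν : ν ∈ s
    · obtain ⟨w, hw, rfl, hsin⟩ := hsω ν hν
      refine ⟨_, fun a => isEigen_sine C w e₀ hsin a, fun _ h0 => ?_⟩
      -- At this point of the edge the phase lies in `(0, π / 2]`, so the sine is positive.
      set x := G.lo e₀ + min ℓ (Real.pi / (2 * w)) with hx
      have hmin : 0 < min ℓ (Real.pi / (2 * w)) := lt_min hℓ (by positivity)
      have h1 := congrFun (congrFun h0 e₀) x
      have hxI : x ∈ Set.Icc (G.lo e₀) (G.hi e₀) :=
        ⟨by linarith, by linarith [min_le_left ℓ (Real.pi / (2 * w))]⟩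
      simp only [hxI, and_self, if_true, Pi.zero_apply] at h1
      have h2 : x - G.lo e₀ = min ℓ (Real.pi / (2 * w)) := by rw [hx]; ring
      rw [h2] at h1
      refine (Real.sin_pos_of_pos_of_lt_pi (mul_pos hw hmin) ?_).ne' h1
      have h3 : w * min ℓ (Real.pi / (2 * w)) ≤ w * (Real.pi / (2 * w)) :=
        mul_le_mul_of_nonneg_left (min_le_right _ _) hw.le
      have h4 : w * (Real.pi / (2 * w)) = Real.pi / 2 := by field_simp
      linarith [Real.pi_pos]
    · refine ⟨0, fun a => ?_, fun h => absurd h hν⟩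
      have h1 : (fun (e : E) (x : ℝ) => a * (0 : E → ℝ → ℝ) e x) = fun _ _ => 0 := by
        funext e x; simp
      rw [h1]
      refine ⟨fun _ _ _ => rfl, fun e => ?_, fun _ => rfl, fun _ => rfl, rfl, fun z hz => ?_⟩
      · have h2 : ∀ x, (G.constPotential C).edgeDeriv (fun (_ : E) (_ : ℝ) => (0 : ℝ)) e x = 0 := by
          intro x; simp [edgeDeriv]
        refine ⟨⟨continuousOn_const, continuousOn_const.congr fun x _ => h2 x, ∅,
          Set.countable_empty, fun x _ => ?_⟩, ∅, Set.countable_empty, fun x _ => ?_⟩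
        · rw [h2]; exact hasDerivAt_const x 0
        · rw [mul_zero]
          exact (hasDerivAt_const x 0).congr_of_eventuallyEq (Eventually.of_forall h2)
      · rw [(Submodule.mem_bot ℝ).mp hz]
        simp
  choose g hgE hg0 using hg
  refine ⟨μ₁ + 1, fun K m L hm hK => ?_⟩
  have hmem : ∀ ν, nodalValues m (g ν) (0 : V → ℝ) ∈ G.nodalSpace m L := by
    intro ν
    have h1 := hgE ν 1
    simp only [one_mul] at h1
    refine ⟨zero_mem _, fun e => ⟨?_, ?_⟩⟩
    · simp only [nodalValues, m.t_zero, hm.lo]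
      exact h1.left e
    · simp only [nodalValues, m.t_last, hm.hi]
      exact h1.right e
  let Φ : (s → ℝ) →ₗ[ℝ] G.NodalSpace m L :=
    Fintype.linearCombination ℝ fun ν : s => toNodal (hmem ν)
  have hΦ : ∀ a : s → ℝ, a ≠ 0 → G.reducedForm m L (μ₁ + 1) (Φ a) (Φ a) < 0 := by
    intro a ha
    set a' : ℝ → ℝ := fun ν => if h : ν ∈ s then a ⟨ν, h⟩ else 0 with ha'
    have ha's : ∀ ν : s, a' ν = a ν := fun ν => by simp [ha']
    have hval : G.nodalIncl L m (Φ a) = nodalValues m (fun e x => ∑ ν ∈ s, a' ν * g ν e x)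
        (fun v => ∑ ν ∈ s, (0 : V → ℝ) v) := by
      rw [Fintype.linearCombination_apply, map_sum]
      simp only [map_smul, nodalIncl_toNodal]
      refine Prod.ext (funext fun v => ?_) (funext fun e => funext fun i => ?_)
      · simp [nodalValues, Prod.fst_sum]
      · simp only [nodalValues, Prod.snd_sum, Finset.sum_apply]
        rw [← Finset.sum_coe_sort s]
        refine Finset.sum_congr rfl fun ν _ => ?_
        rw [ha's]
        rfl
    have hE : ∀ ν, (G.constPotential C).IsEigen ⊥ ν (fun e x => a' ν * g ν e x) 0 :=
      fun ν => hgE ν (a' ν)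
    have hneg := crossEnergy_sum_neg (s := s) hE (μ := μ₁ + 1)
      (fun ν hν => lt_of_le_of_lt (hμ₁ hν) (by linarith)) (by
        obtain ⟨ν, hν⟩ := Function.ne_iff.mp ha
        refine ⟨ν, ν.2, fun h0 => hg0 ν ν.2 ?_⟩
        funext e x
        have := congrFun (congrFun h0 e) x
        rw [ha's] at this
        exact (mul_eq_zero.mp this).resolve_left hν)
    rw [reducedForm_apply, hval]
    have hC1 : ∀ e, IsC1 (G.lo e) (G.hi e) (fun x => ∑ ν ∈ s, a' ν * g ν e x)
        (fun x => ∑ ν ∈ s, (G.constPotential C).edgeDeriv (fun e x => a' ν * g ν e x) e x) :=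
      fun e => IsC1.sum s fun ν => ((hE ν).sol e).toIsC1
    refine (nodalForm_le_crossEnergy hm hK hC1).trans_lt ?_
    exact (crossEnergy_le_constPotential hC _ hC1).trans_lt hneg
  have hinj : Function.Injective Φ := by
    rw [← LinearMap.ker_eq_bot, LinearMap.ker_eq_bot']
    intro a ha
    by_contra ha0
    have := hΦ a ha0
    rw [ha] at this
    simp at this
  have h1 := LinearMap.finrank_range_of_inj hinj
  rw [Module.finrank_fintype_fun_eq_card, Fintype.card_coe, hcard] at h1
  rw [← h1]
  refine le_negIndex ?_
  rintro _ ⟨a, rfl⟩ h0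
  exact hΦ a fun ha => h0 (by rw [ha, map_zero])

/-- Every eigenvalue number is attained. -/
theorem exists_isNthEigenvalue [DecidableEq E] [Nonempty E] (G : QuantumGraph V E)
    (hcov : ∀ v, ∃ e, G.src e = v ∨ G.tgt e = v) {k : ℕ} (hk : 0 < k) :
    ∃ μ, G.IsNthEigenvalue ℝ k μ := by
  obtain ⟨μ, hμ⟩ := G.exists_le_negIndex k
  obtain ⟨m, hm, -⟩ := G.exists_mesh (μ + 1) (A := fun _ => ∅) (by simp)
  obtain ⟨τ, hτ, -⟩ := exists_isReduction (L := G.dirSpace) hm hcov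
    (𝓔 := G.eigenspace ℝ) fun μ f => G.mem_eigenspace_iff
  obtain ⟨ν, hν, h1⟩ := hτ.exists_isNth hk (lt_add_one μ) (hμ _ m _ hm (by linarith))
  exact ⟨ν, (isNthEigenvalue_iff hτ hν k).mpr h1⟩

end QuantumGraph

/-! ### Diagonal forms. -/

section Diagonal

variable {Y : Type*} [NormedAddCommGroup Y] [NormedSpace ℝ Y] [FiniteDimensional ℝ Y]
  {P : Type*} [Fintype P] {B : Y →L[ℝ] Y →L[ℝ] ℝ} {κ : P → ℝ} {ℓ : P → Y →ₗ[ℝ] ℝ} {w : P → Y}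

/-- Pairing with the dual vector `w p` isolates one summand. Duality is asked only of functionals
with non-zero coefficient, because the others are uncontrolled in the application: they belong to
pieces that touch a Dirichlet vertex. -/
theorem eq_zero_of_diagonal (hB : ∀ x y, B x y = ∑ p, κ p * (ℓ p x * ℓ p y))
    [DecidableEq P] (hw : ∀ p q, κ q ≠ 0 → ℓ q (w p) = if q = p then 1 else 0) {x : Y}
    (hx : B x = 0) {p : P} (hp : κ p ≠ 0) : ℓ p x = 0 := by
  have h1 : B x (w p) = 0 := by rw [hx]; rfl
  rw [hB, Finset.sum_eq_single p] at h1
  · rw [hw p p hp] at h1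
    simpa [hp] using h1
  · intro q _ hq
    by_cases h : κ q = 0
    · rw [h, zero_mul]
    · rw [hw p q h, if_neg hq, mul_zero, mul_zero]
  · simp

/-- The negative index of a diagonal form is the number of negative coefficients. -/
theorem negIndex_diagonal (hB : ∀ x y, B x y = ∑ p, κ p * (ℓ p x * ℓ p y))
    [DecidableEq P] (hw : ∀ p q, κ q ≠ 0 → ℓ q (w p) = if q = p then 1 else 0) :
    negIndex B = Fintype.card {p // κ p < 0} := by
  apply le_antisymm
  · obtain ⟨U, hU, hneg⟩ := exists_finrank_eq_negIndex B
    -- The coordinates with negative coefficient are injective on a negative subspace: where they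
    -- all vanish the form is non-negative.
    let Φ : U →ₗ[ℝ] ({p // κ p < 0} → ℝ) := LinearMap.pi fun p => (ℓ p).comp U.subtype
    have hinj : Function.Injective Φ := by
      rw [← LinearMap.ker_eq_bot, LinearMap.ker_eq_bot']
      intro x hx
      by_contra hx0
      have h1 := hneg x x.2 (by simpa using hx0)
      rw [hB] at h1
      refine h1.not_ge (Finset.sum_nonneg fun p _ => ?_)
      by_cases hp : κ p < 0
      · have : ℓ p x = 0 := congrFun hx ⟨p, hp⟩
        rw [this]; simp
      · exact mul_nonneg (not_lt.mp hp) (mul_self_nonneg _)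
    have := LinearMap.finrank_le_finrank_of_injective hinj
    rwa [hU, Module.finrank_fintype_fun_eq_card] at this
  -- Conversely, the dual vectors of the negative coefficients span a negative subspace.
  · let Φ : ({p // κ p < 0} → ℝ) →ₗ[ℝ] Y := Fintype.linearCombination ℝ fun p => w p
    have hΦ : ∀ a q, κ q ≠ 0 → ℓ q (Φ a) = if h : κ q < 0 then a ⟨q, h⟩ else 0 := by
      intro a q hq
      rw [Fintype.linearCombination_apply, map_sum]
      simp only [map_smul, smul_eq_mul, hw _ q hq]
      by_cases h : κ q < 0
      · rw [dif_pos h, Finset.sum_eq_single ⟨q, h⟩]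
        · simp
        · intro p _ hp
          have : q ≠ p := fun h' => hp (Subtype.ext h'.symm)
          simp [this]
        · simp
      · rw [dif_neg h]
        refine Finset.sum_eq_zero fun p _ => ?_
        have : q ≠ p := fun h' => h (h' ▸ p.2)
        simp [this]
    have hneg : ∀ a, a ≠ 0 → B (Φ a) (Φ a) < 0 := by
      intro a ha
      obtain ⟨⟨p, hp⟩, hap⟩ := Function.ne_iff.mp ha
      rw [hB]
      refine Finset.sum_neg' (fun q _ => ?_) ⟨p, Finset.mem_univ p, ?_⟩
      · by_cases hq : κ q < 0
        · exact mul_nonpos_of_nonpos_of_nonneg hq.le (mul_self_nonneg _)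
        · by_cases hq0 : κ q = 0
          · simp [hq0]
          · rw [hΦ a q hq0, dif_neg hq]; simp
      · rw [hΦ a p hp.ne, dif_pos hp]
        exact mul_neg_of_neg_of_pos hp (mul_self_pos.mpr hap)
    have hinj : Function.Injective Φ := by
      rw [← LinearMap.ker_eq_bot, LinearMap.ker_eq_bot']
      intro a ha
      by_contra ha0
      have := hneg a ha0
      rw [ha] at this
      simp at this
    have h1 := LinearMap.finrank_range_of_inj hinj
    rw [Module.finrank_fintype_fun_eq_card] at h1
    rw [← h1]
    refine le_negIndex ?_
    rintro _ ⟨a, rfl⟩ h0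
    exact hneg a fun ha => h0 (by rw [ha, map_zero])

end Diagonal

theorem IsShort.mono {q : ℝ → ℝ} {K x y x' y' : ℝ} (h : IsShort q K x y) (hx : x ≤ x')
    (hxy : x' ≤ y') (hy : y' ≤ y) : IsShort q K x' y' := by
  obtain ⟨k, hk, h1, h2⟩ := h
  refine ⟨k, hk, lt_of_le_of_lt ?_ h1, fun z hz => h2 z ⟨hx.trans hz.1, hz.2.trans hy⟩⟩
  have : 0 ≤ y' - x' := by linarith
  gcongr

/-! ### Zeros of solutions on short pieces. -/

section Zeros

variable {q : ℝ → ℝ} {a b K μ x y : ℝ} {f f' : ℝ → ℝ}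

/-- The discrete Jacobi transformation: for multiples of a solution the form becomes a weighted
product of increments, up to boundary terms that telescope along an edge. -/
theorem FundSys.form_mul {F : FundSys q a b} (hab : a < b) (hq : IsPotential q a b)
    (hx : x ∈ Set.Icc a b) (hy : y ∈ Set.Icc a b) (hσ : F.σ μ x y ≠ 0)
    (hf : IsSol (fun x => q x - μ) a b f f') (u v u' v' : ℝ) :
    F.form μ x y (u * f x) (v * f y) (u' * f x) (v' * f y) =
      f x * f y / F.σ μ x y * ((v - u) * (v' - u')) +
        (f' y * (f y * (v * v')) - f' x * (f x * (u * u'))) := by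
  have h1 := F.form_eq hab hq hx hy hσ hf 1 0
  have h2 := F.form_eq hab hq hx hy hσ hf 0 1
  simp only [FundSys.form] at h1 h2 ⊢
  rw [div_eq_mul_inv]
  linear_combination u * u' * f x * h1 + v * v' * f y * h2

/-- A zero inside a short interval forces a change of sign or the vanishing on both ends. -/
theorem mul_neg_of_zero (F : FundSys q a b) (hab : a < b) (hq : IsPotential q a b) (hμ : μ ≤ K)
    (hx : a ≤ x) (hxy : x < y) (hy : y ≤ b) (hs : IsShort q K x y)
    (hf : IsSol (fun x => q x - μ) a b f f')
    (h0 : f x ≠ 0 ∨ f y ≠ 0) {z : ℝ} (hz : z ∈ Set.Ioo x y) (hfz : f z = 0) :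
    f x * f y < 0 := by
  have hzI : z ∈ Set.Icc a b := ⟨hx.trans hz.1.le, hz.2.le.trans hy⟩
  -- Seen from the zero `z`, the end values are `f x = -f' z * σ x z` and `f y = f' z * σ z y`, with
  -- both `σ` positive.
  have h1 := F.eq_of_cauchy hab hq hf hzI (y := x) ⟨hx, hxy.le.trans hy⟩ hfz
  have h2 := F.eq_of_cauchy hab hq hf hzI (y := y) ⟨hx.trans hxy.le, hy⟩ hfz
  have s1 := F.σ_pos hq hμ hx hz.1 hzI.2 (hs.mono le_rfl hz.1.le hz.2.le)
  have s2 := F.σ_pos hq hμ hzI.1 hz.2 hy (hs.mono hz.1.le hz.2.le le_rfl)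
  have h3 : F.σ μ z x = -F.σ μ x z := by simp only [FundSys.σ]; ring
  rw [h3] at h1
  have h4 : f' z ≠ 0 := by
    intro h
    rw [h, zero_mul] at h1 h2
    exact h0.elim (fun h => h h1) fun h => h h2
  rw [h1, h2]
  have := mul_pos (mul_self_pos.mpr h4) (mul_pos s1 s2)
  nlinarith

/-- Existence is the intermediate value theorem. For two zeros `z < z'`, `mul_neg_of_zero` on `[x,
z']` would give `f x * f z' < 0`, although `f z' = 0`. -/
theorem existsUnique_zero (F : FundSys q a b) (hab : a < b) (hq : IsPotential q a b) (hμ : μ ≤ K)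
    (hx : a ≤ x) (hxy : x < y) (hy : y ≤ b) (hs : IsShort q K x y)
    (hf : IsSol (fun x => q x - μ) a b f f')
    (h0 : f x * f y < 0) : ∃! z, z ∈ Set.Ioo x y ∧ f z = 0 := by
  have hc : ContinuousOn f (Set.Icc x y) := hf.cont.mono (Set.Icc_subset_Icc hx hy)
  have hex : ∃ z ∈ Set.Ioo x y, f z = 0 := by
    obtain ⟨h1, h2⟩ | ⟨h1, h2⟩ := mul_neg_iff.mp h0
    · exact intermediate_value_Ioo' hxy.le hc ⟨h2, h1⟩
    · exact intermediate_value_Ioo hxy.le hc ⟨h1, h2⟩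
  have key : ∀ z z', z ∈ Set.Ioo x y → z' ∈ Set.Ioo x y → f z = 0 → f z' = 0 → ¬ z < z' := by
    intro z z' hz hz' hfz hfz' hlt
    have := mul_neg_of_zero F hab hq hμ hx (hz.1.trans hlt) (hz'.2.le.trans hy)
      (hs.mono le_rfl (hz.1.trans hlt).le hz'.2.le) hf
      (Or.inl fun h => by rw [h, zero_mul] at h0; exact h0.false) ⟨hz.1, hlt⟩ hfz
    rw [hfz', mul_zero] at this
    exact this.false
  obtain ⟨z, hz, hfz⟩ := hex
  refine ⟨z, ⟨hz, hfz⟩, fun z' ⟨hz', hfz'⟩ => ?_⟩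
  exact le_antisymm (not_lt.mp (key z z' hz hz' hfz hfz')) (not_lt.mp (key z' z hz' hz hfz' hfz))

end Zeros

/-! ### The nodal count on a tree. -/

namespace QuantumGraph

variable {V E : Type*} [DecidableEq V] [Fintype E] [Fintype V] {G : QuantumGraph V E}
  {K : ℝ} {m : Mesh E K}

theorem dir_unique {v : V} (hv : v ∈ G.dir) {e e' : E} (he : G.src e = v ∨ G.tgt e = v)
    (he' : G.src e' = v ∨ G.tgt e' = v) : e = e' := by
  classical
  by_contra hne
  have h := G.degree_dir v hv
  have h1 : ∑ x ∈ ({e, e'} : Finset E), ((if G.src x = v then 1 else 0) +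
      (if G.tgt x = v then 1 else 0)) ≤ (1 : ℕ) :=
    (Finset.sum_le_sum_of_subset (Finset.subset_univ ({e, e'} : Finset E))).trans h.le
  rw [Finset.sum_pair hne] at h1
  have h2 : ∀ x : E, (G.src x = v ∨ G.tgt x = v) → 1 ≤ ((if G.src x = v then 1 else 0) +
      (if G.tgt x = v then 1 else 0) : ℕ) := by
    rintro x (hx | hx)
    · rw [if_pos hx]; omega
    · rw [if_pos hx]; omega
  have := h2 e he
  have := h2 e' he'
  omega

section Tree

variable {ξ : ℝ} {ψ : E → ℝ → ℝ} {F : V → ℝ}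

/-- The coefficient of a piece in the form on multiples of the eigenfunction. -/
noncomputable def pieceCoeff (m : Mesh E K) (ξ : ℝ) (ψ : E → ℝ → ℝ) (p : E × Fin m.N) : ℝ :=
  ψ p.1 (m.t p.1 p.2.castSucc) * ψ p.1 (m.t p.1 p.2.succ) /
    (m.sys p.1).σ ξ (m.t p.1 p.2.castSucc) (m.t p.1 p.2.succ)

/-- The form on products with an eigenfunction. -/
theorem IsEigen.nodalForm_mul (hm : m.Fits G) (hξ : ξ ≤ K)
    (hψ : G.IsEigen G.dirSpace ξ ψ F) {u u' : Mesh.Nodal V m} (hu : u ∈ G.nodalSpace m ⊤)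
    (hu' : u' ∈ G.nodalSpace m ⊤) {x y : Mesh.Nodal V m}
    (hx : (∀ v, x.1 v = u.1 v * F v) ∧ ∀ e i, x.2 e i = u.2 e i * ψ e (m.t e i))
    (hy : (∀ v, y.1 v = u'.1 v * F v) ∧ ∀ e i, y.2 e i = u'.2 e i * ψ e (m.t e i)) :
    m.nodalForm G.χ ξ x y = ∑ p : E × Fin m.N, pieceCoeff m ξ ψ p *
      ((u.2 p.1 p.2.succ - u.2 p.1 p.2.castSucc) *
        (u'.2 p.1 p.2.succ - u'.2 p.1 p.2.castSucc)) := by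
  have hsol : ∀ e, IsSol (fun x => m.q e x - ξ) (m.lo e) (m.hi e) (ψ e) (G.edgeDeriv ψ e) := by
    rw [hm.lo, hm.hi, hm.q]; exact hψ.sol
  rw [Mesh.nodalForm_apply, Mesh.edgeForm_apply, Fintype.sum_prod_type]
  have h1 : ∀ e (i : Fin m.N), (m.sys e).form ξ (m.t e i.castSucc) (m.t e i.succ)
      (x.2 e i.castSucc) (x.2 e i.succ) (y.2 e i.castSucc) (y.2 e i.succ) =
      pieceCoeff m ξ ψ (e, i) * ((u.2 e i.succ - u.2 e i.castSucc) *
        (u'.2 e i.succ - u'.2 e i.castSucc)) +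
      (G.edgeDeriv ψ e (m.t e i.succ) * (ψ e (m.t e i.succ) * (u.2 e i.succ * u'.2 e i.succ)) -
        G.edgeDeriv ψ e (m.t e i.castSucc) *
          (ψ e (m.t e i.castSucc) * (u.2 e i.castSucc * u'.2 e i.castSucc))) := by
    intro e i
    rw [hx.2, hx.2, hy.2, hy.2]
    exact (m.sys e).form_mul (m.lo_lt_hi e) (m.pot e) (m.mem_Icc e _) (m.mem_Icc e _)
      (m.σ_pos hξ e i).ne' (hsol e) _ _ _ _
  have h2 : ∀ e, ∑ i : Fin m.N,
      (G.edgeDeriv ψ e (m.t e i.succ) * (ψ e (m.t e i.succ) * (u.2 e i.succ * u'.2 e i.succ)) -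
        G.edgeDeriv ψ e (m.t e i.castSucc) *
          (ψ e (m.t e i.castSucc) * (u.2 e i.castSucc * u'.2 e i.castSucc))) =
      G.edgeDeriv ψ e (G.hi e) * (F (G.tgt e) * (u.1 (G.tgt e) * u'.1 (G.tgt e))) -
      G.edgeDeriv ψ e (G.lo e) * (F (G.src e) * (u.1 (G.src e) * u'.1 (G.src e))) := by
    intro e
    rw [Fin.sum_succ_sub_castSucc fun i => G.edgeDeriv ψ e (m.t e i) *
      (ψ e (m.t e i) * (u.2 e i * u'.2 e i)), m.t_zero, m.t_last, hm.lo, hm.hi,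
      (hu.2 e).1, (hu.2 e).2, (hu'.2 e).1, (hu'.2 e).2, hψ.left, hψ.right]
  -- The boundary terms left by telescoping cancel against the vertex terms: this is the balance
  -- condition of `ψ` tested with `F u u'`.
  have h3 := hψ.balance (fun v => F v * (u.1 v * u'.1 v)) (fun v hv => by
    change F v * _ = 0
    rw [hψ.mem v hv, zero_mul])
  simp only [sub_mul, Finset.sum_sub_distrib] at h3
  rw [sum_flux_mul (G := G) ψ fun v => F v * (u.1 v * u'.1 v)] at h3
  simp only [h1, Finset.sum_add_distrib, h2, hx.1, hy.1]
  have h4 : ∀ v, G.χ v * (u.1 v * F v * (u'.1 v * F v)) =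
      G.χ v * F v * (F v * (u.1 v * u'.1 v)) := fun v => by ring
  simp only [h4]
  simp only [Finset.sum_sub_distrib] at h3 ⊢
  linarith

/-- The quotient of a nodal vector by the eigenfunction. -/
noncomputable def nodalQuot (G : QuantumGraph V E) (m : Mesh E K) (ψ : E → ℝ → ℝ) (F : V → ℝ) :
    G.NodalSpace m G.dirSpace →ₗ[ℝ] Mesh.Nodal V m where
  toFun x := (fun v => (G.nodalIncl _ m x).1 v / F v,
    fun e i => (G.nodalIncl _ m x).2 e i / ψ e (m.t e i))
  map_add' x y := by
    refine Prod.ext (funext fun v => ?_) (funext fun e => funext fun i => ?_) <;>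
      simp [add_div]
  map_smul' c x := by
    refine Prod.ext (funext fun v => ?_) (funext fun e => funext fun i => ?_) <;>
      simp [mul_div_assoc]

theorem nodalQuot_mem (hm : m.Fits G) (hψ : G.IsEigen G.dirSpace ξ ψ F)
    (x : G.NodalSpace m G.dirSpace) :
    G.nodalQuot m ψ F x ∈ G.nodalSpace m ⊤ := by
  have hx := nodalIncl_mem x
  refine ⟨trivial, fun e => ⟨?_, ?_⟩⟩
  · simp only [nodalQuot, LinearMap.coe_mk, AddHom.coe_mk, (hx.2 e).1, m.t_zero, hm.lo, hψ.left]
  · simp only [nodalQuot, LinearMap.coe_mk, AddHom.coe_mk, (hx.2 e).2, m.t_last, hm.hi, hψ.right]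

/-- At a Dirichlet vertex the quotient is the default value `0 / 0 = 0`; this does no harm, since
both sides vanish there. -/
theorem nodalQuot_mul_vertex (hF : ∀ v ∉ G.dir, F v ≠ 0)
    (x : G.NodalSpace m G.dirSpace) (v : V) :
    (G.nodalIncl _ m x).1 v = (G.nodalQuot m ψ F x).1 v * F v := by
  have hx := nodalIncl_mem x
  simp only [nodalQuot, LinearMap.coe_mk, AddHom.coe_mk]
  by_cases hv : v ∈ G.dir
  · rw [hx.1 v hv]; simp
  · rw [div_mul_cancel₀ _ (hF v hv)]

theorem nodalQuot_mul_node (hm : m.Fits G) (hψ : G.IsEigen G.dirSpace ξ ψ F)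
    (hF : ∀ v ∉ G.dir, F v ≠ 0) (hnode : ∀ e i, i ≠ 0 → i ≠ Fin.last m.N → ψ e (m.t e i) ≠ 0)
    (x : G.NodalSpace m G.dirSpace) (e : E) (i : Fin (m.N + 1)) :
    (G.nodalIncl _ m x).2 e i = (G.nodalQuot m ψ F x).2 e i * ψ e (m.t e i) := by
  have hx := nodalIncl_mem x
  have hq := nodalQuot_mem hm hψ x
  by_cases h0 : i = 0
  · rw [h0, (hx.2 e).1, (hq.2 e).1, m.t_zero, hm.lo, hψ.left, nodalQuot_mul_vertex hF]
  by_cases hl : i = Fin.last m.N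
  · rw [hl, (hx.2 e).2, (hq.2 e).2, m.t_last, hm.hi, hψ.right, nodalQuot_mul_vertex hF]
  · simp only [nodalQuot, LinearMap.coe_mk, AddHom.coe_mk]
    rw [div_mul_cancel₀ _ (hnode e i h0 hl)]

/-- The increment of the quotient over a piece. -/
noncomputable def pieceIncr (G : QuantumGraph V E) (m : Mesh E K) (ψ : E → ℝ → ℝ) (F : V → ℝ)
    (p : E × Fin m.N) : G.NodalSpace m G.dirSpace →ₗ[ℝ] ℝ :=
  ((m.node V p.1 p.2.succ).toLinearMap - (m.node V p.1 p.2.castSucc).toLinearMap).comp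
    (G.nodalQuot m ψ F)

theorem pieceIncr_apply (p : E × Fin m.N) (x : G.NodalSpace m G.dirSpace) :
    G.pieceIncr m ψ F p x = (G.nodalQuot m ψ F x).2 p.1 p.2.succ -
      (G.nodalQuot m ψ F x).2 p.1 p.2.castSucc := rfl

theorem reducedForm_eq_diagonal (hm : m.Fits G) (hξ : ξ ≤ K) (hψ : G.IsEigen G.dirSpace ξ ψ F)
    (hF : ∀ v ∉ G.dir, F v ≠ 0) (hnode : ∀ e i, i ≠ 0 → i ≠ Fin.last m.N → ψ e (m.t e i) ≠ 0)
    (x y : G.NodalSpace m G.dirSpace) :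
    G.reducedForm m G.dirSpace ξ x y = ∑ p : E × Fin m.N, pieceCoeff m ξ ψ p *
      (G.pieceIncr m ψ F p x * G.pieceIncr m ψ F p y) :=
  hψ.nodalForm_mul hm hξ (nodalQuot_mem hm hψ x) (nodalQuot_mem hm hψ y)
    ⟨nodalQuot_mul_vertex hF x, nodalQuot_mul_node hm hψ hF hnode x⟩
    ⟨nodalQuot_mul_vertex hF y, nodalQuot_mul_node hm hψ hF hnode y⟩

/-- On a graph without cycles the increments over the pieces are independent. -/
theorem exists_pieceIncr_dual (hm : m.Fits G) (hψ : G.IsEigen G.dirSpace ξ ψ F)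
    [DecidableEq E]
    (hθ : ∀ e, ∃ θ : V → ℝ, ∀ e', θ (G.tgt e') - θ (G.src e') = if e' = e then 1 else 0)
    (p : E × Fin m.N) : ∃ w : G.NodalSpace m G.dirSpace, ∀ q, pieceCoeff m ξ ψ q ≠ 0 →
      G.pieceIncr m ψ F q w = if q = p then 1 else 0 := by
  obtain ⟨e, i⟩ := p
  obtain ⟨θ, hθ⟩ := hθ e
  -- Absence of cycles provides a vertex function `θ` whose only increment is along `e`. It is
  -- extended to the nodes as a step function jumping on the `i`-th piece of `e` only.
  let u : E → Fin (m.N + 1) → ℝ := fun e' k =>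
    if e' = e then (if k ≤ i.castSucc then θ (G.src e) else θ (G.tgt e)) else θ (G.src e')
  have hu0 : ∀ e', u e' 0 = θ (G.src e') := by
    intro e'
    by_cases h : e' = e
    · simp [u, h]
    · simp [u, h]
  have hul : ∀ e', u e' (Fin.last _) = θ (G.tgt e') := by
    intro e'
    by_cases h : e' = e
    · have : ¬ Fin.last m.N ≤ i.castSucc := not_le.mpr (Fin.castSucc_lt_last i)
      simp [u, h, this]
    · have := hθ e'
      rw [if_neg h] at this
      simp only [u, if_neg h]
      linarith
  let y : Mesh.Nodal V m := (fun v => θ v * F v, fun e' k => u e' k * ψ e' (m.t e' k))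
  have hy : y ∈ G.nodalSpace m G.dirSpace := by
    refine ⟨fun v hv => ?_, fun e' => ⟨?_, ?_⟩⟩
    · simp only [y]; rw [hψ.mem v hv, mul_zero]
    · simp only [y]; rw [hu0, m.t_zero, hm.lo, hψ.left]
    · simp only [y]; rw [hul, m.t_last, hm.hi, hψ.right]
  refine ⟨toNodal hy, fun ⟨e', k⟩ hq => ?_⟩
  -- A non-zero coefficient means that `ψ` vanishes at neither end of the piece, so the quotient
  -- recovers `u` there.
  have h1 : ψ e' (m.t e' k.castSucc) ≠ 0 := fun h => hq (by simp [pieceCoeff, h])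
  have h2 : ψ e' (m.t e' k.succ) ≠ 0 := fun h => hq (by simp [pieceCoeff, h])
  rw [pieceIncr_apply]
  simp only [nodalQuot, LinearMap.coe_mk, AddHom.coe_mk, nodalIncl_toNodal, y]
  rw [mul_div_cancel_right₀ _ h1, mul_div_cancel_right₀ _ h2]
  by_cases he : e' = e
  · subst he
    have h3 := hθ e'
    rw [if_pos rfl] at h3
    simp only [u, if_true, Prod.mk.injEq, true_and, Fin.castSucc_le_castSucc_iff,
      Fin.succ_le_castSucc_iff]
    rcases lt_trichotomy k i with h | h | h
    · simp [h, h.le, h.ne]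
    · simp [h, h3]
    · simp [h.not_gt, h.not_ge, h.ne']
  · simp [u, he]

/-- The quotient is constant along each edge except possibly at Dirichlet ends, where the
coefficient of the piece is zero. The constant is carried by the first interior node, which exists
since `1 < m.N`, and connectedness makes it the same on all edges. -/
theorem eq_smul_of_pieceIncr_eq_zero (hm : m.Fits G) (hψ : G.IsEigen G.dirSpace ξ ψ F)
    (hF : ∀ v ∉ G.dir, F v ≠ 0) (hnode : ∀ e i, i ≠ 0 → i ≠ Fin.last m.N → ψ e (m.t e i) ≠ 0)
    (hN : 1 < m.N)
    (hcov : ∀ v, ∃ e, G.src e = v ∨ G.tgt e = v)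
    (hconn : ∀ θ : V → ℝ, (∀ e, θ (G.src e) = θ (G.tgt e)) → ∀ v w, θ v = θ w)
    {x : G.NodalSpace m G.dirSpace}
    (hx : ∀ p, pieceCoeff m ξ ψ p ≠ 0 → G.pieceIncr m ψ F p x = 0) (hξ : ξ ≤ K) :
    ∃ a : ℝ, G.nodalIncl _ m x = a • nodalValues m ψ F := by
  classical
  set u := G.nodalQuot m ψ F x with hu
  have huq := nodalQuot_mem hm hψ x
  rw [← hu] at huq
  have hstep : ∀ e (i : Fin m.N), ψ e (m.t e i.castSucc) ≠ 0 → ψ e (m.t e i.succ) ≠ 0 →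
      u.2 e i.succ = u.2 e i.castSucc := by
    intro e i h1 h2
    have := hx (e, i) (div_ne_zero (mul_ne_zero h1 h2) (m.σ_pos hξ e i).ne')
    rw [pieceIncr_apply, ← hu] at this
    linarith
  set one : Fin (m.N + 1) := ⟨1, by omega⟩ with hone
  have hInt : ∀ e (k : ℕ) (hk : k + 1 < m.N), u.2 e ⟨k + 1, by omega⟩ = u.2 e one := by
    intro e k
    induction k with
    | zero => intro _; rfl
    | succ k ih =>
      intro hk
      rw [← ih (by omega)]
      refine hstep e ⟨k + 1, by omega⟩ (hnode e _ ?_ ?_) (hnode e _ ?_ ?_) <;>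
        simp [Fin.ext_iff] <;> omega
  have hfirst : ∀ e, G.src e ∉ G.dir → u.1 (G.src e) = u.2 e one := by
    intro e he
    have h0 : (⟨0, by omega⟩ : Fin m.N).castSucc = 0 := rfl
    have := hstep e ⟨0, by omega⟩ (by rw [h0, m.t_zero, hm.lo, hψ.left]; exact hF _ he)
      (hnode e _ (by simp [Fin.ext_iff]) (by simp [Fin.ext_iff]; omega))
    rw [h0, (huq.2 e).1] at this
    exact this.symm
  have hlast : ∀ e, G.tgt e ∉ G.dir → u.1 (G.tgt e) = u.2 e one := by
    intro e he
    have hl : (⟨m.N - 1, by omega⟩ : Fin m.N).succ = Fin.last m.N := Fin.ext (by simp; omega)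
    have h1 := hstep e ⟨m.N - 1, by omega⟩
      (hnode e _ (by simp [Fin.ext_iff]; omega) (by simp [Fin.ext_iff]; omega))
      (by rw [hl, m.t_last, hm.hi, hψ.right]; exact hF _ he)
    rw [hl, (huq.2 e).2] at h1
    rw [h1, ← hInt e (m.N - 2) (by omega)]
    exact congrArg (u.2 e) (Fin.ext (by change m.N - 1 = m.N - 2 + 1; omega))
  choose inc hinc using hcov
  -- At a Dirichlet vertex the meaningless quotient is replaced by the constant of the only edge
  -- that ends there.
  let θ : V → ℝ := fun v => if v ∈ G.dir then u.2 (inc v) one else u.1 v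
  have hsrc : ∀ e, θ (G.src e) = u.2 e one := by
    intro e
    by_cases he : G.src e ∈ G.dir
    · simp only [θ, if_pos he]
      rw [dir_unique he (hinc _) (Or.inl rfl)]
    · simp only [θ, if_neg he]
      exact hfirst e he
  have htgt : ∀ e, θ (G.tgt e) = u.2 e one := by
    intro e
    by_cases he : G.tgt e ∈ G.dir
    · simp only [θ, if_pos he]
      rw [dir_unique he (hinc _) (Or.inr rfl)]
    · simp only [θ, if_neg he]
      exact hlast e he
  have hc := hconn θ fun e => (hsrc e).trans (htgt e).symm
  by_cases hV : Nonempty V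
  swap
  · refine ⟨0, Prod.ext (funext fun v => (hV ⟨v⟩).elim) (funext fun e => (hV ⟨G.src e⟩).elim)⟩
  obtain ⟨v₀⟩ := hV
  have hvert : ∀ v, (G.nodalIncl _ m x).1 v = θ v₀ * F v := by
    intro v
    rw [nodalQuot_mul_vertex hF x v, ← hu]
    by_cases hv : v ∈ G.dir
    · rw [hψ.mem v hv, mul_zero, mul_zero]
    · rw [← hc v v₀]
      simp only [θ, if_neg hv]
  refine ⟨θ v₀, Prod.ext (funext fun v => hvert v) (funext fun e => funext fun i => ?_)⟩
  change _ = θ v₀ * ψ e (m.t e i)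
  have hxm := nodalIncl_mem x
  by_cases h0 : i = 0
  · rw [h0, (hxm.2 e).1, hvert, m.t_zero, hm.lo, hψ.left]
  by_cases hl : i = Fin.last m.N
  · rw [hl, (hxm.2 e).2, hvert, m.t_last, hm.hi, hψ.right]
  rw [nodalQuot_mul_node hm hψ hF hnode, ← hu, ← hc (G.src e) v₀, hsrc]
  congr 1
  have h1 : (i : ℕ) ≠ 0 := fun h => h0 (Fin.ext (by simpa using h))
  have h2 : (i : ℕ) ≠ m.N := fun h => hl (Fin.ext (by simpa using h))
  have h3 := i.2
  rw [← hInt e (i - 1) (by omega)]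
  exact congrArg (u.2 e) (Fin.ext (by change (i : ℕ) = i - 1 + 1; omega))

/-- The zeros of the eigenfunction correspond to the pieces with negative coefficient. -/
theorem internalZeros_finite_ncard (hm : m.Fits G) (hξ : ξ ≤ K) (hψ : G.IsEigen G.dirSpace ξ ψ F)
    (hnode : ∀ e i, i ≠ 0 → i ≠ Fin.last m.N → ψ e (m.t e i) ≠ 0)
    (hN : 1 < m.N) : (G.internalZeros ψ).Finite ∧
    (G.internalZeros ψ).ncard = Fintype.card {p : E × Fin m.N // pieceCoeff m ξ ψ p < 0} := by
  have hsol : ∀ e, IsSol (fun x => m.q e x - ξ) (m.lo e) (m.hi e) (ψ e) (G.edgeDeriv ψ e) := by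
    rw [hm.lo, hm.hi, hm.q]; exact hψ.sol
  have hsign : ∀ p : E × Fin m.N, pieceCoeff m ξ ψ p < 0 ↔
      ψ p.1 (m.t p.1 p.2.castSucc) * ψ p.1 (m.t p.1 p.2.succ) < 0 := fun p =>
    ⟨fun h => by
      by_contra hcon
      exact h.not_ge (div_nonneg (not_lt.mp hcon) (m.σ_pos hξ p.1 p.2).le),
      fun h => div_neg_of_neg_of_pos h (m.σ_pos hξ p.1 p.2)⟩
  -- As `1 < m.N`, at least one end of every piece is an interior node, where `ψ` is non-zero.
  have hne : ∀ e (i : Fin m.N), ψ e (m.t e i.castSucc) ≠ 0 ∨ ψ e (m.t e i.succ) ≠ 0 := by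
    intro e i
    by_cases h : (i : ℕ) = 0
    · refine Or.inr (hnode e _ ?_ ?_) <;> (simp [Fin.ext_iff]; try omega)
    · refine Or.inl (hnode e _ ?_ ?_) <;> simp [Fin.ext_iff] <;> omega
  have huniq : ∀ p : {p : E × Fin m.N // pieceCoeff m ξ ψ p < 0}, ∃! z,
      z ∈ Set.Ioo (m.t p.1.1 p.1.2.castSucc) (m.t p.1.1 p.1.2.succ) ∧ ψ p.1.1 z = 0 := fun p =>
    existsUnique_zero (m.sys p.1.1) (m.lo_lt_hi _) (m.pot _) hξ (m.mem_Icc _ _).1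
      (m.t_lt _ _) (m.mem_Icc _ _).2 (m.short _ _) (hsol _) ((hsign p.1).mp p.2)
  choose z hz hzu using huniq
  have hrange : Set.range (fun p => ((p : {p : E × Fin m.N // pieceCoeff m ξ ψ p < 0}).1.1, z p)) =
      G.internalZeros ψ := by
    ext ⟨e, x⟩
    constructor
    · rintro ⟨p, hp⟩
      obtain ⟨h1, h2⟩ := Prod.ext_iff.mp hp
      simp only at h1 h2
      subst h1 h2
      have h3 := (m.mem_Icc p.1.1 p.1.2.castSucc).1
      have h4 := (m.mem_Icc p.1.1 p.1.2.succ).2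
      rw [hm.lo] at h3
      rw [hm.hi] at h4
      exact ⟨⟨h3.trans_lt (hz p).1.1, (hz p).1.2.trans_le h4⟩, (hz p).2⟩
    · rintro ⟨⟨hx1, hx2⟩, hx0⟩
      simp only at hx1 hx2 hx0
      have hex : ∃ i : Fin m.N, x ∈ Set.Ioo (m.t e i.castSucc) (m.t e i.succ) := by
        by_contra hcon
        push Not at hcon
        have hall : ∀ i, m.t e i < x := by
          intro i
          induction i using Fin.induction with
          | zero => rw [m.t_zero, hm.lo]; exact hx1
          | succ i ih =>
            by_contra hge
            rcases (not_lt.mp hge).eq_or_lt with heq | hlt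
            · by_cases hl : i.succ = Fin.last m.N
              · rw [hl, m.t_last, hm.hi] at heq
                exact hx2.ne heq
              · exact hnode e i.succ (Fin.succ_ne_zero i) hl (by rw [← heq]; exact hx0)
            · exact hcon i ⟨ih, hlt⟩
        have := hall (Fin.last _)
        rw [m.t_last, hm.hi] at this
        exact this.not_gt hx2
      obtain ⟨i, hi⟩ := hex
      have hneg := mul_neg_of_zero (m.sys e) (m.lo_lt_hi _) (m.pot _) hξ (m.mem_Icc _ _).1
        (m.t_lt _ _) (m.mem_Icc _ _).2 (m.short _ _) (hsol _) (hne e i) hi hx0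
      refine ⟨⟨(e, i), (hsign (e, i)).mpr hneg⟩, Prod.ext rfl ?_⟩
      exact (hzu ⟨(e, i), (hsign (e, i)).mpr hneg⟩ x ⟨hi, hx0⟩).symm
  have hinj : Function.Injective
      (fun p => ((p : {p : E × Fin m.N // pieceCoeff m ξ ψ p < 0}).1.1, z p)) := by
    rintro ⟨⟨e, i⟩, hp⟩ ⟨⟨e', i'⟩, hp'⟩ h
    obtain ⟨h1, h2⟩ := Prod.ext_iff.mp h
    simp only at h1 h2
    subst h1
    have h3 := (hz ⟨(e, i), hp⟩).1
    have h4 := (hz ⟨(e, i'), hp'⟩).1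
    rw [← h2] at h4
    have hmono := (m.strictMono e).monotone
    have key : ∀ {i j : Fin m.N} {x : ℝ}, x ∈ Set.Ioo (m.t e i.castSucc) (m.t e i.succ) →
        x ∈ Set.Ioo (m.t e j.castSucc) (m.t e j.succ) → ¬ i < j := by
      intro i j x hi hj hij
      have : m.t e i.succ ≤ m.t e j.castSucc := hmono (Fin.succ_le_castSucc_iff.mpr hij)
      exact (hi.2.trans_le this).not_gt hj.1
    have : i = i' := le_antisymm (not_lt.mp (key h4 h3)) (not_lt.mp (key h3 h4))
    subst this
    rfl
  refine ⟨hrange ▸ Set.finite_range _, ?_⟩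
  rw [← hrange, ← Set.image_univ, Set.ncard_image_of_injective _ hinj, Set.ncard_univ,
    Nat.card_eq_fintype_card]

end Tree

end QuantumGraph

/-! ### Restricting and gluing solutions. -/

section Glue

variable {Q : ℝ → ℝ} {a b c : ℝ} {f f' g g' h : ℝ → ℝ}

theorem IsSol.restrict (hf : IsSol Q a b f f') {a' b' : ℝ} (ha : a ≤ a') (hb : b' ≤ b)
    (hab : a' < b') (hg : ∀ x ∈ Set.Icc a' b', g x = f x) :
    IsSol Q a' b' g (derivWithin g (Set.Icc a' b')) ∧
      ∀ x ∈ Set.Icc a' b', derivWithin g (Set.Icc a' b') x = f' x := by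
  have h1 : IsSol Q a' b' g f' := (hf.mono ha hb).congr hg fun _ _ => rfl
  have h2 : ∀ x ∈ Set.Icc a' b', derivWithin g (Set.Icc a' b') x = f' x := fun x hx =>
    h1.toIsC1.derivWithin_eq hab hx
  exact ⟨h1.congr (fun _ _ => rfl) h2, h2⟩

theorem continuousOn_glue (hac : a ≤ c) (hcb : c ≤ b) (hf : ContinuousOn f (Set.Icc a c))
    (hg : ContinuousOn g (Set.Icc c b)) (hfg : f c = g c) :
    ContinuousOn (fun x => if x ≤ c then f x else g x) (Set.Icc a b) := by
  rw [← Set.Icc_union_Icc_eq_Icc hac hcb]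
  refine ContinuousOn.union_of_isClosed ?_ ?_ isClosed_Icc isClosed_Icc
  · exact hf.congr fun x hx => if_pos hx.2
  · refine hg.congr fun x hx => ?_
    by_cases hxc : x ≤ c
    · have : x = c := le_antisymm hxc hx.1
      rw [if_pos hxc, this, hfg]
    · exact if_neg hxc

/-- Solutions with the same Cauchy data at `c` can be glued. -/
theorem IsSol.glue (hac : a < c) (hcb : c < b) (hf : IsSol Q a c f f') (hg : IsSol Q c b g g')
    (h0 : f c = g c) (h1 : f' c = g' c) :
    IsSol Q a b (fun x => if x ≤ c then f x else g x)
      (fun x => if x ≤ c then f' x else g' x) := by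
  obtain ⟨Sf, hSf, df⟩ := hf.deriv
  obtain ⟨Sg, hSg, dg⟩ := hg.deriv
  obtain ⟨Sf', hSf', df'⟩ := hf.deriv2
  obtain ⟨Sg', hSg', dg'⟩ := hg.deriv2
  have hl : ∀ {x : ℝ} (u v : ℝ → ℝ), x < c →
      (fun x => if x ≤ c then u x else v x) =ᶠ[𝓝 x] u := fun u v hx => by
    filter_upwards [Iio_mem_nhds hx] with y hy using if_pos (le_of_lt hy)
  have hr : ∀ {x : ℝ} (u v : ℝ → ℝ), c < x →
      (fun x => if x ≤ c then u x else v x) =ᶠ[𝓝 x] v := fun u v hx => by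
    filter_upwards [Ioi_mem_nhds hx] with y hy using if_neg (not_le.mpr hy)
  refine ⟨⟨continuousOn_glue hac.le hcb.le hf.cont hg.cont h0,
    continuousOn_glue hac.le hcb.le hf.cont' hg.cont' h1, insert c (Sf ∪ Sg),
    (hSf.union hSg).insert c, ?_⟩, insert c (Sf' ∪ Sg'), (hSf'.union hSg').insert c, ?_⟩
  · rintro x ⟨hx, hxS⟩
    simp only [Set.mem_insert_iff, Set.mem_union, not_or] at hxS
    rcases lt_or_gt_of_ne hxS.1 with hxc | hxc
    · simp only [hxc.le, if_true]
      exact (df x ⟨⟨hx.1, hxc⟩, hxS.2.1⟩).congr_of_eventuallyEq (hl f g hxc)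
    · simp only [not_le.mpr hxc, if_false]
      exact (dg x ⟨⟨hxc, hx.2⟩, hxS.2.2⟩).congr_of_eventuallyEq (hr f g hxc)
  · rintro x ⟨hx, hxS⟩
    simp only [Set.mem_insert_iff, Set.mem_union, not_or] at hxS
    rcases lt_or_gt_of_ne hxS.1 with hxc | hxc
    · simp only [hxc.le, if_true]
      exact (df' x ⟨⟨hx.1, hxc⟩, hxS.2.1⟩).congr_of_eventuallyEq (hl f' g' hxc)
    · simp only [not_le.mpr hxc, if_false]
      exact (dg' x ⟨⟨hxc, hx.2⟩, hxS.2.2⟩).congr_of_eventuallyEq (hr f' g' hxc)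

end Glue

/-! ### The cut graph and its eigenfunctions. -/

namespace QuantumGraph

variable {V E : Type*} [DecidableEq V] [Fintype E] [Fintype V] [DecidableEq E]
  {G : QuantumGraph V E} {S : Finset E} {c : {e // e ∉ S} → ℝ}
  {hc : ∀ j : {e // e ∉ S}, c j ∈ Set.Ioo (G.lo j) (G.hi j)} {γ : {e // e ∉ S} → ℝ}

/-- Restriction of functions on the graph to the edges of the cut graph. -/
noncomputable def cutMap (S : Finset E) (c : {e // e ∉ S} → ℝ) :
    (E → ℝ → ℝ) →ₗ[ℝ] ({e // e ∈ S} ⊕ {e // e ∉ S} ⊕ {e // e ∉ S} → ℝ → ℝ) where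
  toFun f
    | .inl e => f e
    | .inr (.inl j) => fun x => if x ≤ c j then f j x else 0
    | .inr (.inr j) => fun x => if c j ≤ x then f j x else 0
  map_add' f g := by
    funext e x
    rcases e with e | j | j <;> simp only [Pi.add_apply] <;> split_ifs <;> simp
  map_smul' r f := by
    funext e x
    rcases e with e | j | j <;> simp only [Pi.smul_apply, RingHom.id_apply] <;> split_ifs <;> simp

theorem cutMap_inl (f : E → ℝ → ℝ) (e : {e // e ∈ S}) (x : ℝ) :
    cutMap S c f (.inl e) x = f e x := rfl

theorem cutMap_minus (f : E → ℝ → ℝ) (j : {e // e ∉ S}) (x : ℝ) :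
    cutMap S c f (.inr (.inl j)) x = if x ≤ c j then f j x else 0 := rfl

theorem cutMap_plus (f : E → ℝ → ℝ) (j : {e // e ∉ S}) (x : ℝ) :
    cutMap S c f (.inr (.inr j)) x = if c j ≤ x then f j x else 0 := rfl

theorem cutMap_injective : Function.Injective (cutMap S c) := by
  rw [← LinearMap.ker_eq_bot, LinearMap.ker_eq_bot']
  intro f hf
  funext e x
  by_cases he : e ∈ S
  · exact congrFun (congrFun hf (.inl ⟨e, he⟩)) x
  · by_cases hx : x ≤ c ⟨e, he⟩
    · have := congrFun (congrFun hf (.inr (.inl ⟨e, he⟩))) x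
      rwa [cutMap_minus, if_pos hx] at this
    · have := congrFun (congrFun hf (.inr (.inr ⟨e, he⟩))) x
      rwa [cutMap_plus, if_pos (not_le.mp hx).le] at this

/-- The vertex values on the cut graph. -/
def cutValues (c : {e // e ∉ S} → ℝ) (f : E → ℝ → ℝ) (F : V → ℝ) :
    V ⊕ {e // e ∉ S} ⊕ {e // e ∉ S} → ℝ :=
  Sum.elim F (Sum.elim (fun j => f j (c j)) (fun j => f j (c j)))

/-- The vertex values on the cut graph that agree at the two sides of each cut. -/
def matchSpace (G : QuantumGraph V E) (S : Finset E) :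
    Submodule ℝ (V ⊕ {e // e ∉ S} ⊕ {e // e ∉ S} → ℝ) where
  carrier := {F | (∀ v ∈ G.dir, F (.inl v) = 0) ∧ ∀ j, F (.inr (.inr j)) = F (.inr (.inl j))}
  add_mem' h₁ h₂ := ⟨fun v hv => by simp [h₁.1 v hv, h₂.1 v hv],
    fun j => by simp [h₁.2 j, h₂.2 j]⟩
  zero_mem' := ⟨fun _ _ => rfl, fun _ => rfl⟩
  smul_mem' r F h := ⟨fun v hv => by simp [h.1 v hv], fun j => by simp [h.2 j]⟩

theorem mem_dirSpace_cut {F : V ⊕ {e // e ∉ S} ⊕ {e // e ∉ S} → ℝ} :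
    F ∈ (G.cut S c hc γ).dirSpace ↔ ∀ v ∈ G.dir, F (.inl v) = 0 := by
  constructor
  · exact fun h v hv => h _ ⟨v, hv, rfl⟩
  · rintro h _ ⟨v, hv, rfl⟩
    exact h v hv

section Cut

variable {μ : ℝ} {f : E → ℝ → ℝ} {F : V → ℝ}

theorem isSol_cutMap
    (hf : ∀ e, IsSol (fun x => G.q e x - μ) (G.lo e) (G.hi e) (f e) (G.edgeDeriv f e)) :
    (∀ e, IsSol (fun x => (G.cut S c hc γ).q e x - μ) ((G.cut S c hc γ).lo e)
      ((G.cut S c hc γ).hi e) (cutMap S c f e) ((G.cut S c hc γ).edgeDeriv (cutMap S c f) e)) ∧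
    (∀ j : {e // e ∉ S}, ∀ x ∈ Set.Icc (G.lo j) (c j),
      (G.cut S c hc γ).edgeDeriv (cutMap S c f) (.inr (.inl j)) x = G.edgeDeriv f j x) ∧
    (∀ j : {e // e ∉ S}, ∀ x ∈ Set.Icc (c j) (G.hi j),
      (G.cut S c hc γ).edgeDeriv (cutMap S c f) (.inr (.inr j)) x = G.edgeDeriv f j x) := by
  have h1 := fun j : {e // e ∉ S} => (hf j).restrict (a' := G.lo j) (b' := c j) le_rfl
    (hc j).2.le (hc j).1 (g := cutMap S c f (.inr (.inl j))) fun x hx => by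
      rw [cutMap_minus, if_pos hx.2]
  have h2 := fun j : {e // e ∉ S} => (hf j).restrict (a' := c j) (b' := G.hi j) (hc j).1.le
    le_rfl (hc j).2 (g := cutMap S c f (.inr (.inr j))) fun x hx => by
      rw [cutMap_plus, if_pos hx.1]
  refine ⟨fun e => ?_, fun j => (h1 j).2, fun j => (h2 j).2⟩
  rcases e with e | j | j
  · exact hf e
  · exact (h1 j).1
  · exact (h2 j).1

/-- At each cut the jump of the test function is paired with `f' - γ f`. This vanishes for one of
two reasons: the test values match, which recovers the uncut graph for every `γ`, or `γ` is the
logarithmic derivative of `f`, which makes `f` an eigenfunction of the cut graph. -/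
theorem sum_flux_cutMap
    (hf : ∀ e, IsSol (fun x => G.q e x - μ) (G.lo e) (G.hi e) (f e) (G.edgeDeriv f e))
    (z : V ⊕ {e // e ∉ S} ⊕ {e // e ∉ S} → ℝ) :
    ∑ v, ((G.cut S c hc γ).flux (cutMap S c f) v -
      (G.cut S c hc γ).χ v * cutValues c f F v) * z v =
    ∑ v, (G.flux f v - G.χ v * F v) * z (.inl v) +
      ∑ j : {e // e ∉ S}, (G.edgeDeriv f j (c j) - γ j * f j (c j)) *
        (z (.inr (.inr j)) - z (.inr (.inl j))) := by
  obtain ⟨-, h2, h3⟩ := isSol_cutMap (hc := hc) (γ := γ) hf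
  have e1 : ∀ e : {e // e ∈ S}, (G.cut S c hc γ).edgeDeriv (cutMap S c f) (.inl e)
        ((G.cut S c hc γ).lo (.inl e)) * z ((G.cut S c hc γ).src (.inl e)) -
      (G.cut S c hc γ).edgeDeriv (cutMap S c f) (.inl e)
        ((G.cut S c hc γ).hi (.inl e)) * z ((G.cut S c hc γ).tgt (.inl e)) =
      G.edgeDeriv f e (G.lo e) * z (.inl (G.src e)) -
        G.edgeDeriv f e (G.hi e) * z (.inl (G.tgt e)) := fun e => rfl
  have e2 : ∀ j : {e // e ∉ S}, (G.cut S c hc γ).edgeDeriv (cutMap S c f) (.inr (.inl j))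
        ((G.cut S c hc γ).lo (.inr (.inl j))) * z ((G.cut S c hc γ).src (.inr (.inl j))) -
      (G.cut S c hc γ).edgeDeriv (cutMap S c f) (.inr (.inl j))
        ((G.cut S c hc γ).hi (.inr (.inl j))) * z ((G.cut S c hc γ).tgt (.inr (.inl j))) =
      G.edgeDeriv f j (G.lo j) * z (.inl (G.src j)) -
        G.edgeDeriv f j (c j) * z (.inr (.inl j)) := by
    intro j
    have p1 := h2 j (G.lo j) ⟨le_rfl, (hc j).1.le⟩
    have p2 := h2 j (c j) ⟨(hc j).1.le, le_rfl⟩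
    rw [← p1, ← p2]
    rfl
  have e3 : ∀ j : {e // e ∉ S}, (G.cut S c hc γ).edgeDeriv (cutMap S c f) (.inr (.inr j))
        ((G.cut S c hc γ).lo (.inr (.inr j))) * z ((G.cut S c hc γ).src (.inr (.inr j))) -
      (G.cut S c hc γ).edgeDeriv (cutMap S c f) (.inr (.inr j))
        ((G.cut S c hc γ).hi (.inr (.inr j))) * z ((G.cut S c hc γ).tgt (.inr (.inr j))) =
      G.edgeDeriv f j (c j) * z (.inr (.inr j)) -
        G.edgeDeriv f j (G.hi j) * z (.inl (G.tgt j)) := by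
    intro j
    have p1 := h3 j (c j) ⟨le_rfl, (hc j).2.le⟩
    have p2 := h3 j (G.hi j) ⟨(hc j).2.le, le_rfl⟩
    rw [← p1, ← p2]
    rfl
  simp only [sub_mul, Finset.sum_sub_distrib]
  have hG : ∀ g : E → ℝ, ∑ e : {e // e ∈ S}, g e + ∑ j : {e // e ∉ S}, g j = ∑ e, g e := by
    intro g
    convert Fintype.sum_subtype_add_sum_subtype (fun e => e ∈ S) g
  rw [sum_flux_mul, sum_flux_mul f fun v => z (.inl v), ← hG fun e =>
    G.edgeDeriv f e (G.lo e) * z (.inl (G.src e)) - G.edgeDeriv f e (G.hi e) * z (.inl (G.tgt e))]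
  simp only [Fintype.sum_sum_type, e1, e2, e3]
  have hχ1 : ∀ v, (G.cut S c hc γ).χ (.inl v) = G.χ v := fun _ => rfl
  have hχ2 : ∀ j, (G.cut S c hc γ).χ (.inr (.inl j)) = -γ j := fun _ => rfl
  have hχ3 : ∀ j, (G.cut S c hc γ).χ (.inr (.inr j)) = γ j := fun _ => rfl
  simp only [hχ1, hχ2, hχ3, cutValues, Sum.elim_inl, Sum.elim_inr, mul_sub,
    Finset.sum_sub_distrib, neg_mul, Finset.sum_neg_distrib]
  ring

theorem cutMap_zero (h0 : ∀ e, ∀ x ∉ Set.Icc (G.lo e) (G.hi e), f e x = 0) :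
    ∀ e, ∀ x ∉ Set.Icc ((G.cut S c hc γ).lo e) ((G.cut S c hc γ).hi e), cutMap S c f e x = 0 := by
  intro e x hx
  rcases e with e | j | j
  · exact h0 e x hx
  · rw [cutMap_minus]
    split_ifs with h
    · exact h0 j x fun h' => hx ⟨h'.1, h⟩
    · rfl
  · rw [cutMap_plus]
    split_ifs with h
    · exact h0 j x fun h' => hx ⟨h, h'.2⟩
    · rfl

theorem cutMap_ends (hl : ∀ e, f e (G.lo e) = F (G.src e)) (hr : ∀ e, f e (G.hi e) = F (G.tgt e)) :
    (∀ e, cutMap S c f e ((G.cut S c hc γ).lo e) = cutValues c f F ((G.cut S c hc γ).src e)) ∧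
    (∀ e, cutMap S c f e ((G.cut S c hc γ).hi e) = cutValues c f F ((G.cut S c hc γ).tgt e)) := by
  constructor
  · rintro (e | j | j)
    · exact hl e
    · exact (if_pos (hc j).1.le).trans (hl j)
    · exact if_pos le_rfl
  · rintro (e | j | j)
    · exact hr e
    · exact if_pos le_rfl
    · exact (if_pos (hc j).2.le).trans (hr j)

/-- An eigenfunction of `G` is one of the cut graph with matching conditions. -/
theorem IsEigen.cutMap (hf : G.IsEigen G.dirSpace μ f F) :
    (G.cut S c hc γ).IsEigen (G.matchSpace S) μ (cutMap S c f) (cutValues c f F) := by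
  obtain ⟨h1, h2⟩ := cutMap_ends (hc := hc) (γ := γ) hf.left hf.right
  refine ⟨cutMap_zero hf.zero, (isSol_cutMap hf.sol).1, h1, h2, ⟨hf.mem, fun j => rfl⟩,
    fun z hz => ?_⟩
  rw [sum_flux_cutMap hf.sol, hf.balance (fun v => z (.inl v)) hz.1]
  simp [hz.2]

/-- An eigenfunction of `G` is one of the cut graph if `γ` is its logarithmic derivative. -/
theorem IsEigen.cutMap_of_eq (hf : G.IsEigen G.dirSpace μ f F)
    (hγ : ∀ j : {e // e ∉ S}, G.edgeDeriv f j (c j) = γ j * f j (c j)) :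
    (G.cut S c hc γ).IsEigen (G.cut S c hc γ).dirSpace μ (QuantumGraph.cutMap S c f)
      (cutValues c f F) := by
  obtain ⟨h1, h2⟩ := cutMap_ends (hc := hc) (γ := γ) hf.left hf.right
  refine ⟨cutMap_zero hf.zero, (isSol_cutMap hf.sol).1, h1, h2, mem_dirSpace_cut.mpr hf.mem,
    fun z hz => ?_⟩
  rw [sum_flux_cutMap hf.sol, hf.balance (fun v => z (.inl v)) (mem_dirSpace_cut.mp hz)]
  simp [hγ]

/-- Matching values give continuity at the cuts and the balance condition gives continuity of the
derivative, so the two halves of a cut edge glue to a solution. -/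
theorem exists_cutMap_eq {g : {e // e ∈ S} ⊕ {e // e ∉ S} ⊕ {e // e ∉ S} → ℝ → ℝ}
    {F : V ⊕ {e // e ∉ S} ⊕ {e // e ∉ S} → ℝ}
    (hg : (G.cut S c hc γ).IsEigen (G.matchSpace S) μ g F) :
    ∃ f, G.IsEigen G.dirSpace μ f (fun v => F (.inl v)) ∧ QuantumGraph.cutMap S c f = g := by
  let f : E → ℝ → ℝ := fun e x => if he : e ∈ S then g (.inl ⟨e, he⟩) x else
    if x ≤ c ⟨e, he⟩ then g (.inr (.inl ⟨e, he⟩)) x else g (.inr (.inr ⟨e, he⟩)) x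
  have hfS : ∀ e : {e // e ∈ S}, f e = g (.inl e) := fun e => by
    funext x; simp [f]
  have hfJ : ∀ j : {e // e ∉ S}, f j =
      fun x => if x ≤ c j then g (.inr (.inl j)) x else g (.inr (.inr j)) x := fun j => by
    funext x; simp [f, j.2]
  have hr : ∀ j : {e // e ∉ S}, g (.inr (.inl j)) (c j) = F (.inr (.inl j)) :=
    fun j => hg.right (.inr (.inl j))
  have hl : ∀ j : {e // e ∉ S}, g (.inr (.inr j)) (c j) = F (.inr (.inr j)) :=
    fun j => hg.left (.inr (.inr j))
  have hm := hg.mem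
  have hval : ∀ j : {e // e ∉ S}, g (.inr (.inl j)) (c j) = g (.inr (.inr j)) (c j) :=
    fun j => by rw [hr, hl, hm.2 j]
  have hder : ∀ j : {e // e ∉ S}, (G.cut S c hc γ).edgeDeriv g (.inr (.inl j)) (c j) =
      (G.cut S c hc γ).edgeDeriv g (.inr (.inr j)) (c j) := by
    intro j
    -- The test function is 1 on both sides of the `j`-th cut. The terms `γ j` and `-γ j` cancel
    -- because the values of `g` agree.
    have hb := hg.balance (Pi.single (.inr (.inl j)) 1 + Pi.single (.inr (.inr j)) 1)
      ⟨fun v _ => by simp, fun i => by simp [Pi.single_apply]⟩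
    simp only [sub_mul, Finset.sum_sub_distrib] at hb
    rw [sum_flux_mul] at hb
    have hs1 : ∀ e, (G.cut S c hc γ).src (.inl e) = .inl (G.src e) := fun _ => rfl
    have hs2 : ∀ j, (G.cut S c hc γ).src (.inr (.inl j)) = .inl (G.src j) := fun _ => rfl
    have hs3 : ∀ j, (G.cut S c hc γ).src (.inr (.inr j)) = .inr (.inr j) := fun _ => rfl
    have ht1 : ∀ e, (G.cut S c hc γ).tgt (.inl e) = .inl (G.tgt e) := fun _ => rfl
    have ht2 : ∀ j, (G.cut S c hc γ).tgt (.inr (.inl j)) = .inr (.inl j) := fun _ => rfl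
    have ht3 : ∀ j, (G.cut S c hc γ).tgt (.inr (.inr j)) = .inl (G.tgt j) := fun _ => rfl
    have hχ1 : ∀ v, (G.cut S c hc γ).χ (.inl v) = G.χ v := fun _ => rfl
    have hχ2 : ∀ j, (G.cut S c hc γ).χ (.inr (.inl j)) = -γ j := fun _ => rfl
    have hχ3 : ∀ j, (G.cut S c hc γ).χ (.inr (.inr j)) = γ j := fun _ => rfl
    simp only [Fintype.sum_sum_type, hs1, hs2, hs3, ht1, ht2, ht3, hχ1, hχ2, hχ3, Pi.add_apply,
      Pi.single_apply, reduceCtorEq, if_false, Sum.inr.injEq, Sum.inl.injEq, add_zero, zero_add,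
      mul_zero, mul_ite, mul_one, Finset.sum_sub_distrib, Finset.sum_const_zero,
      Finset.sum_ite_eq', Finset.mem_univ, if_true] at hb
    rw [hm.2 j] at hb
    have hb' : (G.cut S c hc γ).edgeDeriv g (.inr (.inr j)) (c j) -
      (G.cut S c hc γ).edgeDeriv g (.inr (.inl j)) (c j) -
        (-γ j * F (.inr (.inl j)) + γ j * F (.inr (.inl j))) = 0 := hb
    linarith
  have hsol : ∀ e, ∃ f', IsSol (fun x => G.q e x - μ) (G.lo e) (G.hi e) (f e) f' := by
    intro e
    by_cases he : e ∈ S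
    · rw [hfS ⟨e, he⟩]
      exact ⟨_, hg.sol (.inl ⟨e, he⟩)⟩
    · rw [hfJ ⟨e, he⟩]
      exact ⟨_, IsSol.glue (hc ⟨e, he⟩).1 (hc ⟨e, he⟩).2 (hg.sol (.inr (.inl ⟨e, he⟩)))
        (hg.sol (.inr (.inr ⟨e, he⟩))) (hval _) (hder _)⟩
  have hsol' : ∀ e, IsSol (fun x => G.q e x - μ) (G.lo e) (G.hi e) (f e) (G.edgeDeriv f e) := by
    intro e
    obtain ⟨f', hf'⟩ := hsol e
    exact hf'.congr (fun _ _ => rfl) fun x hx => hf'.toIsC1.derivWithin_eq (G.lo_lt_hi e) hx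
  have hmap : QuantumGraph.cutMap S c f = g := by
    funext e x
    rcases e with e | j | j
    · rw [cutMap_inl, hfS]
    · rw [cutMap_minus, hfJ]
      by_cases hx : x ≤ c j
      · simp [hx]
      · rw [if_neg hx]
        exact (hg.zero (.inr (.inl j)) x fun h => hx h.2).symm
    · rw [cutMap_plus, hfJ]
      by_cases hx : c j ≤ x
      · rw [if_pos hx]
        rcases hx.eq_or_lt with h | h
        · simp only [← h, le_refl, if_true, hval]
        · simp [not_le.mpr h]
      · rw [if_neg hx]
        exact (hg.zero (.inr (.inr j)) x fun h => hx h.1).symm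
  have hFval : cutValues c f (fun v => F (.inl v)) = F := by
    funext v
    rcases v with v | j | j
    · rfl
    · simp only [cutValues, Sum.elim_inr, Sum.elim_inl, hfJ, le_refl, if_true, hr]
    · simp only [cutValues, Sum.elim_inr, hfJ, le_refl, if_true, hr, hm.2 j]
  refine ⟨f, ⟨fun e x hx => ?_, hsol', fun e => ?_, fun e => ?_, hm.1, fun z hz => ?_⟩, hmap⟩
  · by_cases he : e ∈ S
    · rw [hfS ⟨e, he⟩]
      exact hg.zero (.inl ⟨e, he⟩) x hx
    · rw [hfJ ⟨e, he⟩]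
      have hcI := hc ⟨e, he⟩
      by_cases hxc : x ≤ c ⟨e, he⟩
      · simp only [if_pos hxc]
        exact hg.zero (.inr (.inl ⟨e, he⟩)) x fun h => hx ⟨h.1, hxc.trans hcI.2.le⟩
      · simp only [if_neg hxc]
        exact hg.zero (.inr (.inr ⟨e, he⟩)) x fun h => hx ⟨hcI.1.le.trans (not_le.mp hxc).le, h.2⟩
  · by_cases he : e ∈ S
    · rw [hfS ⟨e, he⟩]
      exact hg.left (.inl ⟨e, he⟩)
    · rw [hfJ ⟨e, he⟩]
      simp only [if_pos (hc ⟨e, he⟩).1.le]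
      exact hg.left (.inr (.inl ⟨e, he⟩))
  · by_cases he : e ∈ S
    · rw [hfS ⟨e, he⟩]
      exact hg.right (.inl ⟨e, he⟩)
    · rw [hfJ ⟨e, he⟩]
      simp only [if_neg (not_le.mpr (hc ⟨e, he⟩).2)]
      exact hg.right (.inr (.inr ⟨e, he⟩))
  · have hb := hg.balance (Sum.elim z 0) ⟨fun v hv => hz v hv, fun _ => rfl⟩
    rw [← hmap, ← hFval, sum_flux_cutMap hsol'] at hb
    simpa using hb

theorem mem_map_cutMap_iff {g : {e // e ∈ S} ⊕ {e // e ∉ S} ⊕ {e // e ∉ S} → ℝ → ℝ} :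
    g ∈ (G.eigenspace ℝ μ).map (QuantumGraph.cutMap S c) ↔
      ∃ F, (G.cut S c hc γ).IsEigen (G.matchSpace S) μ g F := by
  constructor
  · rintro ⟨f, hf, rfl⟩
    obtain ⟨F, hF⟩ := G.mem_eigenspace_iff.mp hf
    exact ⟨_, hF.cutMap⟩
  · rintro ⟨F, hF⟩
    obtain ⟨f, hf, hfg⟩ := exists_cutMap_eq hF
    exact ⟨f, G.mem_eigenspace_iff.mpr ⟨_, hf⟩, hfg⟩

/-- The edge of the graph that contains an edge of the cut graph. -/
def cutEdge : {e // e ∈ S} ⊕ {e // e ∉ S} ⊕ {e // e ∉ S} → E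
  | .inl e => e
  | .inr (.inl j) => j
  | .inr (.inr j) => j

/-- No zero is lost at a cut, since `f` is non-zero there, and none is counted on both halves of an
edge. -/
theorem internalZeros_cut (h0 : ∀ j : {e // e ∉ S}, f j (c j) ≠ 0) :
    (fun p => (cutEdge p.1, p.2)) '' (G.cut S c hc γ).internalZeros (QuantumGraph.cutMap S c f) =
      G.internalZeros f ∧
    Set.InjOn (fun p : ({e // e ∈ S} ⊕ {e // e ∉ S} ⊕ {e // e ∉ S}) × ℝ => (cutEdge p.1, p.2))
      ((G.cut S c hc γ).internalZeros (QuantumGraph.cutMap S c f)) := by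
  constructor
  · ext ⟨e, x⟩
    constructor
    · rintro ⟨⟨e', y⟩, ⟨hy, hz⟩, h⟩
      obtain ⟨h1, h2⟩ := Prod.ext_iff.mp h
      simp only at h1 h2 hy hz
      subst h1 h2
      rcases e' with e | j | j
      · exact ⟨hy, hz⟩
      · have hy' : y ∈ Set.Ioo (G.lo j) (c j) := hy
        rw [cutMap_minus, if_pos hy'.2.le] at hz
        exact ⟨⟨hy'.1, hy'.2.trans (hc j).2⟩, hz⟩
      · have hy' : y ∈ Set.Ioo (c j) (G.hi j) := hy
        rw [cutMap_plus, if_pos hy'.1.le] at hz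
        exact ⟨⟨(hc j).1.trans hy'.1, hy'.2⟩, hz⟩
    · rintro ⟨hx, hz⟩
      simp only at hx hz
      by_cases he : e ∈ S
      · exact ⟨(.inl ⟨e, he⟩, x), ⟨hx, hz⟩, rfl⟩
      · rcases lt_trichotomy x (c ⟨e, he⟩) with h | h | h
        · refine ⟨(.inr (.inl ⟨e, he⟩), x), ⟨⟨hx.1, h⟩, ?_⟩, rfl⟩
          rw [cutMap_minus, if_pos h.le]
          exact hz
        · exact absurd (h ▸ hz) (h0 ⟨e, he⟩)
        · refine ⟨(.inr (.inr ⟨e, he⟩), x), ⟨⟨h, hx.2⟩, ?_⟩, rfl⟩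
          rw [cutMap_plus, if_pos h.le]
          exact hz
  · rintro ⟨e, x⟩ ⟨hx, -⟩ ⟨e', y⟩ ⟨hy, -⟩ h
    obtain ⟨h1, h2⟩ := Prod.ext_iff.mp h
    simp only at h1 h2 hx hy
    subst h2
    rcases e with e | j | j <;> rcases e' with e' | j' | j'
    · rw [Subtype.ext (show (e : E) = e' from h1)]
    · exact absurd e.2 (by rw [show (e : E) = j' from h1]; exact j'.2)
    · exact absurd e.2 (by rw [show (e : E) = j' from h1]; exact j'.2)
    · exact absurd e'.2 (by rw [← show (j : E) = e' from h1]; exact j.2)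
    · rw [Subtype.ext (show (j : E) = j' from h1)]
    · have hj : j = j' := Subtype.ext h1
      subst hj
      have h3 : x < c j := hx.2
      have h4 : c j < x := hy.1
      exact absurd h3 h4.not_gt
    · exact absurd e'.2 (by rw [← show (j : E) = e' from h1]; exact j.2)
    · have hj : j = j' := Subtype.ext h1
      subst hj
      have h3 : x < c j := hy.2
      have h4 : c j < x := hx.1
      exact absurd h3 h4.not_gt
    · rw [Subtype.ext (show (j : E) = j' from h1)]

end Cut

/-! ### Spanning trees and vertex potentials. -/

section SpanningTree

/-- Removing `e` separates its ends; `θ` is the indicator of the vertices no longer joined to the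
source of `e`. -/
theorem IsSpanningTree.exists_potential (hS : G.IsSpanningTree S) {e : E} (he : e ∈ S) :
    ∃ θ : V → ℝ, ∀ e' ∈ S, θ (G.tgt e') - θ (G.src e') = if e' = e then 1 else 0 := by
  classical
  refine ⟨fun v => if G.Joined (↑S \ {e}) (G.src e) v then 0 else 1, fun e' he' => ?_⟩
  by_cases h : e' = e
  · subst h
    have h1 : G.Joined (↑S \ {e'}) (G.src e') (G.src e') := Relation.EqvGen.refl _
    simp [h1, hS.2 e' he]
  · have h1 : G.Joined (↑S \ {e}) (G.src e') (G.tgt e') :=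
      Relation.EqvGen.rel _ _ ⟨e', ⟨he', h⟩, rfl, rfl⟩
    have h2 : G.Joined (↑S \ {e}) (G.src e) (G.src e') ↔ G.Joined (↑S \ {e}) (G.src e) (G.tgt e') :=
      ⟨fun h' => h'.trans _ _ _ h1, fun h' => h'.trans _ _ _ (h1.symm _ _)⟩
    simp [h2, h]

theorem eq_of_joined {α : Type*} {θ : V → α} {A : Set E} (hθ : ∀ e ∈ A, θ (G.src e) = θ (G.tgt e))
    {v w : V} (h : G.Joined A v w) : θ v = θ w := by
  induction h with
  | rel u v h =>
    obtain ⟨e, he, rfl, rfl⟩ := h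
    exact hθ e he
  | refl u => rfl
  | symm u v _ ih => exact ih.symm
  | trans u v w _ _ ih₁ ih₂ => exact ih₁.trans ih₂

/-- Rank–nullity for the coboundary map: it is surjective because the tree has no cycles, and its
kernel is the constants because the tree is connected. -/
theorem IsSpanningTree.card (hS : G.IsSpanningTree S) [Nonempty V] :
    S.card + 1 = Fintype.card V := by
  let d : (V → ℝ) →ₗ[ℝ] (S → ℝ) :=
    { toFun := fun θ e => θ (G.tgt e) - θ (G.src e)
      map_add' := fun θ η => by funext e; simp; ring
      map_smul' := fun r θ => by funext e; simp [mul_sub] }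
  have hsurj : LinearMap.range d = ⊤ := by
    rw [LinearMap.range_eq_top]
    choose θ hθ using fun e : S => hS.exists_potential e.2
    intro a
    refine ⟨∑ e, a e • θ e, ?_⟩
    rw [map_sum]
    funext e'
    rw [Finset.sum_apply, Finset.sum_eq_single e']
    · simp [d, hθ e' e' e'.2]
    · intro e _ he
      have : (e' : E) ≠ e := fun h => he (Subtype.ext h.symm)
      simp [d, hθ e e' e'.2, this]
    · simp
  have hker : LinearMap.ker d = Submodule.span ℝ {fun _ : V => (1 : ℝ)} := by
    ext θ
    rw [LinearMap.mem_ker, Submodule.mem_span_singleton]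
    constructor
    · intro h
      obtain ⟨v₀⟩ := ‹Nonempty V›
      refine ⟨θ v₀, funext fun v => ?_⟩
      have := eq_of_joined (G := G) (θ := θ) (A := S) (fun e he => by
        have := congrFun h ⟨e, he⟩
        simp only [d, LinearMap.coe_mk, AddHom.coe_mk, Pi.zero_apply] at this
        linarith) (hS.1 v₀ v)
      simp [this]
    · rintro ⟨a, rfl⟩
      funext e
      simp [d]
  have h1 := LinearMap.finrank_range_add_finrank_ker d
  rw [hsurj, hker, finrank_top, finrank_span_singleton, Module.finrank_fintype_fun_eq_card,
    Module.finrank_fintype_fun_eq_card, Fintype.card_coe] at h1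
  · exact h1
  · intro h
    obtain ⟨v₀⟩ := ‹Nonempty V›
    exact one_ne_zero (congrFun h v₀)

theorem IsSpanningTree.betti_eq (hS : G.IsSpanningTree S) [Nonempty V] :
    G.betti = Fintype.card {e // e ∉ S} := by
  have h1 := hS.card
  have h2 : Fintype.card {e // e ∉ S} + S.card = Fintype.card E := by
    have := Fintype.card_subtype_compl (fun e => e ∈ S)
    rw [Fintype.card_coe] at this
    have h3 := Finset.card_le_univ S
    omega
  rw [betti]
  omega

theorem IsSpanningTree.covers (hS : G.IsSpanningTree S) [Nonempty E] (v : V) :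
    ∃ e, G.src e = v ∨ G.tgt e = v := by
  by_contra hcon
  push Not at hcon
  obtain ⟨e₀⟩ := ‹Nonempty E›
  have := eq_of_joined (G := G) (θ := fun w => w = v) (A := S) (fun e _ => by
    simp [(hcon e).1, (hcon e).2]) (hS.1 v (G.src e₀))
  simp [(hcon e₀).1] at this

theorem covers_cut (hcov : ∀ v, ∃ e, G.src e = v ∨ G.tgt e = v)
    (v : V ⊕ {e // e ∉ S} ⊕ {e // e ∉ S}) :
    ∃ e, (G.cut S c hc γ).src e = v ∨ (G.cut S c hc γ).tgt e = v := by
  rcases v with v | j | j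
  · obtain ⟨e, he⟩ := hcov v
    by_cases heS : e ∈ S
    · exact ⟨.inl ⟨e, heS⟩, he.imp (congrArg Sum.inl) (congrArg Sum.inl)⟩
    · rcases he with he | he
      · exact ⟨.inr (.inl ⟨e, heS⟩), Or.inl (congrArg Sum.inl he)⟩
      · exact ⟨.inr (.inr ⟨e, heS⟩), Or.inr (congrArg Sum.inl he)⟩
  · exact ⟨.inr (.inl j), Or.inr rfl⟩
  · exact ⟨.inr (.inr j), Or.inl rfl⟩

/-- For an edge of the tree, continue its potential constantly along the half-edges. For a
half-edge, use the indicator of its new vertex, with a sign on the side where that vertex is the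
source. -/
theorem IsSpanningTree.exists_potential_cut (hS : G.IsSpanningTree S)
    (e : {e // e ∈ S} ⊕ {e // e ∉ S} ⊕ {e // e ∉ S}) :
    ∃ θ : V ⊕ {e // e ∉ S} ⊕ {e // e ∉ S} → ℝ, ∀ e',
      θ ((G.cut S c hc γ).tgt e') - θ ((G.cut S c hc γ).src e') = if e' = e then 1 else 0 := by
  rcases e with e | j | j
  · obtain ⟨θ, hθ⟩ := hS.exists_potential e.2
    refine ⟨Sum.elim θ (Sum.elim (fun j => θ (G.src j)) fun j => θ (G.tgt j)), ?_⟩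
    rintro (e' | j | j)
    · change θ (G.tgt e') - θ (G.src e') = _
      rw [hθ e' e'.2]
      rcases eq_or_ne e' e with rfl | h
      · simp
      · rw [if_neg fun h' => h (Subtype.ext h'), if_neg fun h' => h (Sum.inl_injective h')]
    · change θ (G.src j) - θ (G.src j) = _
      simp
    · change θ (G.tgt j) - θ (G.tgt j) = _
      simp
  · refine ⟨Sum.elim 0 (Sum.elim (Pi.single j 1) 0), ?_⟩
    rintro (e' | i | i)
    · change (0 : ℝ) - 0 = _
      simp
    · change (Pi.single j 1 : {e // e ∉ S} → ℝ) i - 0 = _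
      simp [Pi.single_apply]
    · change (0 : ℝ) - 0 = _
      simp
  · refine ⟨Sum.elim 0 (Sum.elim 0 (-Pi.single j 1)), ?_⟩
    rintro (e' | i | i)
    · change (0 : ℝ) - 0 = _
      simp
    · change (0 : ℝ) - 0 = _
      simp
    · change 0 - (-Pi.single j 1 : {e // e ∉ S} → ℝ) i = _
      simp [Pi.single_apply]

theorem IsSpanningTree.constant_cut (hS : G.IsSpanningTree S)
    (θ : V ⊕ {e // e ∉ S} ⊕ {e // e ∉ S} → ℝ)
    (hθ : ∀ e, θ ((G.cut S c hc γ).src e) = θ ((G.cut S c hc γ).tgt e))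
    (v w : V ⊕ {e // e ∉ S} ⊕ {e // e ∉ S}) : θ v = θ w := by
  have h1 : ∀ v w, θ (.inl v) = θ (.inl w) := fun v w =>
    eq_of_joined (G := G) (θ := fun v => θ (.inl v)) (A := S) (fun e he => hθ (.inl ⟨e, he⟩))
      (hS.1 v w)
  have h2 : ∀ v, ∃ u, θ v = θ (.inl u) := by
    rintro (v | j | j)
    · exact ⟨v, rfl⟩
    · exact ⟨_, (hθ (.inr (.inl j))).symm⟩
    · exact ⟨_, hθ (.inr (.inr j))⟩
  obtain ⟨a, ha⟩ := h2 v
  obtain ⟨b, hb⟩ := h2 w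
  rw [ha, hb, h1 a b]

/-- An eigenfunction that does not vanish at the vertices does not vanish on a whole edge. -/
theorem IsSpanningTree.exists_ne_zero (hS : G.IsSpanningTree S) {μ : ℝ} {f : E → ℝ → ℝ}
    {F : V → ℝ} (hf : G.IsEigen G.dirSpace μ f F) (hf0 : f ≠ 0) (hV : G.NonzeroOnVertices f)
    (e : E) : ∃ x ∈ Set.Icc (G.lo e) (G.hi e), f e x ≠ 0 := by
  by_contra hcon
  push Not at hcon
  have hab := (G.lo_lt_hi e).le
  have hs : G.src e ∈ G.dir := by
    by_contra h
    exact (hV e).1 h (hcon _ ⟨le_rfl, hab⟩)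
  have ht : G.tgt e ∈ G.dir := by
    by_contra h
    exact (hV e).2 h (hcon _ ⟨hab, le_rfl⟩)
  -- Both ends of `e` have degree one, so the set of these ends is closed under adjacency. By
  -- connectedness it contains all vertices, and `e` is the only edge.
  have hall : ∀ e', e' = e := by
    intro e'
    have h1 := eq_of_joined (G := G) (θ := fun v => v = G.src e ∨ v = G.tgt e) (A := S)
      (fun e'' _ => by
        have key : ∀ v, (G.src e'' = v ∨ G.tgt e'' = v) → (v = G.src e ∨ v = G.tgt e) →
            e'' = e := by
          rintro v hv (rfl | rfl)
          · exact dir_unique hs hv (Or.inl rfl)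
          · exact dir_unique ht hv (Or.inr rfl)
        apply propext
        constructor
        · intro h
          rw [key _ (Or.inl rfl) h]
          exact Or.inr rfl
        · intro h
          rw [key _ (Or.inr rfl) h]
          exact Or.inl rfl) (hS.1 (G.src e) (G.src e'))
    have h2 : G.src e' = G.src e ∨ G.src e' = G.tgt e := by
      have : (G.src e = G.src e ∨ G.src e = G.tgt e) := Or.inl rfl
      exact h1 ▸ this
    rcases h2 with h2 | h2
    · exact dir_unique hs (Or.inl h2) (Or.inl rfl)
    · exact dir_unique ht (Or.inl h2) (Or.inr rfl)
  refine hf0 (funext fun e' => funext fun x => ?_)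
  rw [hall e']
  by_cases hx : x ∈ Set.Icc (G.lo e) (G.hi e)
  · exact hcon x hx
  · exact hf.zero e x hx

end SpanningTree

end QuantumGraph

/-! ### Real and complex eigenspaces. -/

section Complexify

variable {ι κ : Type*}

/-- The functions whose real and imaginary parts belong to `A`. -/
def Submodule.complexify (A : Submodule ℝ (ι → κ → ℝ)) : Submodule ℂ (ι → κ → ℂ) where
  carrier := {f | (fun i x => (f i x).re) ∈ A ∧ (fun i x => (f i x).im) ∈ A}
  add_mem' h₁ h₂ := ⟨A.add_mem h₁.1 h₂.1, A.add_mem h₁.2 h₂.2⟩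
  zero_mem' := ⟨A.zero_mem, A.zero_mem⟩
  smul_mem' z f h := by
    constructor
    · convert A.sub_mem (A.smul_mem z.re h.1) (A.smul_mem z.im h.2) using 1
      funext i x
      simp
    · convert A.add_mem (A.smul_mem z.re h.2) (A.smul_mem z.im h.1) using 1
      funext i x
      simp

/-- Real and imaginary part. -/
def Submodule.complexifyEquiv (A : Submodule ℝ (ι → κ → ℝ)) : A.complexify ≃ₗ[ℝ] A × A where
  toFun f := (⟨_, f.2.1⟩, ⟨_, f.2.2⟩)
  map_add' f g := rfl
  map_smul' r f := by
    refine Prod.ext (Subtype.ext ?_) (Subtype.ext ?_) <;> funext i x <;> simp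
  invFun p := ⟨fun i x => ⟨p.1.1 i x, p.2.1 i x⟩, p.1.2, p.2.2⟩
  left_inv f := rfl
  right_inv p := rfl

theorem Submodule.finite_complexify (A : Submodule ℝ (ι → κ → ℝ)) [Module.Finite ℝ A] :
    Module.Finite ℂ A.complexify := by
  have : Module.Finite ℝ A.complexify := Module.Finite.equiv A.complexifyEquiv.symm
  exact Module.Finite.of_restrictScalars_finite ℝ ℂ _

theorem Submodule.finrank_complexify (A : Submodule ℝ (ι → κ → ℝ)) [Module.Finite ℝ A] :
    Module.finrank ℂ A.complexify = Module.finrank ℝ A := by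
  have h1 := A.complexifyEquiv.finrank_eq
  rw [Module.finrank_prod, ← Module.finrank_mul_finrank ℝ ℂ A.complexify,
    Complex.finrank_real_complex] at h1
  omega

end Complexify

namespace QuantumGraph

variable {V E : Type*} [DecidableEq V] [Fintype E] {G : QuantumGraph V E}

theorem _root_.HasSobolevSecondDeriv.map {𝕜 𝕜' : Type*} [RCLike 𝕜] [RCLike 𝕜'] (T : 𝕜 →L[ℝ] 𝕜')
    {a b : ℝ} (hab : a < b) {f g : ℝ → 𝕜} (h : HasSobolevSecondDeriv a b f g) :
    HasSobolevSecondDeriv a b (fun x => T (f x)) (fun x => T (g x)) ∧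
      ∀ x ∈ Set.Icc a b, derivWithin (fun x => T (f x)) (Set.Icc a b) x =
        T (derivWithin f (Set.Icc a b) x) := by
  have hd : ∀ x ∈ Set.Icc a b, HasDerivWithinAt (fun x => T (f x))
      (T (derivWithin f (Set.Icc a b) x)) (Set.Icc a b) x := fun x hx =>
    T.hasFDerivAt.comp_hasDerivWithinAt x (h.differentiableOn x hx).hasDerivWithinAt
  have hd' : ∀ x ∈ Set.Icc a b, derivWithin (fun x => T (f x)) (Set.Icc a b) x =
      T (derivWithin f (Set.Icc a b) x) := fun x hx =>
    (hd x hx).derivWithin (uniqueDiffOn_Icc hab x hx)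
  refine ⟨⟨fun x hx => by rw [h.eq_zero x hx, map_zero],
    fun x hx => (hd x hx).differentiableWithinAt, T.comp_memLp' h.memLp, fun x hx => ?_⟩, hd'⟩
  have hgi : IntegrableOn g (Set.Icc a b) := h.memLp.integrable (by norm_num)
  have hg : IntervalIntegrable g volume a x := by
    rw [intervalIntegrable_iff_integrableOn_Ioc_of_le hx.1]
    exact hgi.mono_set fun y hy => ⟨hy.1.le, hy.2.trans hx.2⟩
  rw [hd' x hx, hd' a ⟨le_rfl, hab.le⟩, h.deriv_eq x hx, map_add,
    T.intervalIntegral_comp_comm hg]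

theorem eigenspace_map {𝕜 𝕜' : Type*} [RCLike 𝕜] [RCLike 𝕜'] (T : 𝕜 →L[ℝ] 𝕜') {μ : ℝ}
    {f : E → ℝ → 𝕜} (h : f ∈ G.eigenspace 𝕜 μ) :
    (fun e x => T (f e x)) ∈ G.eigenspace 𝕜' μ := by
  have hT : ∀ (r : ℝ) (z : 𝕜), T ((r : 𝕜) * z) = (r : 𝕜') * T z := fun r z => by
    rw [← RCLike.real_smul_eq_coe_mul, map_smul, RCLike.real_smul_eq_coe_mul]
  obtain ⟨g, h1, ⟨F, h2, h3, h4, h5⟩, h6⟩ := h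
  have hm := fun e => (h1 e).map T (G.lo_lt_hi e)
  have hl : ∀ e, G.lo e ∈ Set.Icc (G.lo e) (G.hi e) := fun e => ⟨le_rfl, (G.lo_lt_hi e).le⟩
  have hr : ∀ e, G.hi e ∈ Set.Icc (G.lo e) (G.hi e) := fun e => ⟨(G.lo_lt_hi e).le, le_rfl⟩
  refine ⟨fun e x => T (g e x), fun e => (hm e).1, ⟨fun v => T (F v), fun e => congrArg T (h2 e),
    fun e => congrArg T (h3 e), fun v hv => ?_,
    fun v hv => (congrArg T (h5 v hv)).trans (map_zero T)⟩, fun e => ?_⟩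
  · rw [← hT, ← h4 v hv, flux, flux, map_sum]
    refine Finset.sum_congr rfl fun e _ => ?_
    have e1 : G.edgeDeriv (fun e x => T (f e x)) e (G.lo e) = T (G.edgeDeriv f e (G.lo e)) :=
      (hm e).2 _ (hl e)
    have e2 : G.edgeDeriv (fun e x => T (f e x)) e (G.hi e) = T (G.edgeDeriv f e (G.hi e)) :=
      (hm e).2 _ (hr e)
    rw [e1, e2, map_add]
    split_ifs <;> simp
  · filter_upwards [h6 e] with x hx
    simp only [Pi.smul_apply, smul_eq_mul] at hx ⊢
    rw [← hT, hx, map_add, map_neg, hT]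

/-- The operator has real coefficients, so real and imaginary parts of eigenfunctions are
eigenfunctions for the same eigenvalue. -/
theorem iSup_eigenspace_complex (s : Set ℝ) :
    ⨆ μ ∈ s, G.eigenspace ℂ μ = (⨆ μ ∈ s, G.eigenspace ℝ μ).complexify := by
  apply le_antisymm
  · refine iSup₂_le fun μ hμ f hf => ?_
    have hle : G.eigenspace ℝ μ ≤ ⨆ μ ∈ s, G.eigenspace ℝ μ :=
      le_biSup (G.eigenspace ℝ) hμ
    exact ⟨hle (eigenspace_map Complex.reCLM hf), hle (eigenspace_map Complex.imCLM hf)⟩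
  · let ofR : (E → ℝ → ℝ) →ₗ[ℝ] (E → ℝ → ℂ) :=
      { toFun := fun f e x => (f e x : ℂ)
        map_add' := fun f g => by funext e x; simp
        map_smul' := fun r f => by funext e x; simp }
    have h1 : (⨆ μ ∈ s, G.eigenspace ℝ μ) ≤
        ((⨆ μ ∈ s, G.eigenspace ℂ μ).restrictScalars ℝ).comap ofR := by
      refine iSup₂_le fun μ hμ f hf => ?_
      exact le_biSup (G.eigenspace ℂ) hμ (eigenspace_map Complex.ofRealCLM hf)
    rintro f ⟨hre, him⟩
    have h2 : f = ofR (fun e x => (f e x).re) + Complex.I • ofR (fun e x => (f e x).im) := by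
      funext e x
      change f e x = ((f e x).re : ℂ) + Complex.I * ((f e x).im : ℂ)
      rw [mul_comm]
      exact (Complex.re_add_im _).symm
    rw [h2]
    exact add_mem (h1 hre) (Submodule.smul_mem _ _ (h1 him))

theorem eigenvalueCount_complex (s : Set ℝ) [Module.Finite ℝ ↥(⨆ μ ∈ s, G.eigenspace ℝ μ)] :
    G.eigenvalueCount ℂ s = Module.finrank ℝ ↥(⨆ μ ∈ s, G.eigenspace ℝ μ) := by
  have := Submodule.finite_complexify (⨆ μ ∈ s, G.eigenspace ℝ μ)
  rw [eigenvalueCount, iSup_eigenspace_complex, ← Module.finrank_eq_rank,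
    Submodule.finrank_complexify, map_natCast]

theorem finrank_eigenspace_complex (μ : ℝ) [Module.Finite ℝ (G.eigenspace ℝ μ)] :
    Module.finrank ℂ (G.eigenspace ℂ μ) = Module.finrank ℝ (G.eigenspace ℝ μ) := by
  have h := iSup_eigenspace_complex (G := G) {μ}
  simp only [Set.mem_singleton_iff, iSup_iSup_eq_left] at h
  rw [h, Submodule.finrank_complexify]

end QuantumGraph

/-! ### Transport of indices, and the zero set of a solution. -/

section Transport

variable {Y Z : Type*} [NormedAddCommGroup Y] [NormedSpace ℝ Y] [FiniteDimensional ℝ Y]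
  [NormedAddCommGroup Z] [NormedSpace ℝ Z] [FiniteDimensional ℝ Z]

theorem negIndex_le_of_injective {B : Y →L[ℝ] Y →L[ℝ] ℝ} {C : Z →L[ℝ] Z →L[ℝ] ℝ} {A : Y →ₗ[ℝ] Z}
    (hA : Function.Injective A) (h : ∀ x, C (A x) (A x) = B x x) : negIndex B ≤ negIndex C := by
  obtain ⟨U, hU, hneg⟩ := exists_finrank_eq_negIndex B
  rw [← hU, ← LinearMap.finrank_range_of_inj (f := A.comp U.subtype)
    (hA.comp Subtype.val_injective)]
  refine le_negIndex ?_
  rintro _ ⟨x, rfl⟩ hx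
  rw [LinearMap.comp_apply, h]
  exact hneg x x.2 fun h0 => hx (by
    rw [LinearMap.comp_apply, Submodule.subtype_apply, h0, map_zero])

set_option maxSynthPendingDepth 6 in
theorem exists_sumForm {J : Type*} [Fintype J] (p m : J → Y →L[ℝ] ℝ) :
    ∃ D : (J → ℝ) →L[ℝ] Y →L[ℝ] Y →L[ℝ] ℝ, ∀ γ x y,
      D γ x y = ∑ j, γ j * (p j x * p j y - m j x * m j y) := by
  refine ⟨∑ j, (ContinuousLinearMap.proj (R := ℝ) (φ := fun _ : J => ℝ) j).smulRight
    ((p j).smulRight (p j) - (m j).smulRight (m j)), fun γ x y => ?_⟩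
  simp only [sum_apply]
  exact Finset.sum_congr rfl fun j _ => by simp

end Transport

/-- A solution that vanishes on an open set has zero Cauchy data there and so vanishes everywhere.
-/
theorem dense_compl_zeros {q : ℝ → ℝ} {a b μ : ℝ} {f f' : ℝ → ℝ} (hab : a < b)
    (hq : IsPotential q a b) (hf : IsSol (fun x => q x - μ) a b f f')
    (h0 : ∃ x ∈ Set.Icc a b, f x ≠ 0) : Dense {x | x ∈ Set.Ioo a b ∧ f x = 0}ᶜ := by
  rw [← interior_eq_empty_iff_dense_compl, Set.eq_empty_iff_forall_notMem]
  intro x hx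
  have hxI : x ∈ Set.Icc a b := Set.Ioo_subset_Icc_self (interior_subset hx).1
  have hd : HasDerivAt f (f' x) x := (hf.toIsC1.hasDerivWithinAt hxI).hasDerivAt
    (Icc_mem_nhds (interior_subset hx).1.1 (interior_subset hx).1.2)
  have hd0 : HasDerivAt f 0 x := (hasDerivAt_const x (0 : ℝ)).congr_of_eventuallyEq (by
    filter_upwards [mem_interior_iff_mem_nhds.mp hx] with y hy using hy.2)
  obtain ⟨y, hy, hy0⟩ := h0
  obtain ⟨F⟩ := nonempty_fundSys hab hq
  refine hy0 ?_
  rw [F.eq_of_cauchy hab hq hf hxI hy (interior_subset hx).2, hd.unique hd0, zero_mul]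

theorem Filter.EventuallyEq.isNondegenerateCriticalPoint {X : Type*} [NormedAddCommGroup X]
    [NormedSpace ℝ X] {Λ Λ' : X → ℝ} {x : X} (h : Λ' =ᶠ[𝓝 x] Λ)
    (hΛ : IsNondegenerateCriticalPoint Λ x) :
    IsNondegenerateCriticalPoint Λ' x ∧ morseIndex Λ' x = morseIndex Λ x := by
  have h1 : hessianAt Λ' x = hessianAt Λ x := by
    rw [hessianAt, hessianAt, h.fderiv.fderiv_eq]
  refine ⟨⟨hΛ.1.congr_of_eventuallyEq h, by rw [h.fderiv_eq]; exact hΛ.2.1, by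
    rw [h1]; exact hΛ.2.2⟩, by rw [morseIndex, morseIndex, h1]⟩

/-! ### The forms of the cut graph for varying `γ`, and the matching subspace. -/

namespace QuantumGraph

section Reduction

variable {V E : Type*} [DecidableEq V] [Fintype E] [Fintype V] [DecidableEq E]
  {G H : QuantumGraph V E} {L : Submodule ℝ (V → ℝ)} {K : ℝ} {m : Mesh E K}

set_option maxSynthPendingDepth 6 in
/-- The reduction of the eigenfunctions of `H` to the nodal space of a graph with the same
incidences. -/
theorem exists_isReduction_of_eq (hm : m.Fits H) (hsrc : H.src = G.src) (htgt : H.tgt = G.tgt)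
    (hcov : ∀ v, ∃ e, H.src e = v ∨ H.tgt e = v) {𝓔 : ℝ → Submodule ℝ (E → ℝ → ℝ)}
    (h𝓔 : ∀ μ f, f ∈ 𝓔 μ ↔ ∃ F, H.IsEigen L μ f F) :
    ∃ τ : (E → ℝ → ℝ) →ₗ[ℝ] G.NodalSpace m L, IsReduction K 𝓔 τ fun μ =>
      (m.nodalForm H.χ μ).bilinearComp (G.nodalIncl L m) (G.nodalIncl L m) := by
  have hsp : H.nodalSpace m L = G.nodalSpace m L := by
    ext y
    rw [mem_nodalSpace, mem_nodalSpace, hsrc, htgt]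
  obtain ⟨τ, hτ, -⟩ := exists_isReduction (L := L) hm hcov h𝓔
  have key : ∃ τ : (E → ℝ → ℝ) →ₗ[ℝ] ↥(H.nodalSpace m L), IsReduction K 𝓔 τ fun μ =>
      (m.nodalForm H.χ μ).bilinearComp (H.nodalSpace m L).subtypeL (H.nodalSpace m L).subtypeL :=
    ⟨τ, hτ⟩
  rw [hsp] at key
  exact key

theorem exists_mem_nodalSpace {F : V → ℝ} (hF : F ∈ L) :
    ∃ y ∈ G.nodalSpace m L, y.1 = F := by
  refine ⟨(F, fun e i => if i = 0 then F (G.src e) else if i = Fin.last _ then F (G.tgt e) else 0),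
    ⟨hF, fun e => ⟨by simp, ?_⟩⟩, rfl⟩
  have : Fin.last m.N ≠ 0 := fun h0 => by
    have := congrArg Fin.val h0
    have hN := m.N_pos e
    simp at this
    omega
  simp [this]

end Reduction

section Main

variable {V E : Type*} [Fintype V] [DecidableEq V] [Fintype E] [DecidableEq E]
  {G : QuantumGraph V E} {S : Finset E} {c : {e // e ∉ S} → ℝ}
  {hc : ∀ j : {e // e ∉ S}, c j ∈ Set.Ioo (G.lo j) (G.hi j)} {γ₀ : {e // e ∉ S} → ℝ}
  {K : ℝ} {m : Mesh ({e // e ∈ S} ⊕ {e // e ∉ S} ⊕ {e // e ∉ S}) K}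

/-- The value at one side of a cut. -/
noncomputable def cutPlus (m : Mesh ({e // e ∈ S} ⊕ {e // e ∉ S} ⊕ {e // e ∉ S}) K)
    (hc : ∀ j : {e // e ∉ S}, c j ∈ Set.Ioo (G.lo j) (G.hi j)) (γ₀ : {e // e ∉ S} → ℝ)
    (j : {e // e ∉ S}) :
    (G.cut S c hc γ₀).NodalSpace m (G.cut S c hc γ₀).dirSpace →L[ℝ] ℝ :=
  (m.vertex (.inr (.inr j))).comp ((G.cut S c hc γ₀).nodalIncl _ m)

/-- The value at the other side of a cut. -/
noncomputable def cutMinus (m : Mesh ({e // e ∈ S} ⊕ {e // e ∉ S} ⊕ {e // e ∉ S}) K)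
    (hc : ∀ j : {e // e ∉ S}, c j ∈ Set.Ioo (G.lo j) (G.hi j)) (γ₀ : {e // e ∉ S} → ℝ)
    (j : {e // e ∉ S}) :
    (G.cut S c hc γ₀).NodalSpace m (G.cut S c hc γ₀).dirSpace →L[ℝ] ℝ :=
  (m.vertex (.inr (.inl j))).comp ((G.cut S c hc γ₀).nodalIncl _ m)

/-- The parameter enters only through the vertex coefficients at the cuts, so all forms live on the
nodal space at `γ₀` and are affine in `γ`. -/
theorem nodalForm_cut (γ : {e // e ∉ S} → ℝ) (μ : ℝ)
    (x y : (G.cut S c hc γ₀).NodalSpace m (G.cut S c hc γ₀).dirSpace) :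
    m.nodalForm (G.cut S c hc γ).χ μ ((G.cut S c hc γ₀).nodalIncl _ m x)
      ((G.cut S c hc γ₀).nodalIncl _ m y) =
    (G.cut S c hc γ₀).reducedForm m (G.cut S c hc γ₀).dirSpace μ x y +
      ∑ j, (γ - γ₀) j * (cutPlus m hc γ₀ j x * cutPlus m hc γ₀ j y -
        cutMinus m hc γ₀ j x * cutMinus m hc γ₀ j y) := by
  have hχ1 : ∀ γ v, (G.cut S c hc γ).χ (.inl v) = G.χ v := fun _ _ => rfl
  have hχ2 : ∀ γ j, (G.cut S c hc γ).χ (.inr (.inl j)) = -γ j := fun _ _ => rfl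
  have hχ3 : ∀ γ j, (G.cut S c hc γ).χ (.inr (.inr j)) = γ j := fun _ _ => rfl
  have hp : ∀ j x, cutPlus m hc γ₀ j x = ((G.cut S c hc γ₀).nodalIncl _ m x).1 (.inr (.inr j)) :=
    fun _ _ => rfl
  have hm : ∀ j x, cutMinus m hc γ₀ j x = ((G.cut S c hc γ₀).nodalIncl _ m x).1 (.inr (.inl j)) :=
    fun _ _ => rfl
  rw [reducedForm_apply, Mesh.nodalForm_apply, Mesh.nodalForm_apply]
  simp only [Fintype.sum_sum_type, hχ1, hχ2, hχ3, hp, hm, Pi.sub_apply, sub_mul, mul_sub,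
    Finset.sum_sub_distrib, neg_mul, Finset.sum_neg_distrib]
  ring

/-- Since the eigenvalue is simple, exactly `n - 1` eigenvalues lie below it. The complex counts are
turned into real ones, and the injective `ρ` carries the eigenspaces to the cut graph. -/
theorem negIndex_add_one_of_isNthEigenvalue {X Y : Type*} [AddCommGroup X] [Module ℝ X]
    [NormedAddCommGroup Y] [NormedSpace ℝ Y] [FiniteDimensional ℝ Y] {ρ : (E → ℝ → ℝ) →ₗ[ℝ] X}
    (hρ : Function.Injective ρ) {τ : X →ₗ[ℝ] Y} {R : ℝ → Y →L[ℝ] Y →L[ℝ] ℝ}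
    (hτ : IsReduction K (fun μ => (G.eigenspace ℝ μ).map ρ) τ R) {ξ : ℝ} (hξ : ξ < K) {n : ℕ}
    (hn : G.IsNthEigenvalue ℂ n ξ) (hsimple : Module.finrank ℂ (G.eigenspace ℂ ξ) = 1) :
    negIndex (R ξ) + 1 = n ∧ Module.finrank ℝ (G.eigenspace ℝ ξ) = 1 := by
  have hmap : ⨆ ν ∈ Set.Iio ξ, (G.eigenspace ℝ ν).map ρ =
      (⨆ ν ∈ Set.Iio ξ, G.eigenspace ℝ ν).map ρ := by
    simp only [Submodule.map_iSup]
  have h1 := hτ.finite_iSup_Iio hξ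
  have h2 := hτ.finrank_iSup_Iio hξ
  rw [hmap] at h1 h2
  have h3 : Module.Finite ℝ ↥(⨆ ν ∈ Set.Iio ξ, G.eigenspace ℝ ν) :=
    Module.Finite.equiv (Submodule.equivMapOfInjective ρ hρ _).symm
  rw [← (Submodule.equivMapOfInjective ρ hρ _).finrank_eq] at h2
  have h4 : Module.Finite ℝ (G.eigenspace ℝ ξ) := by
    have := hτ.finite hξ
    exact Module.Finite.equiv (Submodule.equivMapOfInjective ρ hρ _).symm
  rw [finrank_eigenspace_complex] at hsimple
  have h5 : Module.Finite ℝ ↥(⨆ ν ∈ Set.Iic ξ, G.eigenspace ℝ ν) := by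
    rw [iSup_Iic_eq]
    infer_instance
  have h6 : Module.finrank ℝ ↥(⨆ ν ∈ Set.Iic ξ, G.eigenspace ℝ ν) ≤ negIndex (R ξ) + 1 := by
    rw [iSup_Iic_eq, ← h2, ← hsimple]
    exact Submodule.finrank_add_le_finrank_add_finrank _ _
  obtain ⟨h7, h8⟩ := hn
  rw [eigenvalueCount_complex, h2, Nat.cast_lt] at h7
  rw [eigenvalueCount_complex, Nat.cast_le] at h8
  exact ⟨by omega, hsimple⟩

/-- The nodal vectors that agree at the two sides of each cut. -/
def matchSubmodule (m : Mesh ({e // e ∈ S} ⊕ {e // e ∉ S} ⊕ {e // e ∉ S}) K)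
    (hc : ∀ j : {e // e ∉ S}, c j ∈ Set.Ioo (G.lo j) (G.hi j)) (γ₀ : {e // e ∉ S} → ℝ) :
    Submodule ℝ ((G.cut S c hc γ₀).NodalSpace m (G.cut S c hc γ₀).dirSpace) where
  carrier := {x | ∀ j, cutPlus m hc γ₀ j x = cutMinus m hc γ₀ j x}
  add_mem' h₁ h₂ j := by rw [map_add, map_add, h₁ j, h₂ j]
  zero_mem' j := by rw [map_zero, map_zero]
  smul_mem' r x h j := by rw [map_smul, map_smul, h j]

theorem mem_matchSubmodule {x : (G.cut S c hc γ₀).NodalSpace m (G.cut S c hc γ₀).dirSpace} :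
    x ∈ matchSubmodule m hc γ₀ ↔ ∀ j, cutPlus m hc γ₀ j x = cutMinus m hc γ₀ j x := Iff.rfl

theorem nodalIncl_mem_match {x : (G.cut S c hc γ₀).NodalSpace m (G.cut S c hc γ₀).dirSpace}
    (hx : x ∈ matchSubmodule m hc γ₀) :
    (G.cut S c hc γ₀).nodalIncl _ m x ∈ (G.cut S c hc γ₀).nodalSpace m (G.matchSpace S) :=
  ⟨⟨mem_dirSpace_cut.mp (nodalIncl_mem x).1, hx⟩, (nodalIncl_mem x).2⟩

theorem nodalIncl_mem_dir (x : (G.cut S c hc γ₀).NodalSpace m (G.matchSpace S)) :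
    (G.cut S c hc γ₀).nodalIncl _ m x ∈
      (G.cut S c hc γ₀).nodalSpace m (G.cut S c hc γ₀).dirSpace :=
  ⟨mem_dirSpace_cut.mpr (nodalIncl_mem x).1.1, (nodalIncl_mem x).2⟩

theorem toNodal_mem_matchSubmodule (x : (G.cut S c hc γ₀).NodalSpace m (G.matchSpace S)) :
    toNodal (nodalIncl_mem_dir x) ∈ matchSubmodule m hc γ₀ :=
  (nodalIncl_mem x).1.2

/-- The matched vectors appear in two guises, as a subspace of the nodal space of the cut graph and
as the nodal space with vertex values in `matchSpace`. The form is the same on both. -/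
theorem negIndex_match (μ : ℝ) :
    negIndex (((G.cut S c hc γ₀).reducedForm m (G.cut S c hc γ₀).dirSpace μ).bilinearComp
      (matchSubmodule m hc γ₀).subtypeL (matchSubmodule m hc γ₀).subtypeL) =
    negIndex ((G.cut S c hc γ₀).reducedForm m (G.matchSpace S) μ) := by
  apply le_antisymm
  · let A : matchSubmodule m hc γ₀ →ₗ[ℝ] (G.cut S c hc γ₀).NodalSpace m (G.matchSpace S) :=
      { toFun := fun x => toNodal (nodalIncl_mem_match x.2)
        map_add' := fun x y => rfl
        map_smul' := fun r x => rfl }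
    refine negIndex_le_of_injective (A := A) (fun x y hxy => ?_) fun x => rfl
    exact Subtype.ext (nodalIncl_injective
      (congrArg ((G.cut S c hc γ₀).nodalIncl (G.matchSpace S) m) hxy))
  · let A : (G.cut S c hc γ₀).NodalSpace m (G.matchSpace S) →ₗ[ℝ] matchSubmodule m hc γ₀ :=
      { toFun := fun x => ⟨toNodal (nodalIncl_mem_dir x), toNodal_mem_matchSubmodule x⟩
        map_add' := fun x y => rfl
        map_smul' := fun r x => rfl }
    refine negIndex_le_of_injective (A := A) (fun x y hxy => ?_) fun x => rfl
    exact nodalIncl_injective (congrArg (fun x => nodalIncl _ _ _ x.1) hxy)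

end Main

end QuantumGraph

/-! ### Assembly of the Morse index formula. -/

namespace QuantumGraph

variable {V E : Type*} [Fintype V] [DecidableEq V] [Fintype E] [DecidableEq E]

theorem IsEigen.ne_zero_of_notMem_dir {G : QuantumGraph V E}
    (hcov : ∀ v, ∃ e, G.src e = v ∨ G.tgt e = v) {μ : ℝ} {f : E → ℝ → ℝ} {F : V → ℝ}
    (hf : G.IsEigen G.dirSpace μ f F) (hV : G.NonzeroOnVertices f) {v : V} (hv : v ∉ G.dir) :
    F v ≠ 0 := by
  obtain ⟨e, rfl | rfl⟩ := hcov v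
  · rw [← hf.left]; exact (hV e).1 hv
  · rw [← hf.right]; exact (hV e).2 hv

variable {G : QuantumGraph V E} {S : Finset E} {c : {e // e ∉ S} → ℝ}

/-- The interior nodes can avoid the zeros of `ψ`, whose complement is dense because `ψ` is not
identically zero on any edge. -/
theorem exists_cut_mesh (hc : ∀ j : {e // e ∉ S}, c j ∈ Set.Ioo (G.lo j) (G.hi j))
    (γ : {e // e ∉ S} → ℝ) (hS : G.IsSpanningTree S) {ξ : ℝ} {ψ : E → ℝ → ℝ} {F : V → ℝ}
    (hψ : G.IsEigen G.dirSpace ξ ψ F) (hψ0 : ψ ≠ 0) (hψV : G.NonzeroOnVertices ψ) (K : ℝ) :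
    ∃ m : Mesh ({e // e ∈ S} ⊕ {e // e ∉ S} ⊕ {e // e ∉ S}) K,
      m.Fits (G.cut S c hc γ) ∧ 1 < m.N ∧
      ∀ e i, i ≠ 0 → i ≠ Fin.last m.N → cutMap S c ψ e (m.t e i) ≠ 0 := by
  obtain ⟨m, hm, hN, hA⟩ := (G.cut S c hc γ).exists_mesh K
    (A := fun e => {x | x ∈ Set.Ioo (G.lo (cutEdge e)) (G.hi (cutEdge e)) ∧ ψ (cutEdge e) x = 0})
    fun e => dense_compl_zeros (G.lo_lt_hi _) (G.q_piecewise _).isPotential (hψ.sol _)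
      (hS.exists_ne_zero hψ hψ0 hψV _)
  refine ⟨m, hm, hN, fun e i h0 hl h => hA e i h0 hl ?_⟩
  have h1 : m.lo e < m.t e i := by
    rw [← m.t_zero]
    exact m.strictMono e (Fin.pos_iff_ne_zero.mpr h0)
  have h2 : m.t e i < m.hi e := by
    rw [← m.t_last]
    exact m.strictMono e (Fin.lt_last_iff_ne_last.mpr hl)
  rw [hm.lo] at h1
  rw [hm.hi] at h2
  rcases e with e | j | j
  · exact ⟨⟨h1, h2⟩, h⟩
  · have h2' : m.t (.inr (.inl j)) i < c j := h2
    rw [cutMap_minus, if_pos h2'.le] at h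
    exact ⟨⟨h1, h2'.trans (hc j).2⟩, h⟩
  · have h1' : c j < m.t (.inr (.inr j)) i := h1
    rw [cutMap_plus, if_pos h1'.le] at h
    exact ⟨⟨(hc j).1.trans h1', h2⟩, h⟩

-- `exists_branch` is applied to the nodal forms of the cut graph. The index of the full form is the
-- number of zeros, by diagonalisation on the tree; on the matched vectors it is `n - 1`, by
-- counting eigenvalues of the uncut graph.
set_option maxHeartbeats 1000000 in
theorem exists_morse_branch (hS : G.IsSpanningTree S)
    (hc : ∀ j : {e // e ∉ S}, c j ∈ Set.Ioo (G.lo j) (G.hi j)) {n : ℕ} {ξ : ℝ}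
    (hn : G.IsNthEigenvalue ℂ n ξ) (hsimple : Module.finrank ℂ (G.eigenspace ℂ ξ) = 1)
    {ψ : E → ℝ → ℝ} (hψ : ψ ∈ G.eigenspace ℝ ξ) (hψ0 : ψ ≠ 0) (hψV : G.NonzeroOnVertices ψ)
    (hψc : ∀ j : {e // e ∉ S}, ψ j (c j) ≠ 0) {γ₀ : {e // e ∉ S} → ℝ}
    (hγ₀ : ∀ j, γ₀ j = G.edgeDeriv ψ j (c j) / ψ j (c j)) :
    (G.internalZeros ψ).Finite ∧ ∃ Λ : ({e // e ∉ S} → ℝ) → ℝ,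
      IsNondegenerateCriticalPoint Λ γ₀ ∧ Λ γ₀ = ξ ∧
      (morseIndex Λ γ₀ : ℤ) =
        n - 1 + Fintype.card {e // e ∉ S} - (G.internalZeros ψ).ncard ∧
      ∀ᶠ γ in 𝓝 γ₀, (G.cut S c hc γ).IsNthEigenvalue ℝ ((G.internalZeros ψ).ncard + 1) (Λ γ) := by
  classical
  obtain ⟨F, hψE⟩ := G.mem_eigenspace_iff.mp hψ
  obtain ⟨e₀, -⟩ := Function.ne_iff.mp hψ0
  have hE : Nonempty E := ⟨e₀⟩
  have hcovG := hS.covers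
  have hcov := fun γ => covers_cut (c := c) (hc := hc) (γ := γ) hcovG
  obtain ⟨m, hm, hN, hnode⟩ := exists_cut_mesh hc γ₀ hS hψE hψ0 hψV (ξ + 1)
  have hm' : ∀ γ, m.Fits (G.cut S c hc γ) := fun γ => ⟨hm.lo, hm.hi, hm.q⟩
  have hξ : ξ < ξ + 1 := lt_add_one ξ
  set T := G.cut S c hc γ₀ with hT
  set w := cutMap S c ψ with hw
  set W := cutValues c ψ F with hW
  -- the eigenfunction on the cut graph
  have hwE : T.IsEigen T.dirSpace ξ w W := hψE.cutMap_of_eq fun j => by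
    rw [hγ₀ j, div_mul_cancel₀ _ (hψc j)]
  have hwE₀ : T.IsEigen (G.matchSpace S) ξ w W := hψE.cutMap
  have hw0 : w ≠ 0 := fun h => hψ0 (cutMap_injective (h.trans (map_zero _).symm))
  have hW0 : ∀ v ∉ T.dir, W v ≠ 0 := by
    rintro (v | j | j) hv
    · exact hψE.ne_zero_of_notMem_dir hcovG hψV fun h => hv ⟨v, h, rfl⟩
    · exact hψc j
    · exact hψc j
  obtain ⟨hfin, hcard⟩ := internalZeros_finite_ncard hm hξ.le hwE hnode hN
  obtain ⟨himg, hinj⟩ := internalZeros_cut (hc := hc) (γ := γ₀) hψc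
  have hfinG : (G.internalZeros ψ).Finite := himg ▸ hfin.image _
  have hncard : (G.internalZeros ψ).ncard = (T.internalZeros w).ncard := by
    rw [← himg, hinj.ncard_image]
  refine ⟨hfinG, ?_⟩
  -- the reduced form at `γ₀` and its kernel
  have hdiag := reducedForm_eq_diagonal hm hξ.le hwE hW0 hnode
  choose u hu using exists_pieceIncr_dual (F := W) hm hwE
    (hS.exists_potential_cut (c := c) (hc := hc) (γ := γ₀))
  have hneg : negIndex (T.reducedForm m T.dirSpace ξ) = (G.internalZeros ψ).ncard := by
    rw [negIndex_diagonal hdiag hu, hncard, hcard]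
  have hmemY := hwE.nodalValues_mem hm
  set y : T.NodalSpace m T.dirSpace := toNodal hmemY with hy
  have hyincl : T.nodalIncl _ m y = nodalValues m w W := rfl
  have hker : ∀ x, T.reducedForm m T.dirSpace ξ x = 0 → ∃ a : ℝ, x = a • y := by
    intro x hx
    obtain ⟨a, ha⟩ := eq_smul_of_pieceIncr_eq_zero hm hwE hW0 hnode hN (hcov γ₀)
      (hS.constant_cut (c := c) (hc := hc) (γ := γ₀))
      (fun p hp => eq_zero_of_diagonal hdiag hu hx hp) hξ.le
    refine ⟨a, nodalIncl_injective ?_⟩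
    rw [map_smul, ha, hyincl]
  have hyker : T.reducedForm m T.dirSpace ξ y = 0 := by
    ext z
    exact hwE.nodalForm_eq_zero hm hξ.le (nodalIncl_mem z)
  -- the reduction with matching conditions
  obtain ⟨τ₀, hτ₀, hτ₀'⟩ := exists_isReduction (L := G.matchSpace S) hm (hcov γ₀)
    (𝓔 := fun μ => (G.eigenspace ℝ μ).map (cutMap S c)) fun μ f => mem_map_cutMap_iff
  obtain ⟨hn1, hsimpleR⟩ := negIndex_add_one_of_isNthEigenvalue cutMap_injective hτ₀ hξ hn hsimple
  have hspan : ∀ f ∈ G.eigenspace ℝ ξ, ∃ a : ℝ, f = a • ψ := by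
    intro f hf
    obtain ⟨a, ha⟩ := exists_smul_eq_of_finrank_eq_one hsimpleR (x := ⟨ψ, hψ⟩)
      (fun h => hψ0 (congrArg Subtype.val h)) ⟨f, hf⟩
    exact ⟨a, (congrArg Subtype.val ha).symm⟩
  -- the family of forms
  obtain ⟨D, hD⟩ := exists_sumForm (cutPlus m hc γ₀) (cutMinus m hc γ₀)
  -- Subtracting `D γ₀` makes the form of the cut graph with parameter `γ` equal to `R μ + D γ`,
  -- linear in `γ` apart from `R`.
  set R : ℝ → T.NodalSpace m T.dirSpace →L[ℝ] T.NodalSpace m T.dirSpace →L[ℝ] ℝ :=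
    fun μ => T.reducedForm m T.dirSpace μ - D γ₀ with hR
  have hRD : ∀ μ, R μ + D γ₀ = T.reducedForm m T.dirSpace μ := by
    intro μ
    ext x z
    rw [hR, add_apply, add_apply, sub_apply, sub_apply]
    ring
  have hRγ : ∀ μ γ, (m.nodalForm (G.cut S c hc γ).χ μ).bilinearComp (T.nodalIncl T.dirSpace m)
      (T.nodalIncl T.dirSpace m) = R μ + D γ := by
    intro μ γ
    ext x z
    have h1 := nodalForm_cut (m := m) (hc := hc) (γ₀ := γ₀) γ μ x z
    have h2 := hD (γ - γ₀) x z
    rw [map_sub, sub_apply, sub_apply] at h2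
    rw [← h2] at h1
    rw [hR, add_apply, add_apply, sub_apply, sub_apply]
    exact h1.trans (by ring)
  have hred : ∀ γ, ∃ τ : _ →ₗ[ℝ] T.NodalSpace m T.dirSpace,
      IsReduction (ξ + 1) ((G.cut S c hc γ).eigenspace ℝ) τ fun μ => R μ + D γ := by
    intro γ
    obtain ⟨τ, hτ⟩ := exists_isReduction_of_eq (G := T) (H := G.cut S c hc γ) (L := T.dirSpace)
      (hm' γ) rfl rfl (hcov γ) (𝓔 := (G.cut S c hc γ).eigenspace ℝ)
      fun μ f => (G.cut S c hc γ).mem_eigenspace_iff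
    refine ⟨τ, ?_⟩
    have h1 : (fun μ => (m.nodalForm (G.cut S c hc γ).χ μ).bilinearComp
      (T.nodalIncl T.dirSpace m) (T.nodalIncl T.dirSpace m)) = fun μ => R μ + D γ :=
      funext fun μ => hRγ μ γ
    rw [← h1]
    exact hτ
  have hsymm : ∀ μ x z, R μ x z = R μ z x := by
    intro μ x z
    rw [hR]
    simp only [sub_apply, hD, reducedForm_apply]
    rw [m.nodalForm_symm]
    congr 1
    exact Finset.sum_congr rfl fun j _ => by ring
  have hRd : ContDiffAt ℝ 3 R ξ := (contDiffAt_reducedForm hξ).sub contDiffAt_const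
  have hderiv : deriv R ξ y y < 0 := by
    have h1 : deriv R ξ = deriv (T.reducedForm m T.dirSpace) ξ :=
      deriv_sub_const (f := T.reducedForm m T.dirSpace) (D γ₀)
    rw [h1]
    have h2 := deriv_bilinearComp (m.contDiffAt_nodalForm T.χ hξ) (T.nodalIncl T.dirSpace m) y
    exact h2.trans_lt (hwE.deriv_nodalForm_neg hm hξ hw0)
  obtain ⟨Λ, hΛ, hΛ0, hmorse, hev⟩ := exists_branch hsymm hRd D (cutPlus m hc γ₀)
    (cutMinus m hc γ₀) hD (γ₀ := γ₀) (ψ := y)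
    (fun h => by
      rw [h] at hderiv
      simp at hderiv)
    (by rw [hRD]; exact hyker) (by rw [hRD]; exact hker) hderiv (fun j => rfl) (fun j => hψc j)
    -- A nodal vector with values `0` on the minus sides and `v` on the plus sides realises the
    -- prescribed jumps.
    (fun v => by
      obtain ⟨z, hz, hz1⟩ := exists_mem_nodalSpace (G := T) (m := m) (L := T.dirSpace)
        (F := Sum.elim 0 (Sum.elim 0 v)) (mem_dirSpace_cut.mpr fun _ _ => rfl)
      refine ⟨toNodal hz, fun j => ?_⟩
      change z.1 (.inr (.inr j)) - z.1 (.inr (.inl j)) = v j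
      rw [hz1]
      simp)
    (matchSubmodule m hc γ₀) (fun x => mem_matchSubmodule)
    -- A kernel vector on the matched space is the trace of an eigenfunction of the uncut graph,
    -- which is a multiple of `ψ` by simplicity.
    (by
      rw [hRD]
      intro x hx hxz
      obtain ⟨f, ⟨g, hg, rfl⟩, hf⟩ := hτ₀.exists_trace ξ hξ (toNodal (nodalIncl_mem_match hx)) (by
        ext z
        exact hxz _ (toNodal_mem_matchSubmodule z))
      obtain ⟨a, rfl⟩ := hspan g hg
      refine ⟨a, nodalIncl_injective ?_⟩
      have h1 := congrArg (T.nodalIncl (G.matchSpace S) m) hf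
      rw [map_smul, map_smul, map_smul, hτ₀' ξ w W hwE₀, nodalIncl_toNodal] at h1
      rw [map_smul, hyincl, h1])
  refine ⟨Λ, hΛ, hΛ0, ?_, ?_⟩
  · rw [hmorse, hRD, hneg, negIndex_match]
    push_cast [← hn1]
    ring
  -- Near `γ₀` the index at `Λ γ` remains the number of zeros and the kernel is non-trivial, so `Λ
  -- γ` carries the next eigenvalue number. The reduction is valid only below `ξ + 1`.
  · have hcont : ∀ᶠ γ in 𝓝 γ₀, Λ γ < ξ + 1 :=
      hΛ.1.continuousAt.eventually (gt_mem_nhds (by rw [hΛ0]; exact hξ))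
    filter_upwards [hev, hcont] with γ ⟨⟨x, hx0, hx⟩, hγ⟩ hlt
    obtain ⟨τ, hτ⟩ := hred γ
    rw [isNthEigenvalue_iff hτ hlt]
    rw [hγ, hRD, hneg]
    refine ⟨Nat.lt_succ_self _, Nat.add_le_add_left ?_ _⟩
    rw [Nat.succ_le_iff, Module.finrank_pos_iff_exists_ne_zero]
    exact ⟨⟨x, hx⟩, fun h => hx0 (congrArg Subtype.val h)⟩

end QuantumGraph

end

theorem mainTheorem2 {V E : Type*} [Fintype V] [DecidableEq V] [Fintype E] [DecidableEq E]
    (G : QuantumGraph V E)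
    -- a spanning tree, and a cut point in the interior of every other edge
    (S : Finset E) (hS : G.IsSpanningTree S)
    (c : {e // e ∉ S} → ℝ) (hc : ∀ j : {e // e ∉ S}, c j ∈ Set.Ioo (G.lo j) (G.hi j))
    -- a simple eigenvalue `ξ = λ_n(H⁰)` and its (real) eigenfunction
    (n : ℕ) (ξ : ℝ) (hn : G.IsNthEigenvalue ℂ n ξ)
    (hsimple : Module.finrank ℂ (G.eigenspace ℂ ξ) = 1)
    (ψ : E → ℝ → ℝ) (hψ : ψ ∈ G.eigenspace ℝ ξ) (hψ0 : ψ ≠ 0)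
    (hψV : G.NonzeroOnVertices ψ) (hψc : ∀ j : {e // e ∉ S}, ψ j (c j) ≠ 0)
    (φ : ℕ) (hφ : φ = (G.internalZeros ψ).ncard)
    (γ' : {e // e ∉ S} → ℝ) (hγ' : ∀ j, γ' j = G.edgeDeriv ψ j (c j) / ψ j (c j)) :
    (G.internalZeros ψ).Finite ∧
    ∃ Λ : ({e // e ∉ S} → ℝ) → ℝ,
      (∀ γ, (G.cut S c hc γ).IsNthEigenvalue ℝ (φ + 1) (Λ γ)) ∧
      Λ γ' = ξ ∧
      IsNondegenerateCriticalPoint Λ γ' ∧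
      (morseIndex Λ γ' : ℤ) = n - 1 + G.betti - φ := by
  subst hφ
  obtain ⟨e₀, -⟩ := Function.ne_iff.mp hψ0
  have : Nonempty V := ⟨G.src e₀⟩
  have : Nonempty E := ⟨e₀⟩
  obtain ⟨hfin, Λ₁, hΛ, hΛ0, hm, hev⟩ :=
    QuantumGraph.exists_morse_branch hS hc hn hsimple hψ hψ0 hψV hψc hγ'
  have hex : ∀ γ, ∃ r, (G.cut S c hc γ).IsNthEigenvalue ℝ ((G.internalZeros ψ).ncard + 1) r := by
    intro γ
    have : Nonempty ({e // e ∈ S} ⊕ ({e // e ∉ S} ⊕ {e // e ∉ S})) := by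
      by_cases he : e₀ ∈ S
      · exact ⟨Sum.inl ⟨e₀, he⟩⟩
      · exact ⟨Sum.inr (Sum.inl ⟨e₀, he⟩)⟩
    exact QuantumGraph.exists_isNthEigenvalue (G.cut S c hc γ)
      (QuantumGraph.covers_cut hS.covers) (Nat.succ_pos _)
  choose Λ hΛn using hex
  -- The globally defined eigenvalue function agrees near `γ'` with the smooth branch because an
  -- eigenvalue is determined by its number; critical point and Morse index depend only on the germ.
  have heq : Λ =ᶠ[nhds γ'] Λ₁ := by
    filter_upwards [hev] with γ hγ
    exact (hΛn γ).unique hγ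
  obtain ⟨hcrit, hidx⟩ := heq.isNondegenerateCriticalPoint hΛ
  refine ⟨hfin, Λ, hΛn, heq.eq_of_nhds.trans hΛ0, hcrit, ?_⟩
  rw [hidx, hm, hS.betti_eq]
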